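/- Let $\mathbb{T}^2=\mathbb{C}/(\mathbb{Z}\oplus\mathbb{Z}i)$. For $d\ge 1$ and $v\in\mathbb{C}$ let $\#^d_v(\mathbb{T}^2,dz)$ be the connected sum of $d$ copies of $(\mathbb{T}^2,dz)$ along the projection of the segment $[0,v]$: the copies, indexed by $\mathbb{Z}/d$, are slit along the segment and reglued so that crossing the slit from its left side to its right side leads from sheet $j$ to sheet $j+1$ (segments that do not project injectively being counted with multiplicity), and the $d$ copies of each end point of the segment are identified. It has two named singular points $p_0,p_1$, over $[0]$ and $[v]$ (one point if $[v]=[0]$), and the shift of sheets generates an action of $\mathbb{Z}/d$. A ($d$-)symmetric differential $(Y,\tau)$ over $\mathbb{T}^2$ is a holomorphic differential on a compact connected surface with period lattice $\mathbb{Z}\oplus\mathbb{Z}i$ and exactly two zeros $p_0\neq p_1$, both of order $d-1$ (two marked points if $d=1$), of degree $d$ over $\mathbb{T}^2$, and with a cyclic group of order $d$ of translation automorphisms fixing $p_0$ and $p_1$. We also admit degenerate $d$-symmetric differentials, $d\ge2$, in which $p_0=p_1$: compact connected spaces of degree $d$ over $\mathbb{T}^2$ that are translation surfaces away from the one singular point,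 that near this point consist of $d$ discs joined at their centres, and that carry a cyclic group of order $d$ of translation automorphisms fixing the singular point and acting transitively on the fibres over $\mathbb{T}^2$. In general, a differential is called degenerate if some singular point has a connected open neighbourhood which, after removal of that point, is a disjoint union of at least two punctured discs. The Veech group of a differential with named singular points is the set of linear parts in $\mathrm{SL}_2(\mathbb{R})$ of its affine homeomorphisms fixing each named singular point; for a degenerate $d$-symmetric differential the affine homeomorphisms are moreover required to commute with the cyclic symmetry. **Corollary.** Let $g\ge 1$ and $n\ge 2$ be natural numbers. There is a $g$-symmetric differential, possibly degenerate, whose Veech group is $$\Gamma_1(n)=\left\{\begin{pmatrix}a&b\\c&d\end{pmatrix}\in \mathrm{SL}_2(\mathbb{Z}):\ a\equiv d\equiv 1,\ c\equiv 0 \bmod n\right\}.$$ An example is $Y=\#^g_{g/n}(\mathbb{T}^2,dz)$. More precisely: 1. the linear parts of the affine homeomorphisms of $Y$ that fix $p_0$ and $p_1$ and commute with the cyclic symmetry form $\Gamma_1(n)$; 2. if $n\nmid g$, then $Y$ is a non-degenerate $g$-symmetric differential, and its Veech group (without the requirement of commuting with the symmetry) is $\Gamma_1(n)$; 3. if $n\mid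 g$, then $Y$ is a degenerate $g$-symmetric differential; 4. $Y$ is degenerate if and only if $n\mid g$; 5. $Y$ represents the point $[g/n]\in\mathbb{C}/g(\mathbb{Z}\oplus\mathbb{Z}i)$: for $v\in\mathbb{C}$, $\#^g_v(\mathbb{T}^2,dz)$ is isomorphic to $Y$ (by a translation homeomorphism respecting $p_0$, $p_1$ and the cyclic symmetry) if and only if $v-g/n\in g(\mathbb{Z}\oplus\mathbb{Z}i)$. -/

import Mathlib

open scoped Topology MatrixGroups

noncomputable section

/-- The Gaussian lattice `ℤ ⊕ ℤ i` in `ℂ`. -/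
def gaussianLattice : AddSubgroup ℂ := AddSubgroup.closure {1, Complex.I}

/-- The square torus `𝕋² = ℂ / (ℤ ⊕ ℤ i)`. -/
abbrev SquareTorus : Type := ℂ ⧸ gaussianLattice

/-- The class in the square torus of a complex number. -/
def toTorus (z : ℂ) : SquareTorus := QuotientAddGroup.mk z

/-- The real linear action of a matrix in `SL(2, ℝ)` on `ℂ = ℝ²` (column vectors). -/
def linAct (A : SL(2, ℝ)) (h : ℂ) : ℂ :=
  ⟨A 0 0 * h.re + A 0 1 * h.im, A 1 0 * h.re + A 1 1 * h.im⟩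

/-- The underlying data of a (possibly degenerate) elliptic differential over the square torus
with two named singular points `p₀`, `p₁` (which may coincide) and a distinguished self-map `rot`.
The differential is the pull-back of `dz` under `proj`; a translation chart is a local inverse of
`ℂ → 𝕋²` composed with `proj`.  The laws are in `IsRegularSymmetric` and `IsDegenerateSymmetric`
below. -/
structure EllipticDifferential where
  carrier : Type
  top : TopologicalSpace carrier
  proj : carrier → SquareTorus
  p₀ : carrier
  p₁ : carrier
  rot : carrier → carrier

namespace EllipticDifferential

instance (Y : EllipticDifferential) : TopologicalSpace Y.carrier := Y.top

/-- The homeomorphism `f` from `Y` to `Z` respects the named singular points, and away from them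
it is affine with linear part `A` in translation charts. -/
def IsAffine {Y Z : EllipticDifferential} (A : SL(2, ℝ)) (f : Y.carrier → Z.carrier) : Prop :=
  IsHomeomorph f ∧ f Y.p₀ = Z.p₀ ∧ f Y.p₁ = Z.p₁ ∧
    ∀ x, x ≠ Y.p₀ → x ≠ Y.p₁ → ∀ᶠ y in 𝓝 x, ∃ h : ℂ, ‖h‖ < 1 / 2 ∧
      Y.proj y = Y.proj x + toTorus h ∧ Z.proj (f y) = Z.proj (f x) + toTorus (linAct A h)

/-- The Veech group of a differential with named cone points: the linear parts of its
orientation and area preserving affine homeomorphisms fixing each cone point. -/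
def veechGroup (Y : EllipticDifferential) : Set SL(2, ℝ) :=
  {A | ∃ f : Y.carrier → Y.carrier, IsAffine A f}

/-- The Veech group of a differential with named cone points and a cyclic symmetry: the linear
parts of the affine homeomorphisms that fix each cone point and commute with the symmetry. -/
def symmetricVeechGroup (Y : EllipticDifferential) : Set SL(2, ℝ) :=
  {A | ∃ f : Y.carrier → Y.carrier, IsAffine A f ∧ ∀ x, f (Y.rot x) = Y.rot (f x)}

/-- Isomorphism of differentials with named cone points and cyclic symmetry: a homeomorphism
which is a translation in translation charts, respects the names of the cone points, and is
equivariant. -/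
def Isomorphic (Y Z : EllipticDifferential) : Prop :=
  ∃ f : Y.carrier → Z.carrier, IsAffine 1 f ∧ ∀ x, f (Y.rot x) = Z.rot (f x)

/-- Near `s` the space is a surface with a coordinate `w`, `w(s) = 0`, in which the differential
is `d(w ^ (k + 1))`: a zero of order `k` (a regular point when `k = 0`). -/
def HasOrderAt (Y : EllipticDifferential) (s : Y.carrier) (k : ℕ) : Prop :=
  ∃ e : OpenPartialHomeomorph Y.carrier ℂ, s ∈ e.source ∧ e s = 0 ∧
    ∀ x ∈ e.source, Y.proj x = Y.proj s + toTorus (e x ^ (k + 1))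

/-- Some connected open neighbourhood of `s`, with `s` removed, is homeomorphic to the disjoint
union of `k` punctured discs. -/
def IsUnionOfDiscsAt (Y : EllipticDifferential) (s : Y.carrier) (k : ℕ) : Prop :=
  ∃ U : Set Y.carrier, IsOpen U ∧ IsConnected U ∧ s ∈ U ∧
    Nonempty ((U \ {s} : Set Y.carrier) ≃ₜ Fin k × {z : ℂ // 0 < ‖z‖ ∧ ‖z‖ < 1})

/-- A differential is degenerate if one of its singular points has a connected neighbourhood
which becomes, after removal of that point, a disjoint union of at least two punctured discs. -/
def IsDegenerate (Y : EllipticDifferential) : Prop :=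
  ∃ s, (s = Y.p₀ ∨ s = Y.p₁) ∧ ∃ k, 2 ≤ k ∧ Y.IsUnionOfDiscsAt s k

/-- The absolute periods: the integrals of the differential along closed paths.  The integral of
the pull-back of `dz` along `γ` is the difference of the end points of a lift of `proj ∘ γ`. -/
def periods (Y : EllipticDifferential) : Set ℂ :=
  {w | ∃ (γ : C(unitInterval, Y.carrier)) (γ' : C(unitInterval, ℂ)),
    γ 0 = γ 1 ∧ (∀ t, Y.proj (γ t) = toTorus (γ' t)) ∧ γ' 1 - γ' 0 = w}

/-- `rot` is a translation automorphism that fixes the named points and generates a cyclic group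
of order `d`. -/
def HasCyclicSymmetry (Y : EllipticDifferential) (d : ℕ) : Prop :=
  IsAffine (Y := Y) (Z := Y) 1 Y.rot ∧ ∀ k : ℕ, Y.rot^[k] = id ↔ d ∣ k

/-- The projection to the torus has degree `d`. -/
def HasDegree (Y : EllipticDifferential) (d : ℕ) : Prop :=
  ∀ z, z ≠ Y.proj Y.p₀ → z ≠ Y.proj Y.p₁ → (Y.proj ⁻¹' {z}).ncard = d

/-- A (non-degenerate) `d`-symmetric differential over the square torus: a differential on a
compact connected surface with period lattice `ℤ ⊕ ℤ i` and exactly two zeros, both of order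
`d - 1` (marked regular points when `d = 1`), with a cyclic group of order `d` of translation
automorphisms, and of degree `d` over the torus. -/
def IsRegularSymmetric (Y : EllipticDifferential) (d : ℕ) : Prop :=
  CompactSpace Y.carrier ∧ T2Space Y.carrier ∧ ConnectedSpace Y.carrier ∧
  Continuous Y.proj ∧ Y.periods = gaussianLattice ∧
  Y.p₀ ≠ Y.p₁ ∧ Y.HasOrderAt Y.p₀ (d - 1) ∧ Y.HasOrderAt Y.p₁ (d - 1) ∧
  (∀ x, x ≠ Y.p₀ → x ≠ Y.p₁ → Y.HasOrderAt x 0) ∧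
  Y.HasCyclicSymmetry d ∧ Y.HasDegree d

/-- A degenerate `d`-symmetric differential over the square torus: the two singular points have
collided to one totally degenerate point, a neighbourhood of which consists of `d` discs joined
at their centres; away from it there is a translation surface of degree `d` over the torus, and
the cyclic group of order `d` generated by `rot` permutes the points of each fibre
transitively. -/
def IsDegenerateSymmetric (Y : EllipticDifferential) (d : ℕ) : Prop :=
  CompactSpace Y.carrier ∧ T2Space Y.carrier ∧ ConnectedSpace Y.carrier ∧
  Continuous Y.proj ∧ 2 ≤ d ∧
  Y.p₀ = Y.p₁ ∧ Y.IsUnionOfDiscsAt Y.p₀ d ∧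
  (∀ x, x ≠ Y.p₀ → Y.HasOrderAt x 0) ∧
  Y.HasCyclicSymmetry d ∧ Y.HasDegree d ∧
  ∀ x y, Y.proj x = Y.proj y → ∃ k : ℕ, Y.rot^[k] x = y

end EllipticDifferential

namespace ConnectedSum

/-- The number of times that the projection to the torus of the open segment from `0` to `v`
passes through the point `z`. -/
def passes (v : ℂ) (z : SquareTorus) : ℕ :=
  {t : ℝ | 0 < t ∧ t < 1 ∧ toTorus (t * v) = z}.ncard

/-- The change of sheet when moving from `z` by a small vector `h`.  Points on the slit belong to
its left side; who leaves to the right of the slit moves up by one sheet for each passage of the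
segment. -/
def shift (v : ℂ) (z : SquareTorus) (h : ℂ) : ℕ :=
  open Classical in if (h / v).im < 0 then passes v z else 0

/-- The end points of the slit. -/
def IsEnd (v : ℂ) (z : SquareTorus) : Prop := z = toTorus 0 ∨ z = toTorus v

/-- In `d` copies of the torus, the copies of each end point of the slit are identified. -/
def setoid (d : ℕ) (v : ℂ) : Setoid (SquareTorus × ZMod d) where
  r p q := p.1 = q.1 ∧ (IsEnd v p.1 ∨ p.2 = q.2)
  iseqv :=
    { refl := fun _ => ⟨rfl, Or.inr rfl⟩
      symm := by
        rintro p q ⟨h, h2⟩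
        exact ⟨h.symm, h2.imp (fun a => h ▸ a) Eq.symm⟩
      trans := by
        rintro p q r ⟨h, h2⟩ ⟨k, k2⟩
        refine ⟨h.trans k, ?_⟩
        rcases h2 with h2 | h2
        · exact Or.inl h2
        · exact k2.imp (fun a => h.symm ▸ a) (fun b => h2.trans b) }

/-- The points of the connected sum of `d` tori along the segment from `0` to `v`. -/
def Space (d : ℕ) (v : ℂ) : Type := Quotient (setoid d v)

/-- The point over `z` in the sheet `j`. -/
def pt (d : ℕ) (v : ℂ) (z : SquareTorus) (j : ZMod d) : Space d v :=
  Quotient.mk (setoid d v) (z, j)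

/-- The topology of the connected sum: the sheets are slit along the segment and its opposite
sides are reglued, the right side in the sheet `j + m` with the left side in the sheet `j`, where
`m` is the number of passages of the segment.  So a small disc around a point `z` of the sheet `j`,
not an end of the slit, is `(z + h, j + shift v z h)`, and a small neighbourhood of an end consists
of the small discs around it in all the sheets. -/
instance (d : ℕ) (v : ℂ) : TopologicalSpace (Space d v) where
  IsOpen U := ∀ z j, pt d v z j ∈ U → ∃ ε > 0, ∀ h : ℂ, ‖h‖ < ε →
    (IsEnd v z → ∀ k, pt d v (z + toTorus h) k ∈ U) ∧
    (¬ IsEnd v z → pt d v (z + toTorus h) (j + (shift v z h : ℕ)) ∈ U)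
  isOpen_univ := fun _ _ _ =>
    ⟨1, one_pos, fun _ _ => ⟨fun _ _ => Set.mem_univ _, fun _ => Set.mem_univ _⟩⟩
  isOpen_inter := by
    intro U V hU hV z j hz
    obtain ⟨a, ha, hUa⟩ := hU z j hz.1
    obtain ⟨b, hb, hVb⟩ := hV z j hz.2
    refine ⟨min a b, lt_min ha hb, fun h hh => ?_⟩
    have h1 := hUa h (hh.trans_le (min_le_left _ _))
    have h2 := hVb h (hh.trans_le (min_le_right _ _))
    exact ⟨fun e k => ⟨h1.1 e k, h2.1 e k⟩, fun e => ⟨h1.2 e, h2.2 e⟩⟩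
  isOpen_sUnion := by
    intro S hS z j hz
    obtain ⟨U, hU, hzU⟩ := hz
    obtain ⟨a, ha, hUa⟩ := hS U hU z j hzU
    refine ⟨a, ha, fun h hh => ?_⟩
    have h1 := hUa h hh
    exact ⟨fun e k => ⟨U, hU, h1.1 e k⟩, fun e => ⟨U, hU, h1.2 e⟩⟩

end ConnectedSum

/-- The connected sum of `d` square tori along (the projection of) the segment from `0` to `v`,
with its projection to the torus, its singular points over the ends `0` and `v` of the segment, and
the cyclic shift of the sheets.  A segment that does not project injectively is counted with
multiplicity, which gives the limit of the surfaces of nearby segments that do project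
injectively. -/
def connectedSum (d : ℕ) (v : ℂ) : EllipticDifferential where
  carrier := ConnectedSum.Space d v
  top := inferInstance
  proj := Quotient.lift (fun p => p.1) (fun _ _ h => h.1)
  p₀ := ConnectedSum.pt d v (toTorus 0) 0
  p₁ := ConnectedSum.pt d v (toTorus v) 0
  rot := Quotient.map (fun p => (p.1, p.2 + 1))
    (fun _ _ h => ⟨h.1, h.2.imp id (fun e => congrArg (· + 1) e)⟩)

/-- The congruence group `Γ₁(n)`, as a set of real matrices. -/
def realGamma1 (n : ℕ) : Set SL(2, ℝ) :=
  ((CongruenceSubgroup.Gamma1 n).map (Matrix.SpecialLinearGroup.map (Int.castRingHom ℝ)) :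
    Subgroup SL(2, ℝ))

end

/-!
A connected sum of `d` tori is a family of sheets over the torus, with the regluing recorded by the
number of translates of the slit that are crossed. Two mechanisms decide everything about its maps.

*Constructing maps.* A function `c` of the points of the torus whose jumps are the differences of
the passages through two slits gives a homeomorphism `(z, j) ↦ (B z, j + c z)` (`Gluing`). For `B`
in `SL(2, ℤ)` and the slits `[0, v]` and `[0, B v]` the function `c = 0` will do. For `v` and
`v + d * k`, with `v` not horizontal, `c` is the number of lattice points, with sign, in the
triangle that the two slits span at a given point (`gluing_of_translate`); at the moving end this
number changes by a multiple of `d`, hence not at all. Rotating the picture and composing gives an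
isomorphism for slits that differ by `d` times a period (`exists_gluing_of_translate`). So a matrix
`B` with `B v - v ∈ d (ℤ ⊕ ℤ i)` is in the Veech group of the connected sum along `[0, v]`; for
`v = d / n` these are the matrices of `Γ₁(n)` (`mem_Gamma1_iff`).

*Excluding maps.* An affine homeomorphism covers an affine map of the torus once its projection does
not depend on the sheet. This is clear for equivariant maps, and when the two ends of the slit are
distinct it follows by comparing the vertical circles on both sides of an end: they differ by a
small loop around that end, whose monodromy is a single step from one sheet to the next
(`IsAffine.proj_indep_of_not_int`). The linear part is therefore an integral matrix `B`, and after
composition with the map of `B` there remains a map over the identity of the torus between the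
connected sums along `[0, B v]` and `[0, v]`. It intertwines the monodromies of horizontal and
vertical circles, which count the crossings with the slits; hence the end points of the slits, which
agree modulo the periods, agree modulo `d` times the periods (`SheetMap.eq_zero_of_equivariant`, and
`SheetMap.eq_zero_of_injective` without equivariance). The same argument classifies the isomorphisms
between connected sums (`isomorphic_iff`).

*The shape of the example.* The slit `[0, g / n]` is real. Its ends coincide if and only if `g / n`
is an integer. If it is not, the numbers of passages to the left and to the right of an end differ
by one, so that the branches of the `d`-th root fit together to a coordinate there
(`hasOrderAt_end`); a coordinate excludes a union of several discs
(`HasOrderAt.not_isUnionOfDiscsAt`). If it is an integer, a small loop around the end crosses the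
slit equally often in both directions, its monodromy is trivial, and a neighbourhood of the end
consists of `d` discs (`isUnionOfDiscsAt_p₀`).
-/

open Filter

noncomputable section

/-! ### The lattice and the torus -/

lemma mem_gaussianLattice {z : ℂ} :
    z ∈ gaussianLattice ↔ ∃ a b : ℤ, z.re = a ∧ z.im = b := by
  rw [gaussianLattice, AddSubgroup.mem_closure_pair]
  constructor
  · rintro ⟨a, b, rfl⟩
    exact ⟨a, b, by simp, by simp⟩
  · rintro ⟨a, b, ha, hb⟩
    exact ⟨a, b, Complex.ext (by simp [ha]) (by simp [hb])⟩

lemma toTorus_add (z w : ℂ) : toTorus (z + w) = toTorus z + toTorus w := rfl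

lemma toTorus_sub (z w : ℂ) : toTorus (z - w) = toTorus z - toTorus w := rfl

lemma toTorus_zero : toTorus 0 = 0 := rfl

lemma toTorus_eq_iff {z w : ℂ} : toTorus z = toTorus w ↔ z - w ∈ gaussianLattice := by
  rw [toTorus, toTorus, QuotientAddGroup.eq, ← neg_mem_iff]
  simp [sub_eq_add_neg, add_comm]

lemma toTorus_eq_iff_int {z w : ℂ} :
    toTorus z = toTorus w ↔ ∃ a b : ℤ, z.re - w.re = a ∧ z.im - w.im = b := by
  rw [toTorus_eq_iff, mem_gaussianLattice]
  simp

lemma toTorus_eq_zero_iff {z : ℂ} : toTorus z = 0 ↔ z ∈ gaussianLattice := by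
  rw [← toTorus_zero, toTorus_eq_iff, sub_zero]

lemma toTorus_surjective : Function.Surjective toTorus := QuotientAddGroup.mk_surjective

lemma continuous_toTorus : Continuous toTorus := continuous_quot_mk

lemma isOpenMap_toTorus : IsOpenMap toTorus := QuotientAddGroup.isOpenMap_coe

lemma map_toTorus_nhds (z : ℂ) : map toTorus (𝓝 z) = 𝓝 (toTorus z) :=
  isOpenMap_toTorus.map_nhds_eq continuous_toTorus.continuousAt

lemma gaussianLattice_countable : (gaussianLattice : Set ℂ).Countable := by
  refine (Set.countable_range (fun p : ℤ × ℤ => (⟨p.1, p.2⟩ : ℂ))).mono ?_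
  intro z hz
  obtain ⟨a, b, ha, hb⟩ := mem_gaussianLattice.1 hz
  exact ⟨(a, b), Complex.ext ha.symm hb.symm⟩

lemma isClosed_gaussianLattice : IsClosed (gaussianLattice : Set ℂ) := by
  have h : (gaussianLattice : Set ℂ) =
      Complex.re ⁻¹' Set.range ((↑) : ℤ → ℝ) ∩ Complex.im ⁻¹' Set.range ((↑) : ℤ → ℝ) := by
    ext z
    simp only [SetLike.mem_coe, mem_gaussianLattice, Set.mem_inter_iff, Set.mem_preimage,
      Set.mem_range]
    exact ⟨fun ⟨a, b, ha, hb⟩ => ⟨⟨a, ha.symm⟩, ⟨b, hb.symm⟩⟩,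
      fun ⟨⟨a, ha⟩, ⟨b, hb⟩⟩ => ⟨a, b, ha.symm, hb.symm⟩⟩
  rw [h]
  exact (Int.isClosedEmbedding_coe_real.isClosed_range.preimage Complex.continuous_re).inter
    (Int.isClosedEmbedding_coe_real.isClosed_range.preimage Complex.continuous_im)

instance : T2Space SquareTorus := by
  have : IsClosed (gaussianLattice : Set ℂ) := isClosed_gaussianLattice
  have : T3Space SquareTorus := QuotientAddGroup.instT3Space gaussianLattice
  infer_instance

/-- The representative of a point of the torus whose coordinates lie in `[-1/2, 1/2)`, up to the
choice at the boundary: a local inverse of the projection `ℂ → 𝕋²`. -/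
def centeredLift (u : SquareTorus) : ℂ :=
  ⟨(Quotient.out u).re - round (Quotient.out u).re, (Quotient.out u).im - round (Quotient.out u).im⟩

lemma toTorus_centeredLift (u : SquareTorus) : toTorus (centeredLift u) = u := by
  have h : toTorus (Quotient.out u) = u := Quotient.out_eq u
  conv_rhs => rw [← h]
  rw [toTorus_eq_iff_int]
  exact ⟨-round (Quotient.out u).re, -round (Quotient.out u).im, by simp [centeredLift],
    by simp [centeredLift]⟩

/-- Small complex numbers are determined by their class in the torus. -/
lemma eq_of_toTorus_eq {h k : ℂ} (hh : ‖h‖ < 1 / 2) (hk : ‖k‖ < 1 / 2)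
    (e : toTorus h = toTorus k) : h = k := by
  obtain ⟨a, b, ha, hb⟩ := toTorus_eq_iff_int.1 e
  have h1 : |h.re - k.re| < 1 := by
    have := abs_sub h.re k.re
    have := Complex.abs_re_le_norm h
    have := Complex.abs_re_le_norm k
    linarith
  have h2 : |h.im - k.im| < 1 := by
    have := abs_sub h.im k.im
    have := Complex.abs_im_le_norm h
    have := Complex.abs_im_le_norm k
    linarith
  rw [ha] at h1
  rw [hb] at h2
  have h3 : a = 0 := Int.abs_lt_one_iff.1 (by exact_mod_cast h1)
  have h4 : b = 0 := Int.abs_lt_one_iff.1 (by exact_mod_cast h2)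
  subst h3 h4
  exact Complex.ext (by simpa [sub_eq_zero] using ha) (by simpa [sub_eq_zero] using hb)

lemma centeredLift_toTorus {h : ℂ} (hh : ‖h‖ < 1 / 2) : centeredLift (toTorus h) = h := by
  obtain ⟨a, b, ha, hb⟩ := toTorus_eq_iff_int.1 (toTorus_centeredLift (toTorus h))
  have hr : |h.re| < 1 / 2 := (Complex.abs_re_le_norm h).trans_lt hh
  have hi : |h.im| < 1 / 2 := (Complex.abs_im_le_norm h).trans_lt hh
  have h1 : |(centeredLift (toTorus h)).re| ≤ 1 / 2 := abs_sub_round _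
  have h2 : |(centeredLift (toTorus h)).im| ≤ 1 / 2 := abs_sub_round _
  have h3 : |(a : ℝ)| < 1 := by
    rw [← ha]; have := abs_sub (centeredLift (toTorus h)).re h.re; linarith
  have h4 : |(b : ℝ)| < 1 := by
    rw [← hb]; have := abs_sub (centeredLift (toTorus h)).im h.im; linarith
  have h5 : a = 0 := Int.abs_lt_one_iff.1 (by exact_mod_cast h3)
  have h6 : b = 0 := Int.abs_lt_one_iff.1 (by exact_mod_cast h4)
  subst h5 h6
  exact Complex.ext (by simpa [sub_eq_zero] using ha) (by simpa [sub_eq_zero] using hb)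

lemma continuousAt_centeredLift {h : ℂ} (hh : ‖h‖ < 1 / 2) :
    ContinuousAt centeredLift (toTorus h) := by
  rw [ContinuousAt, ← map_toTorus_nhds, tendsto_map'_iff, centeredLift_toTorus hh]
  refine tendsto_id.congr' ?_
  filter_upwards [(isOpen_lt continuous_norm continuous_const).mem_nhds hh] with k hk
  exact (centeredLift_toTorus hk).symm

/-- Points of the torus near `z` are `z + h` for small `h`. -/
lemma eventually_exists_toTorus (z : SquareTorus) {ε : ℝ} (hε : 0 < ε) :
    ∀ᶠ u in 𝓝 z, ∃ h : ℂ, ‖h‖ < ε ∧ u = z + toTorus h := by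
  obtain ⟨z, rfl⟩ := toTorus_surjective z
  rw [← map_toTorus_nhds, eventually_map]
  filter_upwards [Metric.ball_mem_nhds z hε] with w hw
  exact ⟨w - z, by simpa [dist_eq_norm] using hw, by rw [← toTorus_add, add_sub_cancel]⟩

instance : CompactSpace SquareTorus := by
  refine ⟨?_⟩
  have h : IsCompact (toTorus '' Metric.closedBall 0 1) :=
    (isCompact_closedBall _ _).image continuous_toTorus
  convert h
  refine (Set.eq_univ_of_forall fun u => ?_).symm
  refine ⟨centeredLift u, ?_, toTorus_centeredLift u⟩
  have h1 : |(centeredLift u).re| ≤ 1 / 2 := abs_sub_round _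
  have h2 : |(centeredLift u).im| ≤ 1 / 2 := abs_sub_round _
  rw [mem_closedBall_zero_iff]
  linarith [Complex.norm_le_abs_re_add_abs_im (centeredLift u)]

/-! ### Locally constant functions -/

/-- A function on a preconnected set which is locally constant at each of its points takes a
single value there. -/
lemma eq_of_eventually_eq_const {X β : Type*} [TopologicalSpace X] {s : Set X}
    (hs : IsPreconnected s) {p : X → β} (hp : ∀ x ∈ s, ∀ᶠ y in 𝓝 x, p y = p x)
    {x y : X} (hx : x ∈ s) (hy : y ∈ s) : p x = p y := by
  have : PreconnectedSpace s := Subtype.preconnectedSpace hs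
  have h : IsLocallyConstant (fun x : s => p x) := by
    rw [IsLocallyConstant.iff_eventually_eq]
    intro x
    exact continuous_subtype_val.continuousAt.eventually (hp x x.2)
  exact h.apply_eq_of_preconnectedSpace ⟨x, hx⟩ ⟨y, hy⟩

lemma eventually_nhds_iff_add {z : ℂ} {p : ℂ → Prop} :
    (∀ᶠ w in 𝓝 z, p w) ↔ ∀ᶠ h in 𝓝 (0 : ℂ), p (z + h) := by
  have : map (fun h => z + h) (𝓝 (0 : ℂ)) = 𝓝 z := by
    simp
  rw [← this, eventually_map]

namespace ConnectedSum

variable {d : ℕ} {v : ℂ}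

lemma isEnd_toTorus_iff {v z : ℂ} :
    IsEnd v (toTorus z) ↔ z ∈ gaussianLattice ∨ z - v ∈ gaussianLattice := by
  rw [IsEnd, toTorus_eq_iff, toTorus_eq_iff, sub_zero]

lemma countable_ends (v : ℂ) : {z : ℂ | IsEnd v (toTorus z)}.Countable := by
  have : {z : ℂ | IsEnd v (toTorus z)} =
      (gaussianLattice : Set ℂ) ∪ (fun z => z + v) '' (gaussianLattice : Set ℂ) := by
    ext z
    simp only [isEnd_toTorus_iff, Set.mem_ofPred_eq, Set.mem_union, SetLike.mem_coe,
      Set.mem_image]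
    refine or_congr Iff.rfl ⟨fun h => ⟨_, h, by ring⟩, ?_⟩
    rintro ⟨w, hw, rfl⟩
    simpa using hw
  rw [this]
  exact gaussianLattice_countable.union (gaussianLattice_countable.image _)

lemma isPreconnected_compl_ends (v : ℂ) : IsPreconnected {z : ℂ | ¬ IsEnd v (toTorus z)} :=
  ((countable_ends v).isPathConnected_compl_of_one_lt_rank
    (by rw [Complex.rank_real_complex]; norm_num)).isConnected.isPreconnected

lemma dense_compl_ends (v : ℂ) : Dense {z : ℂ | ¬ IsEnd v (toTorus z)} :=
  (countable_ends v).dense_compl ℝ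

/-! ### The points and the topology of a connected sum -/

lemma pt_eq_pt_iff {z w : SquareTorus} {j k : ZMod d} :
    pt d v z j = pt d v w k ↔ z = w ∧ (IsEnd v z ∨ j = k) :=
  Quotient.eq (r := setoid d v)

lemma pt_eq_of_isEnd {z : SquareTorus} (hz : IsEnd v z) (j k : ZMod d) :
    pt d v z j = pt d v z k := pt_eq_pt_iff.2 ⟨rfl, Or.inl hz⟩

lemma exists_pt (x : Space d v) : ∃ (z : ℂ) (j : ZMod d), pt d v (toTorus z) j = x := by
  induction x using Quotient.inductionOn with
  | h p =>
    obtain ⟨z, hz⟩ := toTorus_surjective p.1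
    exact ⟨z, p.2, by rw [hz]; rfl⟩

lemma isOpen_iff [NeZero d] {U : Set (Space d v)} :
    IsOpen U ↔ ∀ (z : ℂ) (j : ZMod d), pt d v (toTorus z) j ∈ U →
      (IsEnd v (toTorus z) → ∀ k, ∀ᶠ h in 𝓝 (0 : ℂ), pt d v (toTorus (z + h)) k ∈ U) ∧
      (¬ IsEnd v (toTorus z) → ∀ᶠ h in 𝓝 (0 : ℂ),
        pt d v (toTorus (z + h)) (j + (shift v (toTorus z) h : ℕ)) ∈ U) := by
  constructor
  · intro hU z j hz
    obtain ⟨ε, hε, H⟩ := hU (toTorus z) j hz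
    have hb := Metric.ball_mem_nhds (0 : ℂ) hε
    constructor
    · intro e k
      filter_upwards [hb] with h hh
      exact (H h (by simpa using hh)).1 e k
    · intro e
      filter_upwards [hb] with h hh
      exact (H h (by simpa using hh)).2 e
  · intro H z j hz
    obtain ⟨z, rfl⟩ := toTorus_surjective z
    obtain ⟨H1, H2⟩ := H z j hz
    by_cases e : IsEnd v (toTorus z)
    · obtain ⟨ε, hε, h⟩ := Metric.eventually_nhds_iff_ball.1 (eventually_all.2 (H1 e))
      exact ⟨ε, hε, fun k hk => ⟨fun _ => h k (by simpa using hk), fun e' => absurd e e'⟩⟩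
    · obtain ⟨ε, hε, h⟩ := Metric.eventually_nhds_iff_ball.1 (H2 e)
      exact ⟨ε, hε, fun k hk => ⟨fun e' => absurd e' e, fun _ => h k (by simpa using hk)⟩⟩

/-- Moving off a point that is not an end of the slit. -/
lemma eventually_of_mem_nhds [NeZero d] {z : ℂ} (hz : ¬ IsEnd v (toTorus z)) {j : ZMod d}
    {p : Space d v → Prop} (hp : ∀ᶠ y in 𝓝 (pt d v (toTorus z) j), p y) :
    ∀ᶠ h in 𝓝 (0 : ℂ), p (pt d v (toTorus (z + h)) (j + (shift v (toTorus z) h : ℕ))) := by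
  obtain ⟨U, hU, hUo, hx⟩ := eventually_nhds_iff.1 hp
  exact ((isOpen_iff.1 hUo z j hx).2 hz).mono fun h hh => hU _ hh

/-- Moving off an end of the slit, in any sheet. -/
lemma eventually_of_mem_nhds_end [NeZero d] {z : ℂ} (hz : IsEnd v (toTorus z)) {j : ZMod d}
    {p : Space d v → Prop} (hp : ∀ᶠ y in 𝓝 (pt d v (toTorus z) j), p y) (k : ZMod d) :
    ∀ᶠ h in 𝓝 (0 : ℂ), p (pt d v (toTorus (z + h)) k) := by
  obtain ⟨U, hU, hUo, hx⟩ := eventually_nhds_iff.1 hp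
  exact ((isOpen_iff.1 hUo z j hx).1 hz k).mono fun h hh => hU _ hh

/-- Continuity of a map defined on an open part of a connected sum. -/
lemma continuousOn_of_tendsto [NeZero d] {X : Type*} [TopologicalSpace X] {f : Space d v → X}
    {U : Set (Space d v)} (hU : IsOpen U)
    (h1 : ∀ (z : ℂ) (j : ZMod d), pt d v (toTorus z) j ∈ U → IsEnd v (toTorus z) →
      ∀ k, Tendsto (fun h : ℂ => f (pt d v (toTorus (z + h)) k)) (𝓝 0)
        (𝓝 (f (pt d v (toTorus z) j))))
    (h2 : ∀ (z : ℂ) (j : ZMod d), pt d v (toTorus z) j ∈ U → ¬ IsEnd v (toTorus z) →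
      Tendsto (fun h : ℂ => f (pt d v (toTorus (z + h)) (j + (shift v (toTorus z) h : ℕ)))) (𝓝 0)
        (𝓝 (f (pt d v (toTorus z) j)))) :
    ContinuousOn f U := by
  rw [continuousOn_open_iff hU]
  intro V hV
  rw [isOpen_iff]
  rintro z j ⟨hzU, hzV⟩
  have hU' := isOpen_iff.1 hU z j hzU
  constructor
  · intro e k
    filter_upwards [hU'.1 e k, (h1 z j hzU e k).eventually (hV.mem_nhds hzV)] with h a b
    exact ⟨a, b⟩
  · intro e
    filter_upwards [hU'.2 e, (h2 z j hzU e).eventually (hV.mem_nhds hzV)] with h a b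
    exact ⟨a, b⟩

lemma continuous_of_tendsto [NeZero d] {X : Type*} [TopologicalSpace X] {f : Space d v → X}
    (h1 : ∀ (z : ℂ) (j : ZMod d), IsEnd v (toTorus z) →
      ∀ k, Tendsto (fun h : ℂ => f (pt d v (toTorus (z + h)) k)) (𝓝 0)
        (𝓝 (f (pt d v (toTorus z) j))))
    (h2 : ∀ (z : ℂ) (j : ZMod d), ¬ IsEnd v (toTorus z) →
      Tendsto (fun h : ℂ => f (pt d v (toTorus (z + h)) (j + (shift v (toTorus z) h : ℕ)))) (𝓝 0)
        (𝓝 (f (pt d v (toTorus z) j)))) :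
    Continuous f := by
  rw [← continuousOn_univ]
  exact continuousOn_of_tendsto isOpen_univ (fun z j _ => h1 z j) (fun z j _ => h2 z j)

/-- A map into a connected sum, given by a lift to `ℂ` and a choice of sheets, is continuous where
the lift is and the sheets change according to the passages through the slit. -/
lemma continuousAt_pt [NeZero d] {X : Type*} [TopologicalSpace X] {γ : X → ℂ} {j : X → ZMod d}
    {x : X} (hγ : ContinuousAt γ x)
    (hj : ¬ IsEnd v (toTorus (γ x)) →
      ∀ᶠ y in 𝓝 x, j y = j x + (shift v (toTorus (γ x)) (γ y - γ x) : ℕ)) :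
    ContinuousAt (fun y => pt d v (toTorus (γ y)) (j y)) x := by
  have ht : Tendsto (fun y => γ y - γ x) (𝓝 x) (𝓝 0) := by
    have := (hγ.tendsto.sub_const (γ x))
    rwa [sub_self] at this
  intro V hV
  rw [mem_map]
  replace hV : ∀ᶠ y in 𝓝 (pt d v (toTorus (γ x)) (j x)), y ∈ V := hV
  by_cases e : IsEnd v (toTorus (γ x))
  · have := ht.eventually (eventually_all.2 (eventually_of_mem_nhds_end e hV))
    filter_upwards [this] with y hy
    simpa using hy (j y)
  · filter_upwards [hj e, ht.eventually (eventually_of_mem_nhds e hV)] with y h1 h2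
    simpa [h1] using h2

/-- The projection of a connected sum to the torus. -/
abbrev toBase (d : ℕ) (v : ℂ) : Space d v → SquareTorus := (connectedSum d v).proj

@[simp] lemma toBase_pt (z : SquareTorus) (j : ZMod d) : toBase d v (pt d v z j) = z := rfl

/-- The cyclic symmetry of a connected sum. -/
abbrev nextSheet (d : ℕ) (v : ℂ) : Space d v → Space d v := (connectedSum d v).rot

@[simp] lemma nextSheet_pt (z : SquareTorus) (j : ZMod d) :
    nextSheet d v (pt d v z j) = pt d v z (j + 1) := rfl

lemma continuous_toBase [NeZero d] : Continuous (toBase d v) := by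
  have h (z : ℂ) : Tendsto (fun h : ℂ => toTorus (z + h)) (𝓝 0) (𝓝 (toTorus z)) := by
    have : Continuous (fun h : ℂ => toTorus (z + h)) := continuous_toTorus.comp (by fun_prop)
    simpa using this.tendsto 0
  exact continuous_of_tendsto (fun z j _ k => h z) (fun z j _ => h z)

lemma eq_p₀_or_p₁_iff {z : SquareTorus} {j : ZMod d} :
    (pt d v z j = (connectedSum d v).p₀ ∨ pt d v z j = (connectedSum d v).p₁) ↔ IsEnd v z := by
  constructor
  · rintro (h | h)
    · exact Or.inl (pt_eq_pt_iff.1 h).1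
    · exact Or.inr (pt_eq_pt_iff.1 h).1
  · intro h
    rcases id h with rfl | rfl
    · exact Or.inl (pt_eq_of_isEnd h _ _)
    · exact Or.inr (pt_eq_of_isEnd h _ _)

lemma preimage_toBase (z : SquareTorus) :
    toBase d v ⁻¹' {z} = Set.range (fun j : ZMod d => pt d v z j) := by
  ext x
  obtain ⟨w, j, rfl⟩ := exists_pt x
  simp only [Set.mem_preimage, Set.mem_singleton_iff, Set.mem_range, toBase_pt]
  constructor
  · rintro rfl
    exact ⟨j, rfl⟩
  · rintro ⟨k, hk⟩
    exact (pt_eq_pt_iff.1 hk).1.symm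

/-- A finite branched covering is a proper map. -/
lemma isProperMap_toBase [NeZero d] : IsProperMap (toBase d v) := by
  rw [isProperMap_iff_isClosedMap_and_compact_fibers]
  refine ⟨continuous_toBase, ?_, fun z => ?_⟩
  · rw [isClosedMap_iff_kernImage]
    intro U hU
    rw [isOpen_iff_mem_nhds]
    intro z hz
    obtain ⟨z, rfl⟩ := toTorus_surjective z
    have hz' : ∀ j, pt d v (toTorus z) j ∈ U := fun j => hz rfl
    rw [← map_toTorus_nhds]
    change ∀ᶠ w in 𝓝 z, _
    rw [eventually_nhds_iff_add]
    have key : ∀ᶠ h in 𝓝 (0 : ℂ), ∀ k, pt d v (toTorus (z + h)) k ∈ U := by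
      by_cases e : IsEnd v (toTorus z)
      · exact eventually_all.2 ((isOpen_iff.1 hU z 0 (hz' 0)).1 e)
      · filter_upwards [eventually_all.2 fun j => (isOpen_iff.1 hU z j (hz' j)).2 e] with h hh k
        simpa using hh (k - (shift v (toTorus z) h : ℕ))
    filter_upwards [key] with h hh x hx
    obtain ⟨w, j, rfl⟩ := exists_pt x
    rw [toBase_pt] at hx
    rw [hx]
    exact hh j
  · rw [preimage_toBase]
    exact (Set.finite_range _).isCompact

instance [NeZero d] : CompactSpace (Space d v) :=
  ⟨by simpa using isProperMap_toBase.isCompact_preimage isCompact_univ⟩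

lemma ncard_preimage_toBase [NeZero d] {z : SquareTorus} (hz : ¬ IsEnd v z) :
    (toBase d v ⁻¹' {z}).ncard = d := by
  rw [preimage_toBase, ← Set.image_univ, Set.ncard_image_of_injective, Set.ncard_univ,
    Nat.card_zmod]
  intro j k h
  exact (pt_eq_pt_iff.1 h).2.resolve_left hz

end ConnectedSum

/-! ### The linear action on `ℂ` -/

lemma linAct_add (A : SL(2, ℝ)) (z w : ℂ) : linAct A (z + w) = linAct A z + linAct A w :=
  Complex.ext (by simp [linAct]; ring) (by simp [linAct]; ring)

lemma linAct_real_mul (A : SL(2, ℝ)) (t : ℝ) (z : ℂ) : linAct A (t * z) = t * linAct A z :=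
  Complex.ext (by simp [linAct]; ring) (by simp [linAct]; ring)

lemma linAct_zero (A : SL(2, ℝ)) : linAct A 0 = 0 := by simpa using linAct_real_mul A 0 0

lemma linAct_neg (A : SL(2, ℝ)) (z : ℂ) : linAct A (-z) = -linAct A z := by
  simpa using linAct_real_mul A (-1) z

lemma linAct_sub (A : SL(2, ℝ)) (z w : ℂ) : linAct A (z - w) = linAct A z - linAct A w := by
  rw [sub_eq_add_neg, linAct_add, linAct_neg, sub_eq_add_neg]

lemma linAct_one (z : ℂ) : linAct 1 z = z := by simp [linAct]

lemma linAct_mul (A B : SL(2, ℝ)) (z : ℂ) : linAct (A * B) z = linAct A (linAct B z) := by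
  apply Complex.ext <;>
  simp [linAct, Matrix.mul_apply, Fin.sum_univ_two] <;> ring

lemma continuous_linAct (A : SL(2, ℝ)) : Continuous (linAct A) := by
  have : linAct A = fun h => ((A 0 0 * h.re + A 0 1 * h.im : ℝ) : ℂ) +
      ((A 1 0 * h.re + A 1 1 * h.im : ℝ) : ℂ) * Complex.I := by
    funext h
    apply Complex.ext <;> simp [linAct]
  rw [this]
  fun_prop

lemma tendsto_linAct_zero (A : SL(2, ℝ)) : Tendsto (linAct A) (𝓝 0) (𝓝 0) := by
  simpa [linAct_zero] using (continuous_linAct A).tendsto 0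

/-- The vector `h` points to the right of `v`. -/
lemma div_im_neg_iff {h v : ℂ} : (h / v).im < 0 ↔ h.im * v.re - h.re * v.im < 0 := by
  rcases eq_or_ne v 0 with rfl | hv
  · simp
  · have hp := Complex.normSq_pos.2 hv
    rw [Complex.div_im, ← sub_div, div_lt_iff₀ hp, zero_mul]

lemma linAct_div_im_neg_iff (A : SL(2, ℝ)) {h v : ℂ} :
    (linAct A h / linAct A v).im < 0 ↔ (h / v).im < 0 := by
  rw [div_im_neg_iff, div_im_neg_iff]
  have hdet := A.det_coe
  rw [Matrix.det_fin_two] at hdet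
  have : (linAct A h).im * (linAct A v).re - (linAct A h).re * (linAct A v).im =
      (A 0 0 * A 1 1 - A 0 1 * A 1 0) * (h.im * v.re - h.re * v.im) := by
    simp only [linAct]; ring
  rw [this, hdet, one_mul]

/-- The real matrix with the entries of an integral one. -/
abbrev intToReal (B : SL(2, ℤ)) : SL(2, ℝ) :=
  Matrix.SpecialLinearGroup.map (Int.castRingHom ℝ) B

lemma linAct_intToReal (B : SL(2, ℤ)) (z : ℂ) :
    linAct (intToReal B) z = ⟨B 0 0 * z.re + B 0 1 * z.im, B 1 0 * z.re + B 1 1 * z.im⟩ := by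
  simp [linAct, intToReal]

lemma linAct_intToReal_mul (B B' : SL(2, ℤ)) (z : ℂ) :
    linAct (intToReal (B * B')) z = linAct (intToReal B) (linAct (intToReal B') z) := by
  rw [intToReal, map_mul, linAct_mul]

lemma linAct_intToReal_self_inv (B : SL(2, ℤ)) (z : ℂ) :
    linAct (intToReal B) (linAct (intToReal B⁻¹) z) = z := by
  rw [← linAct_intToReal_mul, mul_inv_cancel, intToReal, map_one, linAct_one]

lemma linAct_intToReal_inv_self (B : SL(2, ℤ)) (z : ℂ) :
    linAct (intToReal B⁻¹) (linAct (intToReal B) z) = z := by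
  rw [← linAct_intToReal_mul, inv_mul_cancel, intToReal, map_one, linAct_one]

lemma linAct_mem_gaussianLattice (B : SL(2, ℤ)) {z : ℂ} (hz : z ∈ gaussianLattice) :
    linAct (intToReal B) z ∈ gaussianLattice := by
  obtain ⟨a, b, ha, hb⟩ := mem_gaussianLattice.1 hz
  rw [linAct_intToReal, mem_gaussianLattice]
  exact ⟨B 0 0 * a + B 0 1 * b, B 1 0 * a + B 1 1 * b, by simp [ha, hb], by simp [ha, hb]⟩

lemma linAct_mem_gaussianLattice_iff (B : SL(2, ℤ)) {z : ℂ} :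
    linAct (intToReal B) z ∈ gaussianLattice ↔ z ∈ gaussianLattice := by
  refine ⟨fun h => ?_, linAct_mem_gaussianLattice B⟩
  have := linAct_mem_gaussianLattice B⁻¹ h
  rwa [linAct_intToReal_inv_self] at this

lemma toTorus_linAct_eq_iff (B : SL(2, ℤ)) {z w : ℂ} :
    toTorus (linAct (intToReal B) z) = toTorus (linAct (intToReal B) w) ↔
      toTorus z = toTorus w := by
  rw [toTorus_eq_iff, toTorus_eq_iff, ← linAct_sub, linAct_mem_gaussianLattice_iff]

namespace ConnectedSum

variable {d : ℕ} {v : ℂ}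

lemma passes_linAct (B : SL(2, ℤ)) (v z : ℂ) :
    passes (linAct (intToReal B) v) (toTorus (linAct (intToReal B) z)) = passes v (toTorus z) := by
  simp only [passes, ← linAct_real_mul, toTorus_linAct_eq_iff]

lemma shift_linAct (B : SL(2, ℤ)) (v z h : ℂ) :
    shift (linAct (intToReal B) v) (toTorus (linAct (intToReal B) z)) (linAct (intToReal B) h) =
      shift v (toTorus z) h := by
  classical
  simp only [shift, linAct_div_im_neg_iff, passes_linAct]

/-! ### Gluing data -/

/-- A change of sheets `c` for which `(z, j) ↦ (B z, j + c z)` is compatible with the regluings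
of the connected sums along `[0, v]` and `[0, v']`, and maps the end points of the first slit to
those of the second one.  The function `c` is given on `ℂ` rather than on the torus. -/
structure Gluing (d : ℕ) (B : SL(2, ℤ)) (v v' : ℂ) (c : ℂ → ZMod d) : Prop where
  map_end : toTorus (linAct (intToReal B) v) = toTorus v'
  periodic : ∀ z w, toTorus z = toTorus w → c z = c w
  jump : ∀ z, ¬ IsEnd v (toTorus z) → ∀ᶠ h in 𝓝 (0 : ℂ),
    c (z + h) + (shift v (toTorus z) h : ℕ) =
      c z + (shift v' (toTorus (linAct (intToReal B) z)) (linAct (intToReal B) h) : ℕ)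

lemma isEnd_linAct_iff {B : SL(2, ℤ)} {v v' : ℂ}
    (h : toTorus (linAct (intToReal B) v) = toTorus v') (z : ℂ) :
    IsEnd v' (toTorus (linAct (intToReal B) z)) ↔ IsEnd v (toTorus z) := by
  rw [IsEnd, IsEnd, ← h, toTorus_linAct_eq_iff, ← toTorus_linAct_eq_iff B (z := z) (w := 0),
    linAct_zero]

namespace Gluing

variable {B B' : SL(2, ℤ)} {v v' v'' : ℂ} {c c' : ℂ → ZMod d}

lemma linear (d : ℕ) (B : SL(2, ℤ)) (v : ℂ) :
    Gluing d B v (linAct (intToReal B) v) (fun _ => 0) where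
  map_end := rfl
  periodic _ _ _ := rfl
  jump z _ := Eventually.of_forall fun h => by rw [shift_linAct]

lemma trans (h : Gluing d B v v' c) (h' : Gluing d B' v' v'' c') :
    Gluing d (B' * B) v v'' (fun z => c z + c' (linAct (intToReal B) z)) where
  map_end := by
    rw [linAct_intToReal_mul, ← h'.map_end, toTorus_linAct_eq_iff, h.map_end]
  periodic z w e := by
    rw [h.periodic z w e, h'.periodic _ _ ((toTorus_linAct_eq_iff B).2 e)]
  jump z hz := by
    have h1 := h.jump z hz
    have h2 := (tendsto_linAct_zero (intToReal B)).eventually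
      (h'.jump (linAct (intToReal B) z) (by rwa [isEnd_linAct_iff h.map_end]))
    filter_upwards [h1, h2] with k k1 k2
    rw [linAct_intToReal_mul, linAct_intToReal_mul, linAct_add]
    linear_combination k1 + k2

lemma symm (h : Gluing d B v v' c) :
    Gluing d B⁻¹ v' v (fun z => -c (linAct (intToReal B⁻¹) z)) where
  map_end := by
    rw [← toTorus_linAct_eq_iff B, linAct_intToReal_self_inv, h.map_end]
  periodic z w e := by rw [h.periodic _ _ ((toTorus_linAct_eq_iff B⁻¹).2 e)]
  jump z hz := by
    have e := linAct_intToReal_self_inv B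
    rw [← e z, isEnd_linAct_iff h.map_end] at hz
    have h1 := (tendsto_linAct_zero (intToReal B⁻¹)).eventually (h.jump _ hz)
    filter_upwards [h1] with k k1
    rw [e, e] at k1
    rw [linAct_add]
    linear_combination -k1

/-- Gluing data provide a continuous map. -/
lemma exists_continuous [NeZero d] (h : Gluing d B v v' c) :
    ∃ f : Space d v → Space d v', Continuous f ∧ ∀ (z : ℂ) (j : ZMod d),
      f (pt d v (toTorus z) j) = pt d v' (toTorus (linAct (intToReal B) z)) (j + c z) := by
  choose ζ s hs using fun x : Space d v => exists_pt x
  have key (z : ℂ) (j : ZMod d) :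
      pt d v' (toTorus (linAct (intToReal B) (ζ (pt d v (toTorus z) j))))
        (s (pt d v (toTorus z) j) + c (ζ (pt d v (toTorus z) j))) =
      pt d v' (toTorus (linAct (intToReal B) z)) (j + c z) := by
    obtain ⟨h1, h2⟩ := pt_eq_pt_iff.1 (hs (pt d v (toTorus z) j))
    rw [pt_eq_pt_iff, isEnd_linAct_iff h.map_end, toTorus_linAct_eq_iff, h.periodic _ _ h1]
    exact ⟨h1, h2.imp id fun e => by rw [e]⟩
  refine ⟨fun x => pt d v' (toTorus (linAct (intToReal B) (ζ x))) (s x + c (ζ x)), ?_, key⟩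
  have hc (z : ℂ) (j : ℂ → ZMod d)
      (hj : ¬ IsEnd v (toTorus z) → ∀ᶠ k in 𝓝 (0 : ℂ), j k = j 0 +
        (shift v' (toTorus (linAct (intToReal B) z)) (linAct (intToReal B) k) : ℕ)) :
      Tendsto (fun k => pt d v' (toTorus (linAct (intToReal B) (z + k))) (j k)) (𝓝 0)
        (𝓝 (pt d v' (toTorus (linAct (intToReal B) z)) (j 0))) := by
    have := continuousAt_pt (d := d) (v := v') (x := (0 : ℂ)) (j := j)
      (γ := fun k => linAct (intToReal B) (z + k))
      ((continuous_linAct _).comp (by fun_prop)).continuousAt (fun e => by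
        simp only [add_zero, isEnd_linAct_iff h.map_end] at e
        filter_upwards [hj e] with k hk
        rw [hk, linAct_add, linAct_add, linAct_zero, add_zero, add_sub_cancel_left])
    simpa [ContinuousAt] using this
  refine continuous_of_tendsto (fun z j e k => ?_) (fun z j e => ?_)
  · simp only [key]
    rw [pt_eq_of_isEnd ((isEnd_linAct_iff h.map_end z).2 e) (j + c z) (k + c (z + 0))]
    exact hc z (fun h => k + c (z + h)) (fun e' => absurd e e')
  · simp only [key]
    have := hc z (fun k => j + (shift v (toTorus z) k : ℕ) + c (z + k)) (fun _ => by
      filter_upwards [h.jump z e] with k hk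
      simp only [add_zero, shift, zero_div, Complex.zero_im, lt_irrefl, if_false, Nat.cast_zero]
      simp only [shift] at hk
      linear_combination hk)
    simpa [shift] using this

/-- Gluing data provide a homeomorphism. -/
lemma exists_isHomeomorph [NeZero d] (h : Gluing d B v v' c) :
    ∃ f : Space d v → Space d v', IsHomeomorph f ∧ ∀ (z : ℂ) (j : ZMod d),
      f (pt d v (toTorus z) j) = pt d v' (toTorus (linAct (intToReal B) z)) (j + c z) := by
  obtain ⟨f, hf, hf'⟩ := h.exists_continuous
  obtain ⟨g, hg, hg'⟩ := h.symm.exists_continuous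
  refine ⟨f, ?_, hf'⟩
  have e := linAct_intToReal_self_inv B
  have e' := linAct_intToReal_inv_self B
  let F : Space d v ≃ₜ Space d v' :=
    { toFun := f, invFun := g, continuous_toFun := hf, continuous_invFun := hg
      left_inv := fun x => by
        obtain ⟨z, j, rfl⟩ := exists_pt x
        rw [hf', hg', e', add_neg_cancel_right]
      right_inv := fun x => by
        obtain ⟨z, j, rfl⟩ := exists_pt x
        rw [hg', hf', e, neg_add_cancel_right] }
  exact F.isHomeomorph

end Gluing

/-- A homeomorphism of connected sums that covers an integral linear map is affine. -/
lemma isAffine_of_covers [NeZero d] {B : SL(2, ℤ)} {v v' : ℂ}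
    (h : toTorus (linAct (intToReal B) v) = toTorus v') {f : Space d v → Space d v'}
    (hf : IsHomeomorph f)
    (hf' : ∀ (z : ℂ) (j : ZMod d),
      toBase d v' (f (pt d v (toTorus z) j)) = toTorus (linAct (intToReal B) z)) :
    EllipticDifferential.IsAffine (Y := connectedSum d v) (Z := connectedSum d v')
      (intToReal B) f := by
  have hend (z : ℂ) (j k : ZMod d) (e : IsEnd v (toTorus z)) :
      f (pt d v (toTorus z) j) = pt d v' (toTorus (linAct (intToReal B) z)) k := by
    obtain ⟨w, i, hw⟩ := exists_pt (f (pt d v (toTorus z) j))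
    have h1 := hf' z j
    rw [← hw, toBase_pt] at h1
    rw [← hw, h1]
    exact pt_eq_of_isEnd ((isEnd_linAct_iff h z).2 e) _ _
  refine ⟨hf, ?_, ?_, ?_⟩
  · have := hend 0 0 0 (Or.inl rfl)
    rwa [linAct_zero] at this
  · have := hend v 0 0 (Or.inr rfl)
    rwa [h] at this
  · intro x _ _
    obtain ⟨z, j, rfl⟩ := exists_pt x
    filter_upwards [(continuous_toBase (d := d) (v := v)).continuousAt.eventually
      (eventually_exists_toTorus (toTorus z) (by norm_num : (0 : ℝ) < 1 / 2))] with y hy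
    obtain ⟨w, k, rfl⟩ := exists_pt y
    obtain ⟨h, hh, e⟩ := hy
    refine ⟨h, hh, e, ?_⟩
    have e1 : toTorus w = toTorus (z + h) := e
    change toBase d v' _ = toBase d v' _ + _
    rw [hf', hf', ← toTorus_add, ← linAct_add, toTorus_linAct_eq_iff, e1]

lemma Gluing.exists_isAffine [NeZero d] {B : SL(2, ℤ)} {v v' : ℂ} {c : ℂ → ZMod d}
    (h : Gluing d B v v' c) :
    ∃ f : Space d v → Space d v',
      EllipticDifferential.IsAffine (Y := connectedSum d v) (Z := connectedSum d v')
        (intToReal B) f ∧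
      ∀ x, f (nextSheet d v x) = nextSheet d v' (f x) := by
  obtain ⟨f, hf, hf'⟩ := h.exists_isHomeomorph
  refine ⟨f, isAffine_of_covers h.map_end hf fun z j => by rw [hf', toBase_pt], fun x => ?_⟩
  obtain ⟨z, j, rfl⟩ := exists_pt x
  rw [nextSheet_pt, hf', hf', nextSheet_pt, add_right_comm]

end ConnectedSum

/-! ### Counting the passages of a slit row by row -/

lemma eventually_floor_eq {x : ℝ} (hx : ∀ k : ℤ, x ≠ k) : ∀ᶠ y in 𝓝 x, ⌊y⌋ = ⌊x⌋ := by
  have h1 : (⌊x⌋ : ℝ) < x := lt_of_le_of_ne (Int.floor_le x) (hx _).symm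
  filter_upwards [Ioo_mem_nhds h1 (Int.lt_floor_add_one x)] with y hy
  exact Int.floor_eq_iff.2 ⟨hy.1.le, hy.2⟩

namespace ConnectedSum

variable {d : ℕ} {v z : ℂ}

/-- How far the line spanned by the slit from `0` to `v` lies to the right of `z`, at the height
of the translate of `z` by `m * I`. -/
def rowOffset (v z : ℂ) (m : ℤ) : ℝ := (z.im + m) / v.im * v.re - z.re

/-- For `0 < v.im`: the slit passes through the class of `z` at the height of `z + m * I`. -/
def CrossesRow (v z : ℂ) (m : ℤ) : Prop :=
  0 < z.im + m ∧ z.im + m < v.im ∧ ∃ k : ℤ, rowOffset v z m = k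

open Classical in
lemma passes_eq_sum (hv : 0 < v.im) (z : ℂ) {s : Finset ℤ}
    (hs : ∀ m : ℤ, 0 < z.im + m → z.im + m < v.im → m ∈ s) :
    passes v (toTorus z) = ∑ m ∈ s, if CrossesRow v z m then 1 else 0 := by
  have hset : {t : ℝ | 0 < t ∧ t < 1 ∧ toTorus (t * v) = toTorus z} =
      (fun m : ℤ => (z.im + m) / v.im) '' (s.filter (CrossesRow v z) : Finset ℤ) := by
    ext t
    simp only [Set.mem_ofPred_eq, Set.mem_image, Finset.coe_filter]
    constructor
    · rintro ⟨h0, h1, h⟩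
      obtain ⟨k, m, hk, hm⟩ := toTorus_eq_iff_int.1 h
      simp only [Complex.re_ofReal_mul, Complex.im_ofReal_mul] at hk hm
      have ht : z.im + m = t * v.im := by linarith
      have h2 : 0 < z.im + m := by rw [ht]; positivity
      have h3 : z.im + m < v.im := by rw [ht]; nlinarith
      refine ⟨m, ⟨hs m h2 h3, h2, h3, k, ?_⟩, ?_⟩
      · rw [rowOffset, ht, mul_div_cancel_right₀ _ hv.ne', hk]
      · rw [ht, mul_div_cancel_right₀ _ hv.ne']
    · rintro ⟨m, ⟨-, h2, h3, k, hk⟩, rfl⟩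
      refine ⟨by positivity, (div_lt_one hv).2 h3, toTorus_eq_iff_int.2 ⟨k, m, ?_, ?_⟩⟩
      · rw [← hk, Complex.re_ofReal_mul, rowOffset]
      · rw [Complex.im_ofReal_mul, div_mul_cancel₀ _ hv.ne']; ring
  have hinj : Function.Injective (fun m : ℤ => (z.im + m) / v.im) := by
    intro m m' h
    have := (div_left_inj' hv.ne').1 h
    exact_mod_cast add_left_cancel this
  rw [passes, hset, Set.ncard_image_of_injective _ hinj, Set.ncard_coe_finset, Finset.card_filter]

open Classical in
lemma shift_eq_sum (hv : 0 < v.im) (z h : ℂ) {s : Finset ℤ}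
    (hs : ∀ m : ℤ, 0 < z.im + m → z.im + m < v.im → m ∈ s) :
    shift v (toTorus z) h =
      ∑ m ∈ s, if (h / v).im < 0 ∧ CrossesRow v z m then 1 else 0 := by
  rw [shift, passes_eq_sum hv z hs]
  split_ifs with h1 <;> simp [h1]

lemma rowOffset_add (v z h : ℂ) (m : ℤ) :
    rowOffset v (z + h) m = rowOffset v z m + (h.im / v.im * v.re - h.re) := by
  simp only [rowOffset, Complex.add_im, Complex.add_re]; ring

open Classical in
/-- The integer part of the offset drops exactly when the slit is left to the right. -/
lemma eventually_floor_rowOffset (hv : 0 < v.im) (z : ℂ) (m : ℤ) :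
    ∀ᶠ h in 𝓝 (0 : ℂ), ⌊rowOffset v (z + h) m⌋ = ⌊rowOffset v z m⌋ -
      if (h / v).im < 0 ∧ ∃ k : ℤ, rowOffset v z m = k then 1 else 0 := by
  have hc : Tendsto (fun h => rowOffset v (z + h) m) (𝓝 0) (𝓝 (rowOffset v z m)) := by
    have : Continuous (fun h => rowOffset v (z + h) m) := by
      simp only [rowOffset]
      fun_prop
    simpa using this.tendsto 0
  by_cases hk : ∃ k : ℤ, rowOffset v z m = k
  · obtain ⟨k, hk⟩ := hk
    have hI : Set.Ioo ((k : ℝ) - 1) (k + 1) ∈ 𝓝 (rowOffset v z m) := by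
      rw [hk]; exact Ioo_mem_nhds (by linarith) (by linarith)
    filter_upwards [hc.eventually hI] with h hh
    have hdiff : rowOffset v (z + h) m = k + (h.im * v.re - h.re * v.im) / v.im := by
      rw [rowOffset_add, hk]
      field_simp
    have hsign : (h / v).im < 0 ↔ rowOffset v (z + h) m < k := by
      rw [div_im_neg_iff, hdiff, add_lt_iff_neg_left, div_lt_iff₀ hv, zero_mul]
    have hfl : ⌊rowOffset v z m⌋ = k := by rw [hk, Int.floor_intCast]
    rw [hfl]
    by_cases hn : (h / v).im < 0
    · rw [if_pos ⟨hn, k, hk⟩, Int.floor_eq_iff]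
      push_cast
      exact ⟨hh.1.le, by linarith [hsign.1 hn]⟩
    · rw [if_neg (fun H => hn H.1), Int.floor_eq_iff]
      push_cast
      exact ⟨by linarith [not_lt.1 (hsign.not.1 hn)], by linarith [hh.2]⟩
  · have hx : ∀ k : ℤ, rowOffset v z m ≠ k := fun k h => hk ⟨k, h⟩
    filter_upwards [hc.eventually (eventually_floor_eq hx)] with h hh
    rw [hh, if_neg (fun H => hk H.2), sub_zero]

/-- The sum, over the rows `m` that the slit from `0` to `v` meets, of the integer parts of the
offsets.  Where the ends of the slit do not interfere, it jumps by the negative of the change of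
sheets. -/
def rowSum (v z : ℂ) : ℤ :=
  ∑ m ∈ Finset.Ioc ⌊-z.im⌋ ⌊v.im - z.im⌋, ⌊rowOffset v z m⌋

lemma mem_rows_iff {m : ℤ} :
    m ∈ Finset.Ioc ⌊-z.im⌋ ⌊v.im - z.im⌋ ↔ 0 < z.im + m ∧ z.im + m ≤ v.im := by
  rw [Finset.mem_Ioc, Int.floor_lt, Int.le_floor]
  constructor <;> rintro ⟨h1, h2⟩ <;> constructor <;> linarith

lemma eventually_rowSum_add (hv : 0 < v.im) (h0 : ∀ k : ℤ, z.im ≠ k)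
    (h1 : ∀ k : ℤ, v.im - z.im ≠ k) :
    ∀ᶠ h in 𝓝 (0 : ℂ), rowSum v (z + h) = rowSum v z - (shift v (toTorus z) h : ℕ) := by
  classical
  have t1 : Tendsto (fun h : ℂ => -(z + h).im) (𝓝 0) (𝓝 (-z.im)) := by
    have : Continuous (fun h : ℂ => -(z + h).im) := by fun_prop
    simpa using this.tendsto 0
  have t2 : Tendsto (fun h : ℂ => v.im - (z + h).im) (𝓝 0) (𝓝 (v.im - z.im)) := by
    have : Continuous (fun h : ℂ => v.im - (z + h).im) := by fun_prop
    simpa using this.tendsto 0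
  have e1 := t1.eventually (eventually_floor_eq (x := -z.im) fun k hk =>
    h0 (-k) (by push_cast; linarith))
  have e2 := t2.eventually (eventually_floor_eq h1)
  have e3 := (eventually_all_finset (Finset.Ioc ⌊-z.im⌋ ⌊v.im - z.im⌋)).2
    fun m _ => eventually_floor_rowOffset hv z m
  filter_upwards [e1, e2, e3] with h a1 a2 a3
  rw [rowSum, a1, a2, Finset.sum_congr rfl a3, Finset.sum_sub_distrib, ← rowSum,
    shift_eq_sum hv z h (s := Finset.Ioc ⌊-z.im⌋ ⌊v.im - z.im⌋)
      (fun m h1 h2 => mem_rows_iff.2 ⟨h1, h2.le⟩)]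
  push_cast
  congr 1
  refine Finset.sum_congr rfl fun m hm => ?_
  have hm' := mem_rows_iff.1 hm
  have : CrossesRow v z m ↔ ∃ k : ℤ, rowOffset v z m = k :=
    ⟨fun H => H.2.2, fun H => ⟨hm'.1, lt_of_le_of_ne hm'.2 fun e => h1 m (by linarith), H⟩⟩
  rw [this]

/-- The effect of an integral translation on the row sum. -/
lemma rowSum_of_translate (hv : 0 < v.im) {w : ℂ} {a b : ℤ} (ha : z.re - w.re = a)
    (hb : z.im - w.im = b) :
    rowSum v z = rowSum v w - a * (⌊v.im - w.im⌋ - ⌊-w.im⌋) := by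
  have hz : z.im = w.im + b := by linarith
  have hz' : z.re = w.re + a := by linarith
  have hI : Finset.Ioc ⌊-w.im⌋ ⌊v.im - w.im⌋ =
      (Finset.Ioc ⌊-z.im⌋ ⌊v.im - z.im⌋).map (addRightEmbedding b) := by
    rw [Finset.map_add_right_Ioc]
    congr 1 <;> rw [← Int.floor_add_intCast, hz] <;> congr 1 <;> ring
  have hcard : ((Finset.Ioc ⌊-z.im⌋ ⌊v.im - z.im⌋).card : ℤ) = ⌊v.im - w.im⌋ - ⌊-w.im⌋ := by
    rw [← Finset.card_map (addRightEmbedding b), ← hI, Int.card_Ioc, Int.toNat_of_nonneg]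
    exact sub_nonneg.2 (Int.floor_le_floor (by linarith))
  have ht (m : ℤ) : ⌊rowOffset v z m⌋ = ⌊rowOffset v w (m + b)⌋ - a := by
    rw [← Int.floor_sub_intCast]
    congr 1
    simp only [rowOffset, hz, hz']
    push_cast
    ring
  rw [rowSum, rowSum, hI, Finset.sum_map]
  simp only [addRightEmbedding_apply, ht, Finset.sum_sub_distrib, Finset.sum_const, nsmul_eq_mul,
    hcard]
  ring

/-- Adding `d` times a horizontal period to a segment which is not horizontal does not change the
`d`-fold connected sum: the sheets are relabelled by the number of lattice points in the triangle
that the two segments span. -/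
lemma gluing_of_translate {v v' : ℂ} (hv : 0 < v.im) (him : v'.im = v.im) {k : ℤ}
    (hre : v'.re = v.re + d * k) :
    Gluing d 1 v v' (fun z => ((rowSum v z - rowSum v' z : ℤ) : ZMod d)) where
  map_end := by
    rw [intToReal, map_one, linAct_one, toTorus_eq_iff_int]
    exact ⟨-(d * k), 0, by push_cast; linarith, by simp [him]⟩
  periodic z w e := by
    obtain ⟨a, b, ha, hb⟩ := toTorus_eq_iff_int.1 e
    rw [rowSum_of_translate hv ha hb, rowSum_of_translate (v := v') (him ▸ hv) ha hb, him]
    congr 1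
    ring
  jump z hz := by
    classical
    have hv' : 0 < v'.im := him ▸ hv
    simp only [intToReal, map_one, linAct_one]
    rw [isEnd_toTorus_iff, not_or, mem_gaussianLattice, mem_gaussianLattice] at hz
    set s : Finset ℤ := Finset.Icc (⌊-z.im⌋ - 1) (⌊v.im - z.im⌋ + 1)
    let D : ℂ → ℤ → ZMod d := fun w m =>
      if 0 < w.im + m ∧ w.im + m ≤ v.im then
        ((⌊rowOffset v w m⌋ - ⌊rowOffset v' w m⌋ : ℤ) : ZMod d) else 0
    have hsum (w : ℂ) (hw : Finset.Ioc ⌊-w.im⌋ ⌊v.im - w.im⌋ ⊆ s) :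
        ((rowSum v w - rowSum v' w : ℤ) : ZMod d) = ∑ m ∈ s, D w m := by
      rw [rowSum, rowSum, him, ← Finset.sum_sub_distrib, Int.cast_sum,
        ← Finset.sum_subset hw (f := D w)]
      · refine Finset.sum_congr rfl fun m hm => ?_
        simp only [D]
        rw [if_pos (mem_rows_iff.1 hm)]
      · intro m _ hm
        simp only [D]
        rw [if_neg (fun H => hm (mem_rows_iff.2 H))]
    have hs : Finset.Ioc ⌊-z.im⌋ ⌊v.im - z.im⌋ ⊆ s := by
      intro m hm
      rw [Finset.mem_Ioc] at hm
      exact Finset.mem_Icc.2 ⟨by lia, by lia⟩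
    have hs' : ∀ᶠ h in 𝓝 (0 : ℂ), Finset.Ioc ⌊-(z + h).im⌋ ⌊v.im - (z + h).im⌋ ⊆ s := by
      filter_upwards [Metric.ball_mem_nhds (0 : ℂ) one_pos] with h hh m hm
      have hi : |h.im| < 1 := (Complex.abs_im_le_norm h).trans_lt (by simpa using hh)
      rw [abs_lt] at hi
      rw [mem_rows_iff, Complex.add_im] at hm
      rw [Finset.mem_Icc]
      constructor
      · rw [sub_le_iff_le_add, ← Int.lt_add_one_iff, Int.floor_lt]
        push_cast; linarith
      · rw [← sub_le_iff_le_add, Int.le_floor]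
        push_cast; linarith
    have hD : ∀ m ∈ s, ∀ᶠ h in 𝓝 (0 : ℂ),
        D (z + h) m + ((if (h / v).im < 0 ∧ CrossesRow v z m then 1 else 0 : ℕ) : ZMod d) =
        D z m + ((if (h / v').im < 0 ∧ CrossesRow v' z m then 1 else 0 : ℕ) : ZMod d) := by
      intro m _
      have hadd : Tendsto (fun h : ℂ => (z + h).im + m) (𝓝 0) (𝓝 (z.im + m)) := by
        have : Continuous (fun h : ℂ => (z + h).im + m) := by fun_prop
        simpa using this.tendsto 0
      have f1 := eventually_floor_rowOffset hv z m
      have f2 := eventually_floor_rowOffset hv' z m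
      rcases lt_trichotomy (z.im + m) 0 with ha | ha | ha
      · filter_upwards [hadd.eventually (gt_mem_nhds ha)] with h hh
        have e1 : D z m = 0 := if_neg fun H => ha.not_gt H.1
        have e2 : D (z + h) m = 0 := if_neg fun H => hh.not_gt H.1
        simp [e1, e2, CrossesRow, ha.not_gt]
      · -- Near the bottom row both offsets have the same integer part.
        have hn : ∀ j : ℤ, -z.re ≠ j := fun j hj => hz.1
          ⟨-j, -m, by push_cast; linarith, by push_cast; linarith⟩
        have r1 : rowOffset v z m = -z.re := by simp [rowOffset, ha]
        have r2 : rowOffset v' z m = -z.re := by simp [rowOffset, ha]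
        filter_upwards [f1, f2] with h g1 g2
        rw [r1] at g1
        rw [r2] at g2
        rw [if_neg (fun H => H.2.elim hn)] at g1 g2
        simp [D, CrossesRow, ha, g1, g2]
      rcases lt_trichotomy (z.im + m) v.im with hb | hb | hb
      · filter_upwards [hadd.eventually (lt_mem_nhds ha), hadd.eventually (gt_mem_nhds hb), f1, f2]
          with h a1 a2 g1 g2
        simp only [D, CrossesRow, ha, hb, hb.le, a1, a2.le, g1, g2, him, true_and, and_self,
          if_true]
        push_cast
        ring
      · -- At the top row the two integer parts differ by a multiple of `d`.
        have hn : ∀ j : ℤ, v.re - z.re ≠ j := fun j hj => hz.2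
          ⟨-j, -m, by simp only [Complex.sub_re]; push_cast; linarith,
            by simp only [Complex.sub_im]; push_cast; linarith⟩
        have r1 : rowOffset v z m = v.re - z.re := by
          rw [rowOffset, hb, div_self hv.ne', one_mul]
        have r2 : rowOffset v' z m = v.re - z.re + (d * k : ℤ) := by
          rw [rowOffset, hb, him, div_self hv.ne', one_mul, hre]; push_cast; ring
        have hn' : ¬ ∃ j : ℤ, v.re - z.re + (d * k : ℤ) = j := by
          rintro ⟨j, hj⟩
          exact hn (j - d * k) (by push_cast at hj ⊢; linarith)
        filter_upwards [f1, f2] with h g1 g2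
        rw [r1] at g1
        rw [r2] at g2
        rw [if_neg (fun H => H.2.elim hn)] at g1
        rw [if_neg (fun H => hn' H.2), Int.floor_add_intCast] at g2
        have d1 : D z m = 0 := by
          simp only [D, r1, r2, Int.floor_add_intCast, sub_add_cancel_left]
          simp
        have d2 : D (z + h) m = 0 := by
          simp only [D, g1, g2, sub_zero, sub_add_cancel_left]
          simp
        rw [d1, d2]
        simp [CrossesRow, hb, him]
      · filter_upwards [hadd.eventually (lt_mem_nhds hb)] with h hh
        have e1 : D z m = 0 := if_neg fun H => hb.not_ge H.2
        have e2 : D (z + h) m = 0 := if_neg fun H => hh.not_ge H.2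
        simp [e1, e2, CrossesRow, hb.not_gt, him]
    filter_upwards [hs', (eventually_all_finset s).2 hD] with h a1 a2
    have hmem (m : ℤ) (h1 : 0 < z.im + m) (h2 : z.im + m < v.im) : m ∈ s :=
      hs (mem_rows_iff.2 ⟨h1, h2.le⟩)
    rw [hsum _ a1, hsum _ hs, shift_eq_sum hv z h hmem,
      shift_eq_sum hv' z h (fun m h1 h2 => hmem m h1 (him ▸ h2)), Nat.cast_sum, Nat.cast_sum,
      ← Finset.sum_add_distrib, ← Finset.sum_add_distrib]
    exact Finset.sum_congr rfl a2

end ConnectedSum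

namespace ConnectedSum

variable {d : ℕ}

/-! ### Segments that define isomorphic connected sums -/

lemma Gluing.conj {B : SL(2, ℤ)} {v v' : ℂ} {c : ℂ → ZMod d}
    (h : Gluing d 1 (linAct (intToReal B) v) (linAct (intToReal B) v') c) :
    ∃ c', Gluing d 1 v v' c' := by
  have := ((Gluing.linear d B v).trans h).trans (Gluing.linear d B v').symm
  rw [one_mul, inv_mul_cancel] at this
  exact ⟨_, this⟩

lemma linAct_neg_one (z : ℂ) : linAct (intToReal (-1)) z = -z := by
  rw [linAct_intToReal]
  apply Complex.ext <;> simp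

lemma linAct_S (z : ℂ) : linAct (intToReal ModularGroup.S) z = ⟨-z.im, z.re⟩ := by
  rw [linAct_intToReal]
  apply Complex.ext <;> simp [ModularGroup.S]

lemma exists_gluing_horizontal {v v' : ℂ} (hv : v.im ≠ 0) (him : v'.im = v.im) {k : ℤ}
    (hre : v'.re = v.re + d * k) : ∃ c, Gluing d 1 v v' c := by
  rcases hv.lt_or_gt with h | h
  · refine Gluing.conj (B := -1) (gluing_of_translate (k := -k) ?_ ?_ ?_)
    · rw [linAct_neg_one, Complex.neg_im]; linarith
    · rw [linAct_neg_one, linAct_neg_one, Complex.neg_im, Complex.neg_im, him]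
    · simp only [linAct_neg_one, Complex.neg_re, hre]; push_cast; ring
  · exact ⟨_, gluing_of_translate h him hre⟩

lemma exists_gluing_vertical {v v' : ℂ} (hv : v.re ≠ 0) (hre : v'.re = v.re) {k : ℤ}
    (him : v'.im = v.im + d * k) : ∃ c, Gluing d 1 v v' c := by
  obtain ⟨c, hc⟩ := exists_gluing_horizontal (d := d) (k := -k)
    (v := linAct (intToReal ModularGroup.S) v) (v' := linAct (intToReal ModularGroup.S) v')
    (by simpa [linAct_S] using hv) (by simpa [linAct_S] using hre)
    (by simp only [linAct_S, him]; push_cast; ring)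
  exact hc.conj

/-- Segments from `0` whose end points differ by `d` times a period define isomorphic `d`-fold
connected sums.  The change of the end point is decomposed into horizontal and vertical ones, none
of them along the segment itself. -/
lemma exists_gluing_of_translate [NeZero d] {v v' : ℂ} (hv : ∀ k : ℤ, v.re + d * k ≠ 0) {k l : ℤ}
    (hre : v'.re = v.re + d * k) (him : v'.im = v.im + d * l) : ∃ c, Gluing d 1 v v' c := by
  have hd : (d : ℝ) ≠ 0 := Nat.cast_ne_zero.2 (NeZero.ne d)
  obtain ⟨t, ht⟩ : ∃ t : ℤ, v.im + d * t ≠ 0 := by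
    by_cases h : v.im = 0
    · exact ⟨1, by simpa [h] using hd⟩
    · exact ⟨0, by simpa using h⟩
  obtain ⟨c₁, h₁⟩ := exists_gluing_vertical (d := d) (v := v) (v' := ⟨v.re, v.im + d * t⟩)
    (k := t) (by simpa using hv 0) rfl rfl
  obtain ⟨c₂, h₂⟩ := exists_gluing_horizontal (d := d) (v := ⟨v.re, v.im + d * t⟩)
    (v' := ⟨v'.re, v.im + d * t⟩) (k := k) ht rfl hre
  obtain ⟨c₃, h₃⟩ := exists_gluing_vertical (d := d) (v := ⟨v'.re, v.im + d * t⟩)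
    (v' := v') (k := l - t) (by rw [hre]; exact hv k) rfl
    (by simp only [him]; push_cast; ring)
  have := (h₁.trans h₂).trans h₃
  rw [mul_one, mul_one] at this
  exact ⟨_, this⟩

/-! ### Slits along the real axis -/

section RealSlit

variable {x : ℝ}

lemma isClosed_ends (v : ℂ) : IsClosed {z : ℂ | IsEnd v (toTorus z)} := by
  have : {z : ℂ | IsEnd v (toTorus z)} = (gaussianLattice : Set ℂ) ∪
      (fun z => z - v) ⁻¹' (gaussianLattice : Set ℂ) := by
    ext z
    simp [isEnd_toTorus_iff]
  rw [this]
  exact isClosed_gaussianLattice.union (isClosed_gaussianLattice.preimage (by fun_prop))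

lemma eventually_not_isEnd {v z : ℂ} (hz : ¬ IsEnd v (toTorus z)) :
    ∀ᶠ h in 𝓝 (0 : ℂ), ¬ IsEnd v (toTorus (z + h)) :=
  eventually_nhds_iff_add.1 ((isClosed_ends v).isOpen_compl.mem_nhds hz)

lemma shift_real (hx : 0 < x) (z : SquareTorus) (h : ℂ) :
    shift x z h = if h.im < 0 then passes x z else 0 := by
  have : (h / x).im < 0 ↔ h.im < 0 := by
    rw [div_im_neg_iff]
    simp only [Complex.ofReal_re, Complex.ofReal_im, mul_zero, sub_zero]
    exact ⟨fun H => by by_contra hc; nlinarith [not_lt.1 hc], fun H => by nlinarith⟩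
  simp only [shift, this]

lemma passes_eq_zero_of_im {v z : ℂ} (hv : v.im = 0) (hz : ∀ k : ℤ, z.im ≠ k) :
    passes v (toTorus z) = 0 := by
  rw [passes]
  convert Set.ncard_empty ℝ
  rw [Set.eq_empty_iff_forall_notMem]
  rintro t ⟨-, -, ht⟩
  obtain ⟨a, b, -, hb⟩ := toTorus_eq_iff_int.1 ht
  refine hz (-b) ?_
  rw [Complex.im_ofReal_mul, hv] at hb
  push_cast; linarith

lemma shift_eq_zero_of_im {v z : ℂ} (hv : v.im = 0) (hz : ∀ k : ℤ, z.im ≠ k) (h : ℂ) :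
    shift v (toTorus z) h = 0 := by
  simp [shift, passes_eq_zero_of_im hv hz]

lemma not_isEnd_real_iff {z : ℂ} {k : ℤ} (hk : z.im = k) :
    ¬ IsEnd x (toTorus z) ↔ (∀ j : ℤ, -z.re ≠ j) ∧ ∀ j : ℤ, x - z.re ≠ j := by
  rw [isEnd_toTorus_iff, not_or, mem_gaussianLattice, mem_gaussianLattice]
  simp only [Complex.sub_re, Complex.sub_im, Complex.ofReal_re, Complex.ofReal_im, hk, sub_zero]
  refine and_congr ⟨fun h j hj => h ⟨-j, k, ?_, rfl⟩, ?_⟩ ⟨fun h j hj => h ⟨-j, k, ?_, rfl⟩, ?_⟩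
  · push_cast; linarith
  · rintro h ⟨j, -, hj, -⟩
    exact h (-j) (by push_cast; linarith)
  · push_cast; linarith
  · rintro h ⟨j, -, hj, -⟩
    exact h (-j) (by push_cast; linarith)

/-- The number of passages of a real segment through a point of the real circle. -/
lemma passes_real (hx : 0 < x) {z : ℂ} {k : ℤ} (hk : z.im = k) (hz : ¬ IsEnd x (toTorus z)) :
    (passes x (toTorus z) : ℤ) = ⌊x - z.re⌋ - ⌊-z.re⌋ := by
  classical
  have hz' := (not_isEnd_real_iff hk).1 hz
  rw [← passes_linAct ModularGroup.S, linAct_S, linAct_S,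
    passes_eq_sum (s := Finset.Ioc ⌊-z.re⌋ ⌊x - z.re⌋) (by simpa using hx)]
  · have : ∀ m ∈ Finset.Ioc ⌊-z.re⌋ ⌊x - z.re⌋,
        CrossesRow ⟨-(x : ℂ).im, (x : ℂ).re⟩ ⟨-z.im, z.re⟩ m := by
      intro m hm
      rw [Finset.mem_Ioc, Int.floor_lt, Int.le_floor] at hm
      refine ⟨by simp only; linarith [hm.1], lt_of_le_of_ne (by simp; linarith [hm.2]) ?_, k, ?_⟩
      · intro e
        exact hz'.2 m (by simp only [Complex.ofReal_re] at e; linarith)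
      · simp [rowOffset, hk]
    rw [Finset.sum_congr rfl fun m hm => if_pos (this m hm), Finset.sum_const, smul_eq_mul,
      mul_one, Int.card_Ioc, Int.toNat_of_nonneg]
    exact sub_nonneg.2 (Int.floor_le_floor (by linarith))
  · intro m h1 h2
    rw [Finset.mem_Ioc, Int.floor_lt, Int.le_floor]
    simp only [Complex.ofReal_re] at h1 h2
    constructor <;> linarith

lemma eventually_im_ne {z : ℂ} (hz : ∀ k : ℤ, z.im ≠ k) :
    ∀ᶠ h in 𝓝 (0 : ℂ), ∀ k : ℤ, (z + h).im ≠ k := by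
  have : IsOpen (Complex.im ⁻¹' (Set.range ((↑) : ℤ → ℝ))ᶜ) :=
    Int.isClosedEmbedding_coe_real.isClosed_range.isOpen_compl.preimage Complex.continuous_im
  have hmem : z ∈ Complex.im ⁻¹' (Set.range ((↑) : ℤ → ℝ))ᶜ := fun ⟨k, hk⟩ => hz k hk.symm
  filter_upwards [eventually_nhds_iff_add.1 (this.mem_nhds hmem)] with h hh k hk
  exact hh ⟨k, hk.symm⟩

lemma im_add_ne {z h : ℂ} {k : ℤ} (hk : z.im = k) (h0 : h.im ≠ 0) (h1 : ‖h‖ < 1) (j : ℤ) :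
    (z + h).im ≠ j := by
  intro e
  rw [Complex.add_im, hk] at e
  have h2 : h.im = (j - k : ℤ) := by push_cast; linarith
  have h3 := (Complex.abs_im_le_norm h).trans_lt h1
  rw [h2] at h3 h0
  have : j - k = 0 := Int.abs_lt_one_iff.1 (by exact_mod_cast h3)
  exact h0 (by rw [this]; simp)

/-- The changes of sheet along a real slit add up: leaving `z` by `h` and then `z + h` by a much
smaller vector `k` leads to the same sheet as leaving `z` by `h + k`. -/
lemma eventually_shift_add (hx : 0 < x) {z : ℂ} (hz : ¬ IsEnd x (toTorus z)) :
    ∀ᶠ h in 𝓝 (0 : ℂ), ∀ᶠ k in 𝓝 (0 : ℂ), shift x (toTorus z) (h + k) =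
      shift x (toTorus z) h + shift x (toTorus (z + h)) k := by
  by_cases hi : ∀ k : ℤ, z.im ≠ k
  · filter_upwards [eventually_im_ne hi] with h hh
    refine Eventually.of_forall fun k => ?_
    rw [shift_eq_zero_of_im (by simp) hi, shift_eq_zero_of_im (by simp) hi,
      shift_eq_zero_of_im (by simp) hh]
  push Not at hi
  obtain ⟨m, hm⟩ := hi
  have hz' := (not_isEnd_real_iff hm).1 hz
  have t1 : Tendsto (fun h : ℂ => -(z + h).re) (𝓝 0) (𝓝 (-z.re)) := by
    have : Continuous (fun h : ℂ => -(z + h).re) := by fun_prop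
    simpa using this.tendsto 0
  have t2 : Tendsto (fun h : ℂ => x - (z + h).re) (𝓝 0) (𝓝 (x - z.re)) := by
    have : Continuous (fun h : ℂ => x - (z + h).re) := by fun_prop
    simpa using this.tendsto 0
  filter_upwards [eventually_not_isEnd hz, t1.eventually (eventually_floor_eq hz'.1),
    t2.eventually (eventually_floor_eq hz'.2), Metric.ball_mem_nhds (0 : ℂ) one_pos]
    with h h1 h2 h3 h4
  have hadd : Tendsto (fun k : ℂ => (h + k).im) (𝓝 0) (𝓝 h.im) := by
    have : Continuous (fun k : ℂ => (h + k).im) := by fun_prop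
    simpa using this.tendsto 0
  rcases lt_trichotomy h.im 0 with h0 | h0 | h0
  · filter_upwards [hadd.eventually (gt_mem_nhds h0)] with k hk
    rw [shift_eq_zero_of_im (z := z + h) (by simp) (im_add_ne hm h0.ne (by simpa using h4)),
      shift_real hx, shift_real hx, if_pos hk, if_pos h0, add_zero]
  · have hm' : (z + h).im = m := by rw [Complex.add_im, h0, hm, add_zero]
    have hp : passes x (toTorus (z + h)) = passes x (toTorus z) := by
      have := passes_real hx hm' h1
      rw [h2, h3, ← passes_real hx hm hz] at this
      exact_mod_cast this
    refine Eventually.of_forall fun k => ?_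
    simp [shift_real hx, hp, h0]
  · filter_upwards [hadd.eventually (lt_mem_nhds h0)] with k hk
    rw [shift_eq_zero_of_im (z := z + h) (by simp) (im_add_ne hm h0.ne' (by simpa using h4)),
      shift_real hx, shift_real hx, if_neg hk.not_gt, if_neg h0.not_gt]

/-- The disc of radius `ε` around the point over `z` in the sheet `j`. -/
def disc (d : ℕ) (x : ℝ) (z : ℂ) (j : ZMod d) (ε : ℝ) : Set (Space d x) :=
  (fun h : ℂ => pt d x (toTorus (z + h)) (j + (shift x (toTorus z) h : ℕ))) '' Metric.ball 0 ε

lemma shift_zero (v : ℂ) (z : SquareTorus) : shift v z 0 = 0 := by simp [shift]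

lemma mem_disc_self (z : ℂ) (j : ZMod d) {ε : ℝ} (hε : 0 < ε) :
    pt d x (toTorus z) j ∈ disc d x z j ε :=
  ⟨0, Metric.mem_ball_self hε, by simp [shift_zero]⟩

/-- Small discs around points that are not ends of the slit are open, and embedded in the torus. -/
lemma exists_isOpen_disc [NeZero d] (hx : 0 < x) {z : ℂ} (hz : ¬ IsEnd x (toTorus z)) :
    ∃ ε > 0, ε < 1 / 2 ∧ (∀ h : ℂ, ‖h‖ < ε → ¬ IsEnd x (toTorus (z + h))) ∧
      (∀ h : ℂ, ‖h‖ < ε → ∀ᶠ k in 𝓝 (0 : ℂ), shift x (toTorus z) (h + k) =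
      shift x (toTorus z) h + shift x (toTorus (z + h)) k) ∧
      ∀ j : ZMod d, ∀ δ ≤ ε, IsOpen (disc d x z j δ) := by
  obtain ⟨ε, hε, H⟩ := Metric.eventually_nhds_iff_ball.1
    ((eventually_shift_add hx hz).and (eventually_not_isEnd hz))
  refine ⟨min ε (1 / 3), lt_min hε (by norm_num), (min_le_right _ _).trans_lt (by norm_num),
    fun h hh => (H h (by simpa using hh.trans_le (min_le_left _ _))).2,
    fun h hh => (H h (by simpa using hh.trans_le (min_le_left _ _))).1, fun j δ hδ => ?_⟩
  rw [isOpen_iff]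
  rintro w i ⟨h, hh, e⟩
  have hh' : ‖h‖ < δ := by simpa using hh
  obtain ⟨h1, h2⟩ := H h (by simpa using hh'.trans_le (hδ.trans (min_le_left _ _)))
  obtain ⟨e1, e2⟩ := pt_eq_pt_iff.1 e
  have e3 := e2.resolve_left h2
  refine ⟨fun he => absurd (e1 ▸ he) h2, fun _ => ?_⟩
  have hball : ∀ᶠ k in 𝓝 (0 : ℂ), ‖h + k‖ < δ := by
    have : Continuous (fun k : ℂ => ‖h + k‖) := by fun_prop
    exact (this.tendsto 0).eventually (gt_mem_nhds (by simpa using hh'))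
  filter_upwards [h1, hball] with k k1 k2
  refine ⟨h + k, by simpa using k2, ?_⟩
  simp only [k1]
  rw [toTorus_add w k, ← e1, ← e3, ← toTorus_add, add_assoc z h k]
  push_cast
  rw [add_assoc]

/-- The points near a point that is not an end of the slit. -/
lemma eventually_nhds_pt [NeZero d] (hx : 0 < x) {z : ℂ} (hz : ¬ IsEnd x (toTorus z))
    (j : ZMod d) : ∀ᶠ y in 𝓝 (pt d x (toTorus z) j), ∃ h : ℂ, ‖h‖ < 1 / 2 ∧
      pt d x (toTorus (z + h)) (j + (shift x (toTorus z) h : ℕ)) = y := by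
  obtain ⟨ε, hε, hε', -, -, ho⟩ := exists_isOpen_disc (d := d) hx hz
  filter_upwards [(ho j ε le_rfl).mem_nhds (mem_disc_self z j hε)] with y hy
  obtain ⟨h, hh, e⟩ := hy
  exact ⟨h, (by simpa using hh : ‖h‖ < ε).trans hε', e⟩

lemma t2Space [NeZero d] (hx : 0 < x) : T2Space (Space d x) := by
  refine ⟨fun a b hab => ?_⟩
  by_cases hp : toBase d (x : ℂ) a = toBase d (x : ℂ) b
  · obtain ⟨z, j, rfl⟩ := exists_pt a
    obtain ⟨w, k, rfl⟩ := exists_pt b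
    simp only [toBase_pt] at hp
    rw [← hp] at hab ⊢
    have hz : ¬ IsEnd x (toTorus z) := fun h => hab (pt_eq_of_isEnd h j k)
    obtain ⟨ε, hε, hε', hend, -, ho⟩ := exists_isOpen_disc (d := d) hx hz
    refine ⟨_, _, ho j ε le_rfl, ho k ε le_rfl, mem_disc_self z j hε, mem_disc_self z k hε, ?_⟩
    rw [Set.disjoint_left]
    rintro y ⟨h, hh, rfl⟩ ⟨h', hh', e⟩
    have hh : ‖h‖ < ε := by simpa using hh
    have hh' : ‖h'‖ < ε := by simpa using hh'
    obtain ⟨e1, e2⟩ := pt_eq_pt_iff.1 e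
    rw [toTorus_add, toTorus_add, add_right_inj] at e1
    have := eq_of_toTorus_eq (hh'.trans hε') (hh.trans hε') e1
    subst this
    have e3 := add_right_cancel (e2.resolve_left (hend _ hh))
    exact hab (by rw [e3])
  · obtain ⟨U, V, hU, hV, ha, hb, hUV⟩ := t2_separation hp
    exact ⟨_, _, hU.preimage continuous_toBase, hV.preimage continuous_toBase, ha, hb,
      hUV.preimage _⟩

end RealSlit

end ConnectedSum

namespace ConnectedSum

variable {d : ℕ}

/-! ### Monodromy along horizontal and vertical circles -/

/-- The horizontal line through `z` meets no translate of the end points `0` and `v`. -/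
def GenericHeight (v z : ℂ) : Prop := (∀ k : ℤ, z.im ≠ k) ∧ ∀ k : ℤ, v.im - z.im ≠ k

lemma GenericHeight.add_real {v z : ℂ} (h : GenericHeight v z) (t : ℝ) :
    GenericHeight v (z + t) := by
  simpa [GenericHeight] using h

lemma GenericHeight.not_isEnd {v z : ℂ} (h : GenericHeight v z) : ¬ IsEnd v (toTorus z) := by
  rw [isEnd_toTorus_iff, mem_gaussianLattice, mem_gaussianLattice]
  rintro (⟨a, b, -, hb⟩ | ⟨a, b, -, hb⟩)
  · exact h.1 b hb
  · exact h.2 (-b) (by rw [Complex.sub_im] at hb; push_cast; linarith)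

lemma floor_neg_of_ne {y : ℝ} (hy : ∀ k : ℤ, y ≠ k) : ⌊-y⌋ = -⌊y⌋ - 1 := by
  rw [Int.floor_eq_iff]
  have h1 := Int.lt_floor_add_one y
  have h2 := lt_of_le_of_ne (Int.floor_le y) (hy _).symm
  push_cast
  constructor <;> linarith

/-- A function on the plane that records the change of sheets at all generic heights, and its
monodromy along horizontal circles: the number of translates of the slit that they cross. -/
lemma exists_potential (v : ℂ) : ∃ S : ℂ → ℤ,
    (∀ z, GenericHeight v z → ∀ᶠ h in 𝓝 (0 : ℂ), S (z + h) = S z - (shift v (toTorus z) h : ℕ)) ∧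
    ∀ z, GenericHeight v z → S (z + 1) = S z - (⌊v.im - z.im⌋ - ⌊-z.im⌋) := by
  rcases lt_trichotomy v.im 0 with hv | hv | hv
  · have hv' : 0 < (-v).im := by simpa using hv
    have hg {z : ℂ} (hz : GenericHeight v z) : GenericHeight (-v) (-z) :=
      ⟨fun k hk => hz.1 (-k) (by rw [Complex.neg_im] at hk; push_cast; linarith),
        fun k hk => hz.2 (-k) (by simp only [Complex.neg_im] at hk; push_cast; linarith)⟩
    refine ⟨fun z => rowSum (-v) (-z), fun z hz => ?_, fun z hz => ?_⟩
    · have h1 := eventually_rowSum_add hv' (hg hz).1 (hg hz).2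
      have ht : Tendsto (fun h : ℂ => -h) (𝓝 0) (𝓝 0) := by
        simpa using (continuous_neg (G := ℂ)).tendsto 0
      filter_upwards [ht.eventually h1] with h hh
      rw [neg_add, hh, ← shift_linAct (-1) v z h]
      simp only [linAct_neg_one]
    · have h1 := rowSum_of_translate (z := -(z + 1)) (w := -z) (a := -1) (b := 0) hv'
        (by simp) (by simp)
      have h2 : ⌊(-v).im - (-z).im⌋ = -⌊v.im - z.im⌋ - 1 := by
        rw [← floor_neg_of_ne hz.2]
        congr 1
        simp only [Complex.neg_im]; ring
      have h3 : ⌊-(-z).im⌋ = -⌊-z.im⌋ - 1 := by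
        rw [← floor_neg_of_ne fun k hk => hz.1 (-k) (by push_cast; linarith)]
        simp
      simp only
      rw [h1, h2, h3]
      ring
  · refine ⟨fun _ => 0, fun z hz => Eventually.of_forall fun h => ?_, fun z _ => ?_⟩
    · rw [shift_eq_zero_of_im hv hz.1]; simp
    · simp [hv]
  · exact ⟨rowSum v, fun z hz => eventually_rowSum_add hv hz.1 hz.2, fun z _ => by
      simpa using rowSum_of_translate (z := z + 1) (w := z) (a := 1) (b := 0) hv
        (by simp) (by simp)⟩

/-- A function of the sheets that is locally constant along a horizontal line is constant there,
once the sheets are relabelled by a potential. -/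
lemma eq_along_line {α : Type*} {v z : ℂ} {S : ℂ → ℤ} {σ : ℂ → ZMod d → α}
    (hS : ∀ t : ℝ, ∀ᶠ h in 𝓝 (0 : ℂ), S (z + t + h) =
      S (z + t) - (shift v (toTorus (z + t)) h : ℕ))
    (hσ : ∀ (t : ℝ) (j : ZMod d), ∀ᶠ h in 𝓝 (0 : ℂ),
      σ (z + t + h) (j + (shift v (toTorus (z + t)) h : ℕ)) = σ (z + t) j)
    (t : ℝ) (j : ZMod d) : σ (z + t) (j - S (z + t)) = σ z (j - S z) := by
  have key := eq_of_eventually_eq_const (s := Set.univ) isPreconnected_univ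
    (p := fun t : ℝ => σ (z + t) (j - S (z + t))) (fun t _ => ?_) (Set.mem_univ t)
    (Set.mem_univ (0 : ℝ))
  · simpa using key
  · have ht : Tendsto (fun u : ℝ => ((u - t : ℝ) : ℂ)) (𝓝 t) (𝓝 0) := by
      have : Continuous (fun u : ℝ => ((u - t : ℝ) : ℂ)) := by fun_prop
      simpa using this.tendsto t
    filter_upwards [ht.eventually (hS t), ht.eventually (hσ t (j - S (z + t)))] with u h1 h2
    have e : z + t + ((u - t : ℝ) : ℂ) = z + u := by push_cast; ring
    rw [e] at h1 h2
    rw [h1, ← h2]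
    congr 1
    push_cast
    ring

/-- A choice of sheets `σ` for a map between the connected sums along `[0, v]` and `[0, v']` that
covers the identity of the torus: `(z, j) ↦ (z, σ z j)`. -/
structure SheetMap (d : ℕ) (v v' : ℂ) (σ : ℂ → ZMod d → ZMod d) : Prop where
  periodic : ∀ z w, toTorus z = toTorus w → ¬ IsEnd v (toTorus z) → σ z = σ w
  jump : ∀ z, ¬ IsEnd v (toTorus z) → ∀ j, ∀ᶠ h in 𝓝 (0 : ℂ),
    σ (z + h) (j + (shift v (toTorus z) h : ℕ)) = σ z j + (shift v' (toTorus z) h : ℕ)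

lemma half_ne_int (k : ℤ) : (1 / 2 : ℝ) ≠ k := by
  intro h
  have : (1 : ℝ) = ((2 * k : ℤ) : ℝ) := by push_cast; linarith
  have : (1 : ℤ) = 2 * k := by exact_mod_cast this
  lia

namespace SheetMap

variable {v v' : ℂ} {σ : ℂ → ZMod d → ZMod d}

lemma eq_along_line (h : SheetMap d v v' σ) {z : ℂ} {S S' : ℂ → ℤ} (hz : GenericHeight v z)
    (hz' : GenericHeight v' z)
    (hS : ∀ z, GenericHeight v z → ∀ᶠ h in 𝓝 (0 : ℂ),
      S (z + h) = S z - (shift v (toTorus z) h : ℕ))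
    (hS' : ∀ z, GenericHeight v' z → ∀ᶠ h in 𝓝 (0 : ℂ),
      S' (z + h) = S' z - (shift v' (toTorus z) h : ℕ)) (t : ℝ) (j : ZMod d) :
    σ (z + t) (j - S (z + t)) + S' (z + t) = σ z (j - S z) + S' z := by
  refine ConnectedSum.eq_along_line (σ := fun w j => σ w j + S' w) (v := v)
    (fun t => hS _ (hz.add_real t)) (fun t j => ?_) t j
  filter_upwards [h.jump _ (hz.add_real t).not_isEnd j, hS' _ (hz'.add_real t)] with k h1 h2
  rw [h1, h2]
  push_cast
  ring

lemma genericHeight_iff {q : ℤ} (hq : v.im = v'.im + q) {z : ℂ} :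
    GenericHeight v z ↔ GenericHeight v' z := by
  refine and_congr_right fun _ => ⟨fun h k hk => h (k + q) ?_, fun h k hk => h (k - q) ?_⟩ <;>
  push_cast <;> linarith

lemma horizontal_monodromy (h : SheetMap d v v' σ) {q : ℤ} (hq : v.im = v'.im + q) {z : ℂ}
    (hz' : GenericHeight v' z) (j : ZMod d) :
    σ z (j + (⌊v.im - z.im⌋ - ⌊-z.im⌋ : ℤ)) = σ z j + (⌊v'.im - z.im⌋ - ⌊-z.im⌋ : ℤ) := by
  have hz := (genericHeight_iff hq).2 hz'
  obtain ⟨S, hS, hS1⟩ := exists_potential v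
  obtain ⟨S', hS', hS1'⟩ := exists_potential v'
  have key := h.eq_along_line hz hz' hS hS' 1 (j + S z)
  rw [Complex.ofReal_one, hS1 z hz, hS1' z hz',
    ← h.periodic z (z + 1) (toTorus_eq_iff_int.2 ⟨-1, 0, by simp, by simp⟩) hz.not_isEnd] at key
  rw [add_sub_cancel_right, show j + (S z : ZMod d) - ((S z - (⌊v.im - z.im⌋ - ⌊-z.im⌋) : ℤ) :
    ZMod d) = j + (⌊v.im - z.im⌋ - ⌊-z.im⌋ : ℤ) by push_cast; ring] at key
  push_cast at key ⊢
  linear_combination key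

/-- Two points of a horizontal line have the same sheets up to relabelling by translations. -/
lemma exists_compare (h : SheetMap d v v' σ) {q : ℤ} (hq : v.im = v'.im + q) {z : ℂ}
    (hz' : GenericHeight v' z) (t : ℝ) :
    ∃ a b : ZMod d, ∀ j, σ (z + t) (j + a) = σ z j + b := by
  have hz := (genericHeight_iff hq).2 hz'
  obtain ⟨S, hS, -⟩ := exists_potential v
  obtain ⟨S', hS', -⟩ := exists_potential v'
  refine ⟨S z - S (z + t), S' z - S' (z + t), fun j => ?_⟩
  have key := h.eq_along_line hz hz' hS hS' t (j + S z)
  rw [add_sub_cancel_right] at key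
  rw [← add_sub_assoc]
  linear_combination key

lemma linear (h : SheetMap d v v' σ) (B : SL(2, ℤ)) :
    SheetMap d (linAct (intToReal B) v) (linAct (intToReal B) v')
      (fun z => σ (linAct (intToReal B⁻¹) z)) where
  periodic z w e hz := by
    rw [← linAct_intToReal_self_inv B z, isEnd_linAct_iff rfl] at hz
    exact h.periodic _ _ ((toTorus_linAct_eq_iff _).2 e) hz
  jump z hz j := by
    have e := linAct_intToReal_self_inv B
    rw [← e z, isEnd_linAct_iff rfl] at hz
    filter_upwards [(tendsto_linAct_zero (intToReal B⁻¹)).eventually (h.jump _ hz j)] with k hk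
    rw [← shift_linAct B v, ← shift_linAct B v', e, e] at hk
    rw [linAct_add, hk]

lemma vertical_monodromy (h : SheetMap d v v' σ) {p : ℤ} (hp : v.re = v'.re + p) {z : ℂ}
    (h0 : ∀ k : ℤ, z.re ≠ k) (h1 : ∀ k : ℤ, v'.re - z.re ≠ k) (j : ZMod d) :
    σ z (j + (⌊v.re - z.re⌋ - ⌊-z.re⌋ : ℤ)) = σ z j + (⌊v'.re - z.re⌋ - ⌊-z.re⌋ : ℤ) := by
  have := (h.linear ModularGroup.S).horizontal_monodromy (q := p)
    (z := linAct (intToReal ModularGroup.S) z) (by simpa only [linAct_S] using hp)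
    (by rw [GenericHeight, linAct_S, linAct_S]; exact ⟨h0, h1⟩) j
  rw [linAct_intToReal_inv_self] at this
  simpa only [linAct_S] using this

lemma _root_.ZMod.map_add_of_map_add_one [NeZero d] {f : ZMod d → ZMod d}
    (hf : ∀ j, f (j + 1) = f j + 1) (j m : ZMod d) : f (j + m) = f j + m := by
  have key (n : ℕ) : f (j + n) = f j + n := by
    induction n with
    | zero => simp
    | succ n ih => push_cast; rw [← add_assoc, hf, ih, add_assoc]
  simpa using key m.val

lemma exists_generic (y : ℝ) : ∃ s : ℝ, (∀ k : ℤ, s ≠ k) ∧ ∀ k : ℤ, y - s ≠ k := by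
  have quarter (k : ℤ) : (1 / 4 : ℝ) ≠ k := by
    intro h
    have : (1 : ℝ) = ((4 * k : ℤ) : ℝ) := by push_cast; linarith
    have : (1 : ℤ) = 4 * k := by exact_mod_cast this
    lia
  by_cases hy : ∀ k : ℤ, y - 1 / 2 ≠ k
  · exact ⟨_, half_ne_int, hy⟩
  · push Not at hy
    obtain ⟨k, hk⟩ := hy
    exact ⟨_, quarter, fun m hm => quarter (m - k) (by push_cast; linarith)⟩

/-- An equivariant isomorphism over the torus determines the slit modulo `d` times the periods. -/
lemma eq_zero_of_equivariant [NeZero d] (h : SheetMap d v v' σ) {p q : ℤ}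
    (hp : v.re = v'.re + p) (hq : v.im = v'.im + q)
    (heq : ∀ z, ¬ IsEnd v (toTorus z) → ∀ j, σ z (j + 1) = σ z j + 1) :
    (p : ZMod d) = 0 ∧ (q : ZMod d) = 0 := by
  obtain ⟨s, hs, hs'⟩ := exists_generic v'.re
  obtain ⟨t, ht, ht'⟩ := exists_generic v'.im
  have hz' : GenericHeight v' ⟨s, t⟩ := ⟨ht, ht'⟩
  have e := ZMod.map_add_of_map_add_one (heq _ ((genericHeight_iff hq).2 hz').not_isEnd) 0
  have h1 := h.vertical_monodromy (z := ⟨s, t⟩) hp hs hs' 0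
  have h2 := h.horizontal_monodromy hq hz' 0
  rw [e, add_right_inj] at h1 h2
  have r1 : v.re - s = v'.re - s + p := by rw [hp]; ring
  have r2 : v.im - t = v'.im - t + q := by rw [hq]; ring
  simp only [r1, r2, Int.floor_add_intCast] at h1 h2
  push_cast at h1 h2
  exact ⟨by linear_combination h1, by linear_combination h2⟩

end SheetMap

/-- On both sides of a vertical line through the lattice, the vertical circles cross a real slit
of non-integral length a different number of times. -/
lemma exists_vertical_lines {x : ℝ} (hx : ∀ k : ℤ, x ≠ k) : ∃ s t : ℝ,
    ((∀ k : ℤ, s ≠ k) ∧ ∀ k : ℤ, x - s ≠ k) ∧ ((∀ k : ℤ, t ≠ k) ∧ ∀ k : ℤ, x - t ≠ k) ∧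
    ⌊x - t⌋ - ⌊-t⌋ = ⌊x - s⌋ - ⌊-s⌋ + 1 := by
  have h0 : (⌊x⌋ : ℝ) < x := lt_of_le_of_ne (Int.floor_le x) (hx _).symm
  have h1 := Int.lt_floor_add_one x
  have hne {y : ℝ} {m : ℤ} (a : (m : ℝ) < y) (b : y < m + 1) (k : ℤ) : y ≠ k := by
    rintro rfl
    have a : m < k := by exact_mod_cast a
    have b : k < m + 1 := by exact_mod_cast b
    lia
  refine ⟨(x - ⌊x⌋ - 1) / 2, (x - ⌊x⌋) / 2, ⟨hne (m := -1) ?_ ?_, hne (m := ⌊x⌋) ?_ ?_⟩,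
    ⟨hne (m := 0) ?_ ?_, hne (m := ⌊x⌋) ?_ ?_⟩, ?_⟩
  any_goals (push_cast; linarith)
  have e1 : ⌊x - (x - ⌊x⌋) / 2⌋ = ⌊x⌋ := Int.floor_eq_iff.2 ⟨by linarith, by linarith⟩
  have e2 : ⌊-((x - ⌊x⌋) / 2)⌋ = -1 := Int.floor_eq_iff.2
    ⟨by push_cast; linarith, by push_cast; linarith⟩
  have e3 : ⌊x - (x - ⌊x⌋ - 1) / 2⌋ = ⌊x⌋ := Int.floor_eq_iff.2 ⟨by linarith, by linarith⟩
  have e4 : ⌊-((x - ⌊x⌋ - 1) / 2)⌋ = 0 := Int.floor_eq_iff.2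
    ⟨by push_cast; linarith, by push_cast; linarith⟩
  rw [e1, e2, e3, e4]
  ring

/-- Without assuming equivariance, an isomorphism over the torus onto a connected sum with two
different end points still determines the slit modulo `d` times the periods: the vertical circles
to both sides of an end point differ by a small loop around it, which forces equivariance. -/
lemma SheetMap.eq_zero_of_injective [NeZero d] {v : ℂ} {x : ℝ} {σ : ℂ → ZMod d → ZMod d}
    (h : SheetMap d v x σ) (hx : ∀ k : ℤ, x ≠ k) {p q : ℤ}
    (hp : v.re = x + p) (hq : v.im = q)
    (hinj : ∀ z, ¬ IsEnd v (toTorus z) → Function.Injective (σ z)) :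
    (p : ZMod d) = 0 ∧ (q : ZMod d) = 0 := by
  obtain ⟨s, t, hs, ht, hst⟩ := exists_vertical_lines hx
  have hq' : v.im = (x : ℂ).im + q := by simpa using hq
  have hg (s : ℝ) : GenericHeight x ⟨s, 1 / 2⟩ :=
    ⟨half_ne_int, fun k hk => half_ne_int (-k) (by
      simp only [Complex.ofReal_im] at hk; push_cast; linarith)⟩
  have h1 := h.vertical_monodromy (z := ⟨s, 1 / 2⟩) hp hs.1 hs.2
  have h2 := h.vertical_monodromy (z := ⟨t, 1 / 2⟩) hp ht.1 ht.2
  obtain ⟨a, b, hab⟩ := h.exists_compare hq' (hg s) (t - s)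
  have e : (⟨s, 1 / 2⟩ : ℂ) + ((t - s : ℝ) : ℂ) = ⟨t, 1 / 2⟩ := by
    apply Complex.ext <;> simp
  have hab : ∀ j, σ ⟨t, 1 / 2⟩ (j + a) = σ ⟨s, 1 / 2⟩ j + b := e ▸ hab
  simp only [Complex.ofReal_re] at h1 h2
  have r (s : ℝ) : v.re - s = x - s + p := by rw [hp]; ring
  simp only [r, Int.floor_add_intCast] at h1 h2
  rw [show ⌊x - t⌋ + p - ⌊-t⌋ = (⌊x - s⌋ + p - ⌊-s⌋) + 1 by lia, hst] at h2
  have heq (j : ZMod d) : σ ⟨s, 1 / 2⟩ (j + 1) = σ ⟨s, 1 / 2⟩ j + 1 := by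
    obtain ⟨u, rfl⟩ : ∃ u, u + ((⌊x - s⌋ + p - ⌊-s⌋ : ℤ) : ZMod d) = j :=
      ⟨_, sub_add_cancel j _⟩
    rw [h1]
    have k1 := h2 (u + a)
    rw [hab, show u + a + ((⌊x - s⌋ + p - ⌊-s⌋ + 1 : ℤ) : ZMod d) =
      u + ((⌊x - s⌋ + p - ⌊-s⌋ : ℤ) : ZMod d) + 1 + a by push_cast; ring, hab] at k1
    push_cast at k1 ⊢
    linear_combination k1
  constructor
  · have := h1 0
    rw [ZMod.map_add_of_map_add_one heq] at this
    push_cast at this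
    linear_combination this
  · have h3 := h.horizontal_monodromy hq' (hg s) 0
    have e3 : ⌊v.im - 1 / 2⌋ = q + ⌊-(1 / 2 : ℝ)⌋ := by
      rw [hq, sub_eq_add_neg, Int.floor_intCast_add]
    simp only [e3, Complex.ofReal_im, zero_sub, sub_self, add_sub_cancel_right, Int.cast_zero,
      add_zero] at h3
    simpa using hinj _ ((SheetMap.genericHeight_iff hq').2 (hg s)).not_isEnd h3

/-- The sheets of a continuous map that covers the identity of the torus. -/
lemma exists_sheetMap [NeZero d] {v : ℂ} {x : ℝ} (hx : 0 < x) (hvx : toTorus v = toTorus x)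
    {f : Space d v → Space d x} (hf : Continuous f)
    (hf' : ∀ (z : ℂ) (j : ZMod d), toBase d (x : ℂ) (f (pt d v (toTorus z) j)) = toTorus z) :
    ∃ σ, SheetMap d v x σ ∧
      ∀ (z : ℂ) (j : ZMod d), f (pt d v (toTorus z) j) = pt d x (toTorus z) (σ z j) := by
  have hσ (z : ℂ) (j : ZMod d) : ∃ k, f (pt d v (toTorus z) j) = pt d x (toTorus z) k := by
    obtain ⟨w, k, e⟩ := exists_pt (f (pt d v (toTorus z) j))
    have := hf' z j
    rw [← e, toBase_pt] at this
    exact ⟨k, by rw [← e, this]⟩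
  choose σ hσ using hσ
  have hend (z : ℂ) : IsEnd v (toTorus z) ↔ IsEnd x (toTorus z) := by rw [IsEnd, IsEnd, hvx]
  refine ⟨σ, ⟨fun z w e hz => ?_, fun z hz j => ?_⟩, hσ⟩
  · funext j
    have := hσ w j
    rw [← e, hσ z j] at this
    exact (pt_eq_pt_iff.1 this).2.resolve_left (by rwa [← hend])
  · have h1 := hf.continuousAt.eventually
      (by rw [hσ]; exact eventually_nhds_pt hx (by rwa [← hend]) (σ z j))
    filter_upwards [eventually_of_mem_nhds hz h1, eventually_not_isEnd hz,
      Metric.ball_mem_nhds (0 : ℂ) (by norm_num : (0 : ℝ) < 1 / 2)] with h ⟨k, hk, e⟩ h2 h3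
    rw [hσ] at e
    obtain ⟨e1, e2⟩ := pt_eq_pt_iff.1 e
    rw [toTorus_add, toTorus_add, add_right_inj] at e1
    have := eq_of_toTorus_eq hk (by simpa using h3) e1
    subst this
    exact (e2.resolve_left (by rwa [← hend])).symm

/-- Connected sums that are isomorphic over the torus have slits that differ by `d` times a
period. -/
lemma exists_of_covers_id [NeZero d] {v : ℂ} {x : ℝ} (hx : 0 < x) (hvx : toTorus v = toTorus x)
    {f : Space d v → Space d x} (hf : Continuous f) (hinj : Function.Injective f)
    (hf' : ∀ (z : ℂ) (j : ZMod d), toBase d (x : ℂ) (f (pt d v (toTorus z) j)) = toTorus z)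
    (h : (∀ k : ℤ, x ≠ k) ∨
      ∀ y, f (nextSheet d v y) = nextSheet d x (f y)) :
    ∃ p q : ℤ, v.re = x + d * p ∧ v.im = d * q := by
  obtain ⟨σ, hσ, hfσ⟩ := exists_sheetMap hx hvx hf hf'
  obtain ⟨p, q, hp, hq⟩ := toTorus_eq_iff_int.1 hvx
  have hend (z : ℂ) : IsEnd v (toTorus z) ↔ IsEnd x (toTorus z) := by rw [IsEnd, IsEnd, hvx]
  simp only [Complex.ofReal_re, Complex.ofReal_im, sub_zero] at hp hq
  have hp : v.re = x + p := by linarith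
  have key : (p : ZMod d) = 0 ∧ (q : ZMod d) = 0 := by
    rcases h with h | h
    · refine hσ.eq_zero_of_injective h hp hq fun z hz i j e => ?_
      have := hinj ((hfσ z i).trans ((e ▸ rfl : _ = _).trans (hfσ z j).symm))
      exact (pt_eq_pt_iff.1 this).2.resolve_left hz
    · refine hσ.eq_zero_of_equivariant (p := p) (q := q) hp (by simpa using hq) fun z hz j => ?_
      have := h (pt d v (toTorus z) j)
      rw [nextSheet_pt, hfσ, hfσ, nextSheet_pt] at this
      exact (pt_eq_pt_iff.1 this).2.resolve_left (by rwa [← hend])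
  rw [ZMod.intCast_zmod_eq_zero_iff_dvd, ZMod.intCast_zmod_eq_zero_iff_dvd] at key
  obtain ⟨⟨a, rfl⟩, ⟨b, rfl⟩⟩ := key
  exact ⟨a, b, by rw [hp]; push_cast; ring, by rw [hq]; push_cast; ring⟩

end ConnectedSum

namespace ConnectedSum

open EllipticDifferential

variable {d : ℕ}

/-! ### Affine homeomorphisms cover linear maps of the torus -/

lemma IsAffine.eventually_proj [NeZero d] {v v' : ℂ} {A : SL(2, ℝ)} {f : Space d v → Space d v'}
    (hf : IsAffine (Y := connectedSum d v) (Z := connectedSum d v') A f) {z : ℂ}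
    (hz : ¬ IsEnd v (toTorus z)) (j : ZMod d) : ∀ᶠ h in 𝓝 (0 : ℂ),
      toBase d v' (f (pt d v (toTorus (z + h)) (j + (shift v (toTorus z) h : ℕ)))) =
        toBase d v' (f (pt d v (toTorus z) j)) + toTorus (linAct A h) := by
  have hne := not_or.1 ((eq_p₀_or_p₁_iff (d := d) (j := j)).not.2 hz)
  filter_upwards [eventually_of_mem_nhds hz (hf.2.2.2 _ hne.1 hne.2),
    Metric.ball_mem_nhds (0 : ℂ) (by norm_num : (0 : ℝ) < 1 / 2)] with h ⟨k, hk, e1, e2⟩ hh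
  have e1 : toTorus (z + h) = toTorus z + toTorus k := e1
  rw [toTorus_add, add_right_inj] at e1
  obtain rfl := eq_of_toTorus_eq (by simpa using hh) hk e1
  exact e2

/-- If the points over a point of the torus all have images over one point, then an affine map
covers the linear map `A` of the torus. -/
lemma IsAffine.proj_eq [NeZero d] {v v' : ℂ} {A : SL(2, ℝ)} {f : Space d v → Space d v'}
    (hf : IsAffine (Y := connectedSum d v) (Z := connectedSum d v') A f)
    (hind : ∀ z, ¬ IsEnd v (toTorus z) → ∀ j k, toBase d v' (f (pt d v (toTorus z) j)) =
      toBase d v' (f (pt d v (toTorus z) k))) (z : ℂ) (j : ZMod d) :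
    toBase d v' (f (pt d v (toTorus z) j)) = toTorus (linAct A z) := by
  have hcont : Continuous (fun z => toBase d v' (f (pt d v (toTorus z) 0))) := by
    rw [continuous_iff_continuousAt]
    intro z
    rw [ContinuousAt, tendsto_nhds]
    intro V hV hz
    change ∀ᶠ w in 𝓝 z, _
    rw [eventually_nhds_iff_add]
    have hpre : IsOpen ((fun x => toBase d v' (f x)) ⁻¹' V) :=
      hV.preimage (continuous_toBase.comp hf.1.continuous)
    by_cases e : IsEnd v (toTorus z)
    · exact (isOpen_iff.1 hpre z 0 hz).1 e 0
    · filter_upwards [(isOpen_iff.1 hpre z 0 hz).2 e, eventually_not_isEnd e] with h h1 h2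
      have h1 : toBase d v' (f _) ∈ V := h1
      rwa [hind _ h2 _ 0] at h1
  have hconst : ∀ w ∈ {z : ℂ | ¬ IsEnd v (toTorus z)}, ∀ w' ∈ {z : ℂ | ¬ IsEnd v (toTorus z)},
      toBase d v' (f (pt d v (toTorus w) 0)) - toTorus (linAct A w) =
      toBase d v' (f (pt d v (toTorus w') 0)) - toTorus (linAct A w') := by
    intro w hw w' hw'
    refine eq_of_eventually_eq_const (isPreconnected_compl_ends v)
      (p := fun w => toBase d v' (f (pt d v (toTorus w) 0)) - toTorus (linAct A w))
      (fun w hw => ?_) hw hw'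
    rw [eventually_nhds_iff_add]
    filter_upwards [IsAffine.eventually_proj hf hw 0, eventually_not_isEnd hw] with h h1 h2
    rw [hind _ h2 0 (0 + (shift v (toTorus w) h : ℕ)), h1, linAct_add, toTorus_add]
    abel
  have hdense := dense_compl_ends v
  obtain ⟨w, hw⟩ := hdense.nonempty
  have hlin : Continuous (fun z => toTorus (linAct A z)) :=
    continuous_toTorus.comp (continuous_linAct A)
  have hall := (hcont.sub hlin).ext_on hdense continuous_const fun w' hw' => hconst w' hw' w hw
  have h0 : f (pt d v (toTorus 0) 0) = pt d v' (toTorus 0) 0 := hf.2.1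
  have key : toBase d v' (f (pt d v (toTorus z) 0)) - toTorus (linAct A z) = 0 := by
    have h1 := congrFun hall z
    rw [← congrFun hall 0] at h1
    simpa only [Pi.sub_apply, h0, toBase_pt, linAct_zero, sub_self] using h1
  rw [← sub_eq_zero.1 key]
  by_cases e : IsEnd v (toTorus z)
  · rw [pt_eq_of_isEnd e j 0]
  · exact hind z e j 0

lemma exists_intToReal_of_map_lattice {A : SL(2, ℝ)}
    (h : ∀ w ∈ gaussianLattice, linAct A w ∈ gaussianLattice) :
    ∃ B : SL(2, ℤ), intToReal B = A := by
  obtain ⟨a, c, ha, hc⟩ := mem_gaussianLattice.1 (h 1 (mem_gaussianLattice.2 ⟨1, 0, by simp⟩))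
  obtain ⟨b, e, hb, he⟩ := mem_gaussianLattice.1
    (h Complex.I (mem_gaussianLattice.2 ⟨0, 1, by simp⟩))
  simp only [linAct, Complex.one_re, Complex.one_im, Complex.I_re, Complex.I_im, mul_one, mul_zero,
    add_zero, zero_add] at ha hb hc he
  have hdet := A.det_coe
  rw [Matrix.det_fin_two, ha, hb, hc, he] at hdet
  refine ⟨⟨!![a, b; c, e], ?_⟩, ?_⟩
  · rw [Matrix.det_fin_two_of]
    exact_mod_cast hdet
  · ext i j
    fin_cases i <;> fin_cases j
    exacts [ha.symm, hb.symm, hc.symm, he.symm]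

/-- Affine maps that commute with the symmetry cover a map of the torus, since the fibres are
orbits. -/
lemma IsAffine.proj_indep_of_equivariant [NeZero d] {v v' : ℂ} {f : Space d v → Space d v'}
    (hf : ∀ x, f (nextSheet d v x) = nextSheet d v' (f x)) (z : SquareTorus)
    (j k : ZMod d) : toBase d v' (f (pt d v z j)) = toBase d v' (f (pt d v z k)) := by
  have hrot (y : Space d v') : toBase d v' (nextSheet d v' y) = toBase d v' y := by
    obtain ⟨w, i, rfl⟩ := exists_pt y
    rw [nextSheet_pt, toBase_pt, toBase_pt]
  have key (n : ℕ) : toBase d v' (f (pt d v z n)) = toBase d v' (f (pt d v z 0)) := by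
    induction n with
    | zero => simp
    | succ n ih => rw [Nat.cast_add_one, ← nextSheet_pt, hf, hrot, ih]
  have h1 := key j.val
  have h2 := key k.val
  rw [ZMod.natCast_zmod_val] at h1 h2
  rw [h1, h2]

/-- If the two end points of a real slit are distinct, then affine maps cover a map of the torus:
a small loop around an end point leads from one sheet to the next, and has trivial holonomy. -/
lemma IsAffine.proj_indep_of_not_int [NeZero d] {x : ℝ} (hx : ∀ k : ℤ, x ≠ k) {v' : ℂ}
    {A : SL(2, ℝ)} {f : Space d x → Space d v'}
    (hf : IsAffine (Y := connectedSum d x) (Z := connectedSum d v') A f) (z : ℂ)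
    (hz : ¬ IsEnd x (toTorus z)) (j k : ZMod d) :
    toBase d v' (f (pt d x (toTorus z) j)) = toBase d v' (f (pt d x (toTorus z) k)) := by
  set G : ℂ → ZMod d → SquareTorus := fun z j =>
    toBase d v' (f (pt d x (toTorus z) j)) - toTorus (linAct A z) with hGdef
  have hG (z : ℂ) (hz : ¬ IsEnd x (toTorus z)) (j : ZMod d) : ∀ᶠ h in 𝓝 (0 : ℂ),
      G (z + h) (j + (shift x (toTorus z) h : ℕ)) = G z j := by
    filter_upwards [IsAffine.eventually_proj hf hz j] with h hh
    simp only [hGdef]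
    rw [hh, linAct_add, toTorus_add]
    abel
  obtain ⟨s, t, hs, ht, hst⟩ := exists_vertical_lines hx
  have hg (s : ℝ) : GenericHeight x ⟨s, 1 / 2⟩ :=
    ⟨half_ne_int, fun k hk => half_ne_int (-k) (by
      simp only [Complex.ofReal_im] at hk; push_cast; linarith)⟩
  -- Going down once along a vertical circle.
  have hvert (s : ℝ) (hs : (∀ k : ℤ, s ≠ k) ∧ ∀ k : ℤ, x - s ≠ k) (j : ZMod d) :
      G ⟨s, 1 / 2⟩ (j + (⌊x - s⌋ - ⌊-s⌋ : ℤ)) + toTorus (linAct A Complex.I) =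
        G ⟨s, 1 / 2⟩ j := by
    obtain ⟨S, hS, hS1⟩ := exists_potential (linAct (intToReal ModularGroup.S) x)
    have hgen : GenericHeight (linAct (intToReal ModularGroup.S) x)
        (linAct (intToReal ModularGroup.S) ⟨s, 1 / 2⟩) := by
      rw [GenericHeight, linAct_S, linAct_S]
      exact hs
    have e (w : ℂ) := linAct_intToReal_self_inv ModularGroup.S w
    have key := eq_along_line (S := S) (v := linAct (intToReal ModularGroup.S) x)
      (z := linAct (intToReal ModularGroup.S) ⟨s, 1 / 2⟩)
      (σ := fun w => G (linAct (intToReal ModularGroup.S⁻¹) w))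
      (fun t => hS _ (hgen.add_real t)) (fun t j => by
        have hn := (hgen.add_real t).not_isEnd
        set w := linAct (intToReal ModularGroup.S) ⟨s, 1 / 2⟩ + t
        rw [← e w, isEnd_linAct_iff rfl] at hn
        filter_upwards [(tendsto_linAct_zero (intToReal ModularGroup.S⁻¹)).eventually
          (hG _ hn j)] with h hh
        rw [← shift_linAct ModularGroup.S x, e, e] at hh
        rw [linAct_add, hh]) 1 (j + S (linAct (intToReal ModularGroup.S) ⟨s, 1 / 2⟩))
    rw [Complex.ofReal_one, hS1 _ hgen, linAct_add, linAct_intToReal_inv_self,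
      add_sub_cancel_right] at key
    have hone : linAct (intToReal ModularGroup.S⁻¹) 1 = -Complex.I := by
      have : linAct (intToReal ModularGroup.S) (-Complex.I) = 1 := by
        rw [linAct_S]; apply Complex.ext <;> simp
      rw [← this, linAct_intToReal_inv_self]
    rw [hone, linAct_S, linAct_S] at key
    simp only [Complex.ofReal_re] at key
    rw [← key]
    have hper : toTorus ((⟨s, 1 / 2⟩ : ℂ) + -Complex.I) = toTorus ⟨s, 1 / 2⟩ :=
      toTorus_eq_iff_int.2 ⟨0, -1, by simp, by simp⟩
    simp only [hGdef]
    rw [hper, linAct_add, linAct_neg, ← sub_eq_add_neg, toTorus_sub]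
    have hj (a b : ℤ) : j + (a : ZMod d) - ((a - b : ℤ) : ZMod d) = j + (b : ℤ) := by
      push_cast; ring
    rw [hj]
    abel
  have hhor (j : ZMod d) : G ⟨t, 1 / 2⟩ j = G ⟨s, 1 / 2⟩ j := by
    have key := eq_along_line (S := fun _ => 0) (v := x) (z := ⟨s, 1 / 2⟩) (σ := G)
      (fun t => Eventually.of_forall fun h => by
        rw [shift_eq_zero_of_im (by simp) ((hg s).add_real t).1]; simp)
      (fun t j => hG _ ((hg s).add_real t).not_isEnd j) (t - s) j
    have e : (⟨s, 1 / 2⟩ : ℂ) + ((t - s : ℝ) : ℂ) = ⟨t, 1 / 2⟩ := by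
      apply Complex.ext <;> simp
    rw [e] at key
    simpa only [Int.cast_zero, sub_zero] using key
  have hone (j : ZMod d) : G ⟨s, 1 / 2⟩ (j + 1) = G ⟨s, 1 / 2⟩ j := by
    obtain ⟨u, rfl⟩ : ∃ u, u + ((⌊x - s⌋ - ⌊-s⌋ : ℤ) : ZMod d) = j := ⟨_, sub_add_cancel j _⟩
    have h1 := hvert t ht u
    rw [hhor, hhor, hst, ← hvert s hs u, Int.cast_add, Int.cast_one, ← add_assoc] at h1
    exact add_right_cancel h1
  have hall : ∀ j, G z (j + 1) = G z j := by
    have := eq_of_eventually_eq_const (isPreconnected_compl_ends x)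
      (p := fun z => ∀ j, G z (j + 1) = G z j) (fun z hz => ?_) hz (hg s).not_isEnd
    · exact this ▸ hone
    · rw [eventually_nhds_iff_add]
      filter_upwards [eventually_all.2 (hG z hz)] with h hh
      refine propext ⟨fun H j => ?_, fun H j => ?_⟩
      · rw [← hh, ← hh j, add_right_comm, H]
      · obtain ⟨i, rfl⟩ : ∃ i, i + ((shift x (toTorus z) h : ℕ) : ZMod d) = j :=
          ⟨_, sub_add_cancel j _⟩
        rw [add_right_comm, hh, hh, H]
  have hz0 (n : ℕ) : G z n = G z 0 := by
    induction n with
    | zero => simp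
    | succ n ih => rw [Nat.cast_add_one, hall, ih]
  have h1 := hz0 j.val
  have h2 := hz0 k.val
  rw [ZMod.natCast_zmod_val] at h1 h2
  exact sub_left_injective (h1.trans h2.symm)

/-! ### The Veech groups -/

/-- An affine homeomorphism of the connected sum along `[0, x]` which covers a map of the torus has
an integral linear part `B`, and the slits `[0, B x]` and `[0, x]` define connected sums that are
isomorphic over the torus. -/
lemma exists_of_isAffine [NeZero d] {x : ℝ} (hx : 0 < x) {A : SL(2, ℝ)}
    {f : Space d x → Space d x}
    (hf : IsAffine (Y := connectedSum d x) (Z := connectedSum d x) A f)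
    (h : (∀ k : ℤ, x ≠ k) ∨
      ∀ y, f (nextSheet d x y) = nextSheet d x (f y)) :
    ∃ B : SL(2, ℤ), intToReal B = A ∧ ∃ p q : ℤ, B 0 0 * x = x + d * p ∧ B 1 0 * x = d * q := by
  have hproj := IsAffine.proj_eq hf fun z hz j k =>
    h.elim (fun h => IsAffine.proj_indep_of_not_int h hf z hz j k)
      fun h => IsAffine.proj_indep_of_equivariant h _ j k
  obtain ⟨B, rfl⟩ := exists_intToReal_of_map_lattice (A := A) fun w hw => by
    rw [← toTorus_eq_zero_iff, ← hproj w 0, toTorus_eq_zero_iff.2 hw, ← toTorus_zero, hproj,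
      linAct_zero]
  refine ⟨B, rfl, ?_⟩
  have hend : toTorus (linAct (intToReal B) x) = toTorus x := by
    rw [← hproj x 0]
    have : f (pt d x (toTorus x) 0) = pt d x (toTorus x) 0 := hf.2.2.1
    rw [this, toBase_pt]
  obtain ⟨g, hg, hg'⟩ := (Gluing.linear d B x).symm.exists_isHomeomorph
  have := exists_of_covers_id hx hend (f := f ∘ g) (hf.1.continuous.comp hg.continuous)
    (hf.1.injective.comp hg.injective)
    (fun z j => by rw [Function.comp_apply, hg', hproj, linAct_intToReal_self_inv])
    (h.imp_right fun h y => by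
      obtain ⟨z, j, rfl⟩ := exists_pt y
      rw [Function.comp_apply, Function.comp_apply, nextSheet_pt, hg', hg', ← h, nextSheet_pt,
        add_right_comm])
  obtain ⟨p, q, hp, hq⟩ := this
  rw [linAct_intToReal] at hp hq
  simp only [Complex.ofReal_re, Complex.ofReal_im, mul_zero, add_zero] at hp hq
  exact ⟨p, q, hp, hq⟩

lemma mem_realGamma1 {n : ℕ} {A : SL(2, ℝ)} :
    A ∈ realGamma1 n ↔ ∃ B ∈ CongruenceSubgroup.Gamma1 n, intToReal B = A := Iff.rfl

/-- `Γ₁(n)` consists of the matrices that fix `1 / n` modulo the periods. -/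
lemma mem_Gamma1_iff [NeZero d] {n : ℕ} (hn : n ≠ 0) {B : SL(2, ℤ)} :
    B ∈ CongruenceSubgroup.Gamma1 n ↔ ∃ p q : ℤ, B 0 0 * ((d : ℝ) / n) = (d : ℝ) / n + d * p ∧
      B 1 0 * ((d : ℝ) / n) = d * q := by
  have hd : (d : ℝ) ≠ 0 := Nat.cast_ne_zero.2 (NeZero.ne d)
  have hn' : (n : ℝ) ≠ 0 := Nat.cast_ne_zero.2 hn
  have e1 (a p : ℤ) : a * ((d : ℝ) / n) = (d : ℝ) / n + d * p ↔ a = 1 + n * p := by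
    rw [← Int.cast_inj (α := ℝ)]
    push_cast
    constructor <;> intro h
    · field_simp at h; linear_combination h
    · field_simp; linear_combination h
  have e2 (c q : ℤ) : c * ((d : ℝ) / n) = d * q ↔ c = n * q := by
    rw [← Int.cast_inj (α := ℝ)]
    push_cast
    constructor <;> intro h
    · field_simp at h; linear_combination h
    · field_simp; linear_combination h
  simp only [e1, e2, exists_and_left, exists_and_right]
  rw [CongruenceSubgroup.Gamma1_mem]
  have hdet := B.det_coe
  rw [Matrix.det_fin_two] at hdet
  constructor
  · rintro ⟨ha, -, hc⟩
    rw [ZMod.intCast_zmod_eq_zero_iff_dvd] at hc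
    have ha' : ((B 0 0 - 1 : ℤ) : ZMod n) = 0 := by push_cast; rw [ha, sub_self]
    rw [ZMod.intCast_zmod_eq_zero_iff_dvd] at ha'
    obtain ⟨p, hp⟩ := ha'
    exact ⟨⟨p, by linarith⟩, hc⟩
  · rintro ⟨⟨p, hp⟩, ⟨q, hq⟩⟩
    have ha : ((B 0 0 : ℤ) : ZMod n) = 1 := by rw [hp]; simp
    have hc : ((B 1 0 : ℤ) : ZMod n) = 0 := by rw [hq]; simp
    refine ⟨ha, ?_, hc⟩
    have := congrArg (Int.cast : ℤ → ZMod n) hdet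
    push_cast at this
    rwa [ha, hc, one_mul, mul_zero, sub_zero] at this

lemma re_translate_ne_zero [NeZero d] {n : ℕ} (hn : 2 ≤ n) (k : ℤ) :
    (d : ℝ) / n + d * k ≠ 0 := by
  have hd : (d : ℝ) ≠ 0 := Nat.cast_ne_zero.2 (NeZero.ne d)
  have hn' : (n : ℝ) ≠ 0 := Nat.cast_ne_zero.2 (by lia)
  intro h
  have h1 : (1 : ℝ) + n * k = 0 := by
    have h3 : (d : ℝ) / n * (1 + n * k) = 0 := by
      rw [← h]
      field_simp
    exact (mul_eq_zero.1 h3).resolve_left (div_ne_zero hd hn')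
  have h2 : (1 : ℤ) + n * k = 0 := by exact_mod_cast h1
  have h3 : (n : ℤ) ∣ 1 := ⟨-k, by linear_combination h2⟩
  have h4 := Int.le_of_dvd one_pos h3
  lia

lemma realGamma1_subset [NeZero d] {n : ℕ} (hn : 2 ≤ n) {v : ℂ} (hv : v = ((d : ℝ) / n : ℝ)) :
    realGamma1 n ⊆ (connectedSum d v).symmetricVeechGroup := by
  rintro A hA
  obtain ⟨B, hB, rfl⟩ := mem_realGamma1.1 hA
  obtain ⟨p, q, hp, hq⟩ := (mem_Gamma1_iff (d := d) (by lia)).1 hB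
  obtain ⟨c, hc⟩ := exists_gluing_of_translate (d := d) (v := v)
    (v' := linAct (intToReal B) v) (k := p) (l := q)
    (fun k => by rw [hv]; simpa using re_translate_ne_zero hn k)
    (by rw [linAct_intToReal, hv]; simpa using hp) (by rw [linAct_intToReal, hv]; simpa using hq)
  have := (Gluing.linear d B v).trans hc.symm
  rw [inv_one, one_mul] at this
  exact this.exists_isAffine

lemma symmetricVeechGroup_subset (Y : EllipticDifferential) :
    Y.symmetricVeechGroup ⊆ Y.veechGroup := fun _ ⟨f, hf, _⟩ => ⟨f, hf⟩

lemma symmetricVeechGroup_eq [NeZero d] {n : ℕ} (hn : 2 ≤ n) {v : ℂ}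
    (hv : v = ((d : ℝ) / n : ℝ)) : (connectedSum d v).symmetricVeechGroup = realGamma1 n := by
  refine Set.Subset.antisymm ?_ (realGamma1_subset hn hv)
  rintro A ⟨f, hf, hrot⟩
  subst hv
  have hd : 0 < d := Nat.pos_of_ne_zero (NeZero.ne d)
  obtain ⟨B, rfl, h⟩ := exists_of_isAffine (by positivity) hf (Or.inr hrot)
  exact mem_realGamma1.2 ⟨B, (mem_Gamma1_iff (by lia)).2 h, rfl⟩

lemma div_ne_int_of_not_dvd {n : ℕ} (hn : n ≠ 0) (hnd : ¬ n ∣ d) (k : ℤ) : (d : ℝ) / n ≠ k := by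
  intro h
  have hn' : (n : ℝ) ≠ 0 := Nat.cast_ne_zero.2 hn
  rw [div_eq_iff hn'] at h
  have h1 : (d : ℤ) = k * n := by exact_mod_cast h
  exact hnd (Int.natCast_dvd_natCast.1 ⟨k, by rw [h1, mul_comm]⟩)

lemma veechGroup_eq [NeZero d] {n : ℕ} (hn : 2 ≤ n) (hnd : ¬ n ∣ d) {v : ℂ}
    (hv : v = ((d : ℝ) / n : ℝ)) : (connectedSum d v).veechGroup = realGamma1 n := by
  refine Set.Subset.antisymm ?_
    ((realGamma1_subset hn hv).trans (symmetricVeechGroup_subset _))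
  rintro A ⟨f, hf⟩
  subst hv
  have hd : 0 < d := Nat.pos_of_ne_zero (NeZero.ne d)
  obtain ⟨B, rfl, h⟩ := exists_of_isAffine (by positivity) hf
    (Or.inl (div_ne_int_of_not_dvd (by lia) hnd))
  exact mem_realGamma1.2 ⟨B, (mem_Gamma1_iff (by lia)).2 h, rfl⟩

lemma isomorphic_iff [NeZero d] {n : ℕ} (hn : 2 ≤ n) {u : ℂ} (hu : u = ((d : ℝ) / n : ℝ))
    (v : ℂ) : (connectedSum d v).Isomorphic (connectedSum d u) ↔
      ∃ w ∈ gaussianLattice, v - u = d * w := by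
  subst hu
  constructor
  · rintro ⟨f, hf, hrot⟩
    have hd : 0 < d := Nat.pos_of_ne_zero (NeZero.ne d)
    have hproj := IsAffine.proj_eq hf fun z hz j k =>
      IsAffine.proj_indep_of_equivariant hrot _ j k
    simp only [linAct_one] at hproj
    have hend : toTorus v = toTorus ((d : ℝ) / n : ℝ) := by
      rw [← hproj v 0]
      have : f (pt d v (toTorus v) 0) = pt d _ (toTorus ((d : ℝ) / n : ℝ)) 0 := hf.2.2.1
      rw [this, toBase_pt]
    obtain ⟨p, q, hp, hq⟩ := exists_of_covers_id (by positivity) hend hf.1.continuous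
      hf.1.injective hproj (Or.inr hrot)
    refine ⟨⟨p, q⟩, mem_gaussianLattice.2 ⟨p, q, rfl, rfl⟩, ?_⟩
    apply Complex.ext
    · rw [Complex.sub_re, hp]; simp
    · rw [Complex.sub_im, hq]; simp
  · rintro ⟨w, hw, e⟩
    obtain ⟨a, b, ha, hb⟩ := mem_gaussianLattice.1 hw
    have e' : v = ((d : ℝ) / n : ℝ) + d * w := by rw [← e]; ring
    obtain ⟨c, hc⟩ := exists_gluing_of_translate (d := d) (v := ((d : ℝ) / n : ℝ))
      (v' := v) (k := a) (l := b)
      (fun k => by rw [Complex.ofReal_re]; exact re_translate_ne_zero hn k)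
      (by rw [e']; simp [ha]) (by rw [e']; simp [hb])
    have := hc.symm
    rw [inv_one] at this
    obtain ⟨f, hf, hrot⟩ := this.exists_isAffine
    refine ⟨f, ?_, hrot⟩
    rwa [intToReal, map_one] at hf

end ConnectedSum

/-! ### Charts from compactness, and punctured discs -/

/-- A continuous injection of a compact set restricts to a chart on an open subset whose image is
open. -/
lemma exists_openPartialHomeomorph {X Y : Type*} [TopologicalSpace X] [TopologicalSpace Y]
    [T2Space Y] [Nonempty X] {e : X → Y} {K U : Set X} (hK : IsCompact K) (hU : IsOpen U)
    (hUK : U ⊆ K) (hc : ContinuousOn e K) (hi : Set.InjOn e K) (ho : IsOpen (e '' U)) :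
    ∃ φ : OpenPartialHomeomorph X Y, φ.source = U ∧ ∀ x, φ x = e x := by
  refine ⟨OpenPartialHomeomorph.ofContinuousOpenRestrict ((hi.mono hUK).toPartialEquiv e U)
    (hc.mono hUK) ?_ hU, rfl, fun _ => rfl⟩
  intro V hV
  obtain ⟨W, hW, rfl⟩ := isOpen_induced_iff.1 hV
  have hcl : IsClosed (e '' (K \ (W ∩ U))) :=
    ((hK.diff (hW.inter hU)).image_of_continuousOn (hc.mono Set.sdiff_subset)).isClosed
  convert ho.sdiff hcl using 1
  ext y
  constructor
  · rintro ⟨⟨x, hx⟩, hxW, rfl⟩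
    refine ⟨⟨x, hx, rfl⟩, ?_⟩
    rintro ⟨x', hx', e'⟩
    have := hi hx'.1 (hUK hx) e'
    subst this
    exact hx'.2 ⟨hxW, hx⟩
  · rintro ⟨⟨x, hx, rfl⟩, hn⟩
    refine ⟨⟨x, hx⟩, ?_, rfl⟩
    by_contra hxW
    exact hn ⟨x, ⟨hUK hx, fun H => hxW H.1⟩, rfl⟩

/-- A punctured disc is the image of a half plane under the exponential function. -/
lemma isPreconnected_punctured_disc {r : ℝ} (hr : 0 < r) :
    IsPreconnected {w : ℂ | w ≠ 0 ∧ ‖w‖ < r} := by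
  have h : {w : ℂ | w ≠ 0 ∧ ‖w‖ < r} = Complex.exp '' {z : ℂ | z.re < Real.log r} := by
    ext w
    simp only [Set.mem_ofPred_eq, Set.mem_image]
    constructor
    · rintro ⟨h0, h1⟩
      refine ⟨Complex.log w, ?_, Complex.exp_log h0⟩
      rw [Complex.log_re]
      exact Real.log_lt_log (norm_pos_iff.2 h0) h1
    · rintro ⟨z, hz, rfl⟩
      refine ⟨Complex.exp_ne_zero z, ?_⟩
      rw [Complex.norm_exp, ← Real.exp_log hr]
      exact Real.exp_lt_exp.2 hz
  rw [h]
  exact (convex_halfSpace_re_lt _).isPreconnected.image _ Complex.continuous_exp.continuousOn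

namespace EllipticDifferential

/-- Near a point with a chart the surface is not a union of several discs: removing the point does
not disconnect a connected neighbourhood. -/
lemma HasOrderAt.not_isUnionOfDiscsAt {Y : EllipticDifferential} [T1Space Y.carrier]
    {s : Y.carrier} {k m : ℕ} (h : Y.HasOrderAt s k) (hm : 2 ≤ m) :
    ¬ Y.IsUnionOfDiscsAt s m := by
  rintro ⟨U, hU, hUc, hsU, ⟨φ⟩⟩
  obtain ⟨e, hs, hs0, -⟩ := h
  have hopen : IsOpen (U \ {s}) := hU.sdiff isClosed_singleton
  -- A punctured coordinate disc inside `U` lies in a single component.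
  have ht : s ∈ e.source ∩ U := ⟨hs, hsU⟩
  have htgt : IsOpen (e.target ∩ e.symm ⁻¹' U) := e.symm.isOpen_inter_preimage hU
  have h0 : (0 : ℂ) ∈ e.target ∩ e.symm ⁻¹' U := by
    rw [← hs0]
    exact ⟨e.map_source hs, by rw [Set.mem_preimage, e.left_inv hs]; exact hsU⟩
  obtain ⟨r, hr, hball⟩ := Metric.isOpen_iff.1 htgt 0 h0
  set P : Set ℂ := {w : ℂ | w ≠ 0 ∧ ‖w‖ < r}
  have hP : P ⊆ e.target ∩ e.symm ⁻¹' U := fun w hw => hball (by simpa using hw.2)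
  have hPs (w : ℂ) (hw : w ∈ P) : e.symm w ∈ U \ {s} := by
    refine ⟨(hP hw).2, fun H => hw.1 ?_⟩
    rw [← e.right_inv (hP hw).1, Set.mem_singleton_iff.1 H, hs0]
  have hcomp (x : Y.carrier) (hx : x ∈ U \ {s}) : ∀ᶠ y in 𝓝 x, ∃ hy : y ∈ U \ {s},
      (φ ⟨y, hy⟩).1 = (φ ⟨x, hx⟩).1 := by
    have hc : Continuous (fun y : (U \ {s} : Set Y.carrier) => (φ y).1) := by fun_prop
    have h1 : ∀ᶠ y in 𝓝 (⟨x, hx⟩ : (U \ {s} : Set Y.carrier)), (φ y).1 = (φ ⟨x, hx⟩).1 :=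
      hc.continuousAt.eventually ((isOpen_discrete {(φ ⟨x, hx⟩).1}).mem_nhds rfl)
    rw [nhds_subtype_eq_comap, eventually_comap] at h1
    filter_upwards [h1, hopen.mem_nhds hx] with y hy hyU
    exact ⟨hyU, hy ⟨y, hyU⟩ rfl⟩
  obtain ⟨w₀, hw₀⟩ : P.Nonempty :=
    ⟨(r / 2 : ℝ), by simpa using hr.ne', by
      rw [Complex.norm_real, Real.norm_of_nonneg (by positivity)]; linarith⟩
  classical
  set p : Y.carrier → Fin m := fun y =>
    if hy : y ∈ U \ {s} then (φ ⟨y, hy⟩).1 else (φ ⟨e.symm w₀, hPs w₀ hw₀⟩).1 with hp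
  have hpU {x : Y.carrier} (hx : x ∈ U \ {s}) : ∀ᶠ y in 𝓝 x, p y = p x := by
    filter_upwards [hcomp x hx] with y ⟨hy, hy'⟩
    simp only [hp]
    rw [dif_pos hx, dif_pos hy, hy']
  have hps : p s = p (e.symm w₀) := by
    simp only [hp]
    rw [dif_neg (fun H => H.2 rfl), dif_pos (hPs w₀ hw₀)]
  have hpP (w : ℂ) (hw : w ∈ P) : p (e.symm w) = p s := by
    rw [hps]
    refine eq_of_eventually_eq_const (isPreconnected_punctured_disc hr)
      (p := fun w => p (e.symm w)) (fun u hu => ?_) hw hw₀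
    exact (e.continuousAt_symm (hP hu).1).eventually (hpU (hPs u hu))
  have hpconst : ∀ x ∈ U, ∀ᶠ y in 𝓝 x, p y = p x := by
    intro x hx
    by_cases hxs : x = s
    · subst hxs
      have hb : ∀ᶠ y in 𝓝 x, ‖e y‖ < r := by
        have := (e.continuousAt hs).norm
        exact this.eventually (gt_mem_nhds (by simpa [hs0] using hr))
      filter_upwards [hb, e.open_source.mem_nhds hs] with y h1 h2
      by_cases hy : e y = 0
      · rw [e.injOn h2 hs (hy.trans hs0.symm)]
      · rw [← hpP (e y) ⟨hy, h1⟩, e.left_inv h2]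
    · exact hpU ⟨hx, hxs⟩
  -- Two points in different components contradict the connectedness of `U`.
  have hval (i : Fin m) : ∃ x ∈ U, p x = i := by
    set y := φ.symm (i, ⟨(1 / 2 : ℝ), by
      rw [Complex.norm_real]; norm_num, by rw [Complex.norm_real]; norm_num⟩) with hy
    refine ⟨y, y.2.1, ?_⟩
    simp only [hp]
    rw [dif_pos y.2]
    simp [hy]
  obtain ⟨x, hx, hx'⟩ := hval ⟨0, by lia⟩
  obtain ⟨y, hy, hy'⟩ := hval ⟨1, by lia⟩
  have := eq_of_eventually_eq_const hUc.isPreconnected hpconst hx hy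
  rw [hx', hy'] at this
  simp at this

end EllipticDifferential

namespace ConnectedSum

open EllipticDifferential

variable {d : ℕ} {x : ℝ}

/-! ### Connectedness, periods and the cyclic symmetry -/

/-- The number of the sheet of a point of a connected sum (arbitrary over an end of the slit). -/
def sheet {v : ℂ} (y : Space d v) : ZMod d := (Quotient.out y).2

lemma sheet_pt {v : ℂ} {z : SquareTorus} (hz : ¬ IsEnd v z) (j : ZMod d) :
    sheet (pt d v z j) = j := by
  have h : pt d v (Quotient.out (pt d v z j)).1 (Quotient.out (pt d v z j)).2 = pt d v z j :=
    Quotient.out_eq (pt d v z j)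
  obtain ⟨h1, h2⟩ := pt_eq_pt_iff.1 h
  rw [h1] at h2
  exact h2.resolve_left hz

/-- A path in a single sheet which is horizontal whenever it meets the slit. -/
lemma continuousAt_const_sheet [NeZero d] (hx : 0 < x) {X : Type*} [TopologicalSpace X]
    {γ : X → ℂ} {t : X} (hγ : ContinuousAt γ t) (j : ZMod d)
    (h : (∀ k : ℤ, (γ t).im ≠ k) ∨ IsEnd x (toTorus (γ t)) ∨ ∀ᶠ s in 𝓝 t, (γ s).im = (γ t).im) :
    ContinuousAt (fun s => pt d x (toTorus (γ s)) j) t := by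
  refine continuousAt_pt (j := fun _ => j) hγ fun he => ?_
  rcases h with h | h | h
  · refine Eventually.of_forall fun s => ?_
    rw [shift_eq_zero_of_im (by simp) h, Nat.cast_zero, add_zero]
  · exact absurd h he
  · filter_upwards [h] with s hs
    rw [shift_real hx, if_neg (by simp [hs]), Nat.cast_zero, add_zero]

/-- The segment from the singular point over `0` to a point at distance less than `1` from the
real axis. -/
lemma exists_isPreconnected_segment [NeZero d] (hx : 0 < x) {h : ℂ} (hh : |h.im| < 1)
    (j : ZMod d) : IsPreconnected
      ((fun t : ℝ => pt d x (toTorus (t * h)) j) '' Set.Icc 0 1) := by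
  refine isPreconnected_Icc.image _ fun t ht => ContinuousAt.continuousWithinAt ?_
  refine continuousAt_const_sheet hx (by fun_prop) j ?_
  rcases eq_or_ne h.im 0 with h0 | h0
  · exact Or.inr (Or.inr (Eventually.of_forall fun s => by simp [h0]))
  rcases eq_or_ne t 0 with rfl | ht0
  · exact Or.inr (Or.inl (Or.inl (by simp)))
  · refine Or.inl fun k hk => ?_
    rw [Complex.im_ofReal_mul] at hk
    have h1 : |(k : ℝ)| < 1 := by
      rw [← hk, abs_mul, abs_of_nonneg ht.1]
      nlinarith [ht.2, abs_nonneg h.im]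
    have : k = 0 := Int.abs_lt_one_iff.1 (by exact_mod_cast h1)
    rw [this, Int.cast_zero] at hk
    exact (mul_ne_zero ht0 h0) hk

lemma connectedSpace [NeZero d] (hx : 0 < x) : ConnectedSpace (Space d x) := by
  have hp : IsPreconnected (Set.univ : Set (Space d x)) := by
    refine isPreconnected_of_forall (pt d x (toTorus 0) 0) fun y _ => ?_
    obtain ⟨z, j, rfl⟩ := exists_pt y
    have him : |(centeredLift (toTorus z)).im| < 1 :=
      (abs_sub_round _).trans_lt (by norm_num)
    refine ⟨(fun t : ℝ => pt d x (toTorus (t * centeredLift (toTorus z))) j) '' Set.Icc 0 1,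
      Set.subset_univ _, ⟨0, by simp, ?_⟩, ⟨1, by simp, ?_⟩,
      exists_isPreconnected_segment hx him j⟩
    · simp only [Complex.ofReal_zero, zero_mul]
      exact pt_eq_of_isEnd (Or.inl rfl) _ _
    · simp only [Complex.ofReal_one, one_mul, toTorus_centeredLift]
  exact { toPreconnectedSpace := ⟨hp⟩, toNonempty := ⟨pt d x (toTorus 0) 0⟩ }

/-- Every period of the torus is the period of a closed path, which follows the real axis and then
a vertical line through the lattice, in a single sheet. -/
lemma periods_eq [NeZero d] (hx : 0 < x) : (connectedSum d x).periods = gaussianLattice := by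
  ext w
  constructor
  · rintro ⟨γ, γ', h, h', rfl⟩
    rw [SetLike.mem_coe, ← toTorus_eq_iff, ← h' 1, ← h' 0, h]
  · intro hw
    obtain ⟨p, q, hp, hq⟩ := mem_gaussianLattice.1 hw
    let γ' : unitInterval → ℂ := fun t =>
      ((min (2 * (t : ℝ)) 1 * p : ℝ) : ℂ) + ((max (2 * (t : ℝ) - 1) 0 * q : ℝ) : ℂ) * Complex.I
    have hre (t) : (γ' t).re = min (2 * (t : ℝ)) 1 * p := by simp [γ']
    have him (t) : (γ' t).im = max (2 * (t : ℝ) - 1) 0 * q := by simp [γ']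
    have hγ' : Continuous γ' := by
      simp only [γ']
      fun_prop
    have hγ : Continuous (fun t => pt d x (toTorus (γ' t)) 0) := by
      rw [continuous_iff_continuousAt]
      intro t
      refine continuousAt_const_sheet hx hγ'.continuousAt 0 ?_
      rcases lt_or_ge (t : ℝ) (1 / 2) with ht | ht
      · refine Or.inr (Or.inr ?_)
        have : ∀ᶠ s : unitInterval in 𝓝 t, (s : ℝ) < 1 / 2 :=
          continuous_subtype_val.continuousAt.eventually (gt_mem_nhds ht)
        filter_upwards [this] with s hs
        rw [him, him, max_eq_right (by linarith), max_eq_right (by linarith)]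
      · by_cases hi : ∀ k : ℤ, (γ' t).im ≠ k
        · exact Or.inl hi
        · push Not at hi
          obtain ⟨k, hk⟩ := hi
          refine Or.inr (Or.inl (Or.inl (toTorus_eq_iff_int.2 ⟨p, k, ?_, ?_⟩)))
          · rw [hre, min_eq_right (by linarith)]; simp
          · rw [hk]; simp
    refine ⟨⟨_, hγ⟩, ⟨γ', hγ'⟩, ?_, fun t => rfl, ?_⟩
    · refine pt_eq_pt_iff.2 ⟨toTorus_eq_iff_int.2 ⟨-p, -q, ?_, ?_⟩, Or.inr rfl⟩
      · rw [hre, hre]; norm_num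
      · rw [him, him]; norm_num
    · apply Complex.ext
      · change (γ' 1 - γ' 0).re = _
        rw [Complex.sub_re, hre, hre, hp]; norm_num
      · change (γ' 1 - γ' 0).im = _
        rw [Complex.sub_im, him, him, hq]; norm_num

lemma iterate_nextSheet {v : ℂ} (k : ℕ) (z : SquareTorus) (j : ZMod d) :
    (nextSheet d v)^[k] (pt d v z j) = pt d v z (j + k) := by
  induction k with
  | zero => simp
  | succ k ih => rw [Function.iterate_succ_apply', ih, nextSheet_pt]; push_cast; rw [add_assoc]

lemma hasCyclicSymmetry [NeZero d] (v : ℂ) : (connectedSum d v).HasCyclicSymmetry d := by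
  constructor
  · have h : Gluing d 1 v v (fun _ => 1) :=
      { map_end := by rw [intToReal, map_one, linAct_one]
        periodic := fun _ _ _ => rfl
        jump := fun z _ => Eventually.of_forall fun h => by
          rw [intToReal, map_one, linAct_one, linAct_one] }
    obtain ⟨f, hf, hf'⟩ := h.exists_isHomeomorph
    have e : f = nextSheet d v := by
      funext y
      obtain ⟨z, j, rfl⟩ := exists_pt y
      rw [hf', intToReal, map_one, linAct_one, nextSheet_pt]
    have := isAffine_of_covers h.map_end hf fun z j => by rw [hf', toBase_pt]
    rw [intToReal, map_one, e] at this
    exact this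
  · intro k
    rw [← CharP.cast_eq_zero_iff (ZMod d) d]
    change (nextSheet d v)^[k] = id ↔ _
    constructor
    · intro h
      obtain ⟨z, hz⟩ := (dense_compl_ends v).nonempty
      have h1 := congrFun h (pt d v (toTorus z) 0)
      rw [iterate_nextSheet, zero_add, id] at h1
      exact (pt_eq_pt_iff.1 h1).2.resolve_left hz
    · intro h
      funext y
      obtain ⟨z, j, rfl⟩ := exists_pt y
      rw [iterate_nextSheet, h, add_zero, id]

lemma hasDegree [NeZero d] (v : ℂ) : (connectedSum d v).HasDegree d := by
  intro z h0 h1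
  exact ncard_preimage_toBase fun h => h.elim h0 h1

lemma exists_iterate_eq [NeZero d] {v : ℂ} (y y' : Space d v) (h : toBase d v y = toBase d v y') :
    ∃ k : ℕ, (nextSheet d v)^[k] y = y' := by
  obtain ⟨z, i, rfl⟩ := exists_pt y
  obtain ⟨z', j, rfl⟩ := exists_pt y'
  rw [toBase_pt, toBase_pt] at h
  refine ⟨(j - i).val, ?_⟩
  rw [iterate_nextSheet, ZMod.natCast_zmod_val, add_sub_cancel, h]

/-! ### Regular points -/

lemma hasOrderAt_zero [NeZero d] (hx : 0 < x) {z : ℂ} (hz : ¬ IsEnd x (toTorus z)) (j : ZMod d) :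
    (connectedSum d x).HasOrderAt (pt d x (toTorus z) j) 0 := by
  obtain ⟨ε, hε, hε', hend, hadd, ho⟩ := exists_isOpen_disc (d := d) hx hz
  have hl {h : ℂ} (hh : ‖h‖ < ε) : centeredLift (toTorus (z + h) - toTorus z) = h := by
    rw [← toTorus_sub, add_sub_cancel_left, centeredLift_toTorus (hh.trans hε')]
  let e : OpenPartialHomeomorph (Space d x) ℂ :=
    { toFun := fun y => centeredLift (toBase d (x : ℂ) y - toTorus z)
      invFun := fun h => pt d x (toTorus (z + h)) (j + (shift x (toTorus z) h : ℕ))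
      source := disc d x z j ε
      target := Metric.ball 0 ε
      map_source' := by
        rintro _ ⟨h, hh, rfl⟩
        simp only [toBase_pt]
        rwa [hl (by simpa using hh)]
      map_target' := fun h hh => ⟨h, hh, rfl⟩
      left_inv' := by
        rintro _ ⟨h, hh, rfl⟩
        simp only [toBase_pt]
        rw [hl (by simpa using hh)]
      right_inv' := fun h hh => by
        rw [toBase_pt, hl (by simpa using hh)]
      open_source := ho j ε le_rfl
      open_target := Metric.isOpen_ball
      continuousOn_toFun := by
        rintro _ ⟨h, hh, rfl⟩
        have hh : ‖h‖ < ε := by simpa using hh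
        refine ContinuousAt.continuousWithinAt ?_
        have h1 : ContinuousAt (fun y => toBase d (x : ℂ) y - toTorus z)
            (pt d x (toTorus (z + h)) (j + (shift x (toTorus z) h : ℕ))) :=
          (continuous_toBase.sub continuous_const).continuousAt
        refine ContinuousAt.comp (g := centeredLift) ?_ h1
        simp only [toBase_pt]
        rw [← toTorus_sub, add_sub_cancel_left]
        exact continuousAt_centeredLift (hh.trans hε')
      continuousOn_invFun := by
        intro h hh
        have hh : ‖h‖ < ε := by simpa using hh
        refine ContinuousAt.continuousWithinAt (continuousAt_pt (by fun_prop) fun _ => ?_)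
        rw [eventually_nhds_iff_add]
        filter_upwards [hadd h hh] with k hk
        rw [hk, show z + (h + k) - (z + h) = k by ring]
        push_cast
        ring }
  refine ⟨e, mem_disc_self z j hε, ?_, ?_⟩
  · change centeredLift (toTorus z - toTorus z) = 0
    simpa using hl (h := 0) (by simpa using hε)
  · rintro y -
    change toBase d (x : ℂ) y =
      toTorus z + toTorus ((centeredLift (toBase d (x : ℂ) y - toTorus z)) ^ 1)
    rw [pow_one, toTorus_centeredLift, add_sub_cancel]

end ConnectedSum

/-! ### Branches of the `d`-th root -/

lemma cpow_inv_of_im_nonneg {d : ℕ} {u : ℂ} (hr : u.re < 0) (hi : 0 ≤ u.im) :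
    u ^ (d : ℂ)⁻¹ = Complex.exp (Real.pi * Complex.I / d) * (-u) ^ (d : ℂ)⁻¹ := by
  have hu : u ≠ 0 := fun h => by simp [h] at hr
  have harg : (-u).arg = u.arg - Real.pi := Complex.arg_neg_eq_arg_sub_pi_iff.2
    (hi.lt_or_eq.imp id fun h => ⟨h.symm, hr⟩)
  rw [Complex.cpow_def_of_ne_zero hu, Complex.cpow_def_of_ne_zero (neg_ne_zero.2 hu),
    ← Complex.exp_add, Complex.log, Complex.log, harg, norm_neg]
  congr 1
  push_cast
  ring

lemma cpow_inv_of_im_neg {d : ℕ} {u : ℂ} (hi : u.im < 0) :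
    u ^ (d : ℂ)⁻¹ * Complex.exp (2 * Real.pi * Complex.I / d) =
      Complex.exp (Real.pi * Complex.I / d) * (-u) ^ (d : ℂ)⁻¹ := by
  have hu : u ≠ 0 := fun h => by simp [h] at hi
  rw [Complex.cpow_def_of_ne_zero hu, Complex.cpow_def_of_ne_zero (neg_ne_zero.2 hu),
    ← Complex.exp_add, ← Complex.exp_add, Complex.log, Complex.log,
    Complex.arg_neg_eq_arg_add_pi_of_im_neg hi, norm_neg]
  congr 1
  push_cast
  ring

/-- The principal `d`-th root continues across the negative real axis as another branch. -/
lemma tendsto_cpow_inv_of_neg {d : ℕ} {u : ℂ} (hr : u.re < 0) (hi : u.im = 0) :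
    Tendsto (fun w : ℂ => w ^ (d : ℂ)⁻¹ *
      if 0 ≤ w.im then 1 else Complex.exp (2 * Real.pi * Complex.I / d)) (𝓝 u)
      (𝓝 (u ^ (d : ℂ)⁻¹)) := by
  have hc : ContinuousAt (fun w : ℂ => Complex.exp (Real.pi * Complex.I / d) *
      (-w) ^ (d : ℂ)⁻¹) u := by
    refine continuousAt_const.mul (ContinuousAt.comp (f := fun w : ℂ => -w)
      (continuousAt_cpow_const ?_) continuous_neg.continuousAt)
    exact Or.inl (by simpa using hr)
  rw [ContinuousAt, ← cpow_inv_of_im_nonneg hr hi.ge] at hc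
  refine hc.congr' ?_
  filter_upwards [Complex.continuous_re.continuousAt.eventually (gt_mem_nhds hr)] with w hw
  split_ifs with h
  · rw [mul_one, cpow_inv_of_im_nonneg hw h]
  · rw [cpow_inv_of_im_neg (not_le.1 h)]

namespace ConnectedSum

open EllipticDifferential

variable {d : ℕ} {x : ℝ}

/-! ### Cone points -/

/-- A branch of the `d`-th root, for each sheet in the upper and in the lower half plane. -/
def rootBranch (d : ℕ) [NeZero d] (φ ψ : Equiv.Perm (ZMod d)) (h : ℂ) (j : ZMod d) : ℂ :=
  h ^ (d : ℂ)⁻¹ * ZMod.stdAddChar (if 0 ≤ h.im then φ j else ψ j)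

section rootBranch

variable [NeZero d] {φ ψ : Equiv.Perm (ZMod d)}

lemma stdAddChar_one : (ZMod.stdAddChar (1 : ZMod d) : ℂ) =
    Complex.exp (2 * Real.pi * Complex.I / d) := by
  simpa using ZMod.stdAddChar_coe (N := d) 1

lemma stdAddChar_pow (j : ZMod d) : (ZMod.stdAddChar j : ℂ) ^ d = 1 := by
  rw [← AddChar.map_nsmul_eq_pow, nsmul_eq_mul, CharP.cast_eq_zero, zero_mul,
    AddChar.map_zero_eq_one]

lemma rootBranch_pow (h : ℂ) (j : ZMod d) : rootBranch d φ ψ h j ^ d = h := by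
  rw [rootBranch, mul_pow, stdAddChar_pow, mul_one, Complex.cpow_nat_inv_pow h (NeZero.ne d)]

lemma rootBranch_zero (j : ZMod d) : rootBranch d φ ψ 0 j = 0 :=
  eq_zero_of_pow_eq_zero (rootBranch_pow 0 j)

lemma rootBranch_injective {h : ℂ} (hh : h ≠ 0) : Function.Injective (rootBranch d φ ψ h) := by
  intro j k e
  have h0 : h ^ (d : ℂ)⁻¹ ≠ 0 := by simp [Complex.cpow_eq_zero_iff, hh]
  have := ZMod.injective_stdAddChar (mul_left_cancel₀ h0 e)
  split_ifs at this
  · exact φ.injective this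
  · exact ψ.injective this

lemma exists_rootBranch_eq (w : ℂ) : ∃ j, rootBranch d φ ψ (w ^ d) j = w := by
  rcases eq_or_ne w 0 with rfl | hw
  · rw [zero_pow (NeZero.ne d)]
    exact ⟨0, rootBranch_zero 0⟩
  have h0 : (w ^ d) ^ (d : ℂ)⁻¹ ≠ 0 := by simp [Complex.cpow_eq_zero_iff, hw]
  have hprim := Complex.isPrimitiveRoot_exp d (NeZero.ne d)
  obtain ⟨i, -, hi⟩ := hprim.eq_pow_of_pow_eq_one (ξ := w / (w ^ d) ^ (d : ℂ)⁻¹) (by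
    rw [div_pow, Complex.cpow_nat_inv_pow _ (NeZero.ne d), div_self (pow_ne_zero _ hw)])
  have hi' : (w ^ d) ^ (d : ℂ)⁻¹ * ZMod.stdAddChar (i : ZMod d) = w := by
    rw [← nsmul_one i, AddChar.map_nsmul_eq_pow, stdAddChar_one, hi, mul_div_cancel₀ _ h0]
  by_cases him : 0 ≤ (w ^ d).im
  · exact ⟨φ.symm i, by rw [rootBranch, if_pos him, Equiv.apply_symm_apply, hi']⟩
  · exact ⟨ψ.symm i, by rw [rootBranch, if_neg him, Equiv.apply_symm_apply, hi']⟩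

/-- The branches fit together along the slit, if turning once around its end point leads from one
sheet to the next. -/
lemma tendsto_rootBranch (hx : 0 < x) {h : ℂ} (h0 : h ≠ 0) {z : ℂ}
    (hz : h.im ≠ 0 → ∀ k : ℤ, z.im ≠ k)
    (hr : h.im = 0 → 0 < h.re → ∀ j, ψ (j + (passes x (toTorus z) : ℕ)) = φ j)
    (hl : h.im = 0 → h.re < 0 → ∀ j, ψ (j + (passes x (toTorus z) : ℕ)) = φ j + 1) (j : ZMod d) :
    Tendsto (fun k : ℂ => rootBranch d φ ψ (h + k) (j + (shift x (toTorus z) k : ℕ))) (𝓝 0)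
      (𝓝 (rootBranch d φ ψ h j)) := by
  have hadd : Tendsto (fun k : ℂ => h + k) (𝓝 0) (𝓝 h) := by
    simpa using (continuous_const_add h).tendsto (0 : ℂ)
  have him : Tendsto (fun k : ℂ => (h + k).im) (𝓝 0) (𝓝 h.im) :=
    (Complex.continuous_im.tendsto h).comp hadd
  have hroot (hs : h ∈ Complex.slitPlane) (c : ℂ) : Tendsto (fun k : ℂ => (h + k) ^ (d : ℂ)⁻¹ * c)
      (𝓝 0) (𝓝 (h ^ (d : ℂ)⁻¹ * c)) :=
    ((continuousAt_cpow_const hs).tendsto.comp hadd).mul_const c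
  rcases lt_trichotomy h.im 0 with hi | hi | hi
  · rw [rootBranch, if_neg hi.not_ge]
    refine (hroot (Or.inr hi.ne) _).congr' ?_
    filter_upwards [him.eventually (gt_mem_nhds hi)] with k hk
    rw [rootBranch, if_neg hk.not_ge, shift_eq_zero_of_im (by simp) (hz hi.ne), Nat.cast_zero,
      add_zero]
  · have hk (k : ℂ) : (h + k).im = k.im := by rw [Complex.add_im, hi, zero_add]
    rw [rootBranch, if_pos hi.ge]
    have hre : h.re ≠ 0 := fun e => h0 (Complex.ext e hi)
    rcases hre.lt_or_gt with hn | hp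
    · refine (((tendsto_cpow_inv_of_neg (d := d) hn hi).comp hadd).mul_const _).congr' ?_
      refine Eventually.of_forall fun k => ?_
      beta_reduce
      rw [rootBranch, Function.comp_apply, shift_real hx, hk]
      rcases lt_or_ge k.im 0 with h1 | h1
      · rw [if_neg h1.not_ge, if_neg h1.not_ge, if_pos h1, hl hi hn, AddChar.map_add_eq_mul,
          stdAddChar_one]
        ring
      · simp [h1, h1.not_gt]
    · refine (hroot (Or.inl hp) _).congr' (Eventually.of_forall fun k => ?_)
      beta_reduce
      rw [rootBranch, shift_real hx, hk]
      rcases lt_or_ge k.im 0 with h1 | h1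
      · rw [if_neg h1.not_ge, if_pos h1, hr hi hp]
      · simp [h1, h1.not_gt]
  · rw [rootBranch, if_pos hi.le]
    refine (hroot (Or.inr hi.ne') _).congr' ?_
    filter_upwards [him.eventually (lt_mem_nhds hi)] with k hk
    rw [rootBranch, if_pos hk.le, shift_eq_zero_of_im (by simp) (hz hi.ne'), Nat.cast_zero,
      add_zero]

end rootBranch

/-- A chart around an end point `s` of the slit, where the numbers of passages to its right and to
its left differ by one. -/
lemma hasOrderAt_end [NeZero d] (hx : 0 < x) {s ε : ℝ} (hε : 0 < ε) (hε' : ε < 1 / 2)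
    (hs : IsEnd x (toTorus s)) (hsk : ∀ h : ℂ, h ≠ 0 → ‖h‖ < ε → ¬ IsEnd x (toTorus (s + h)))
    {φ ψ : Equiv.Perm (ZMod d)}
    (hr : ∀ h : ℝ, 0 < h → h < ε → ∀ j, ψ (j + (passes x (toTorus (s + h)) : ℕ)) = φ j)
    (hl : ∀ h : ℝ, -ε < h → h < 0 → ∀ j, ψ (j + (passes x (toTorus (s + h)) : ℕ)) = φ j + 1)
    (j₀ : ZMod d) : (connectedSum d x).HasOrderAt (pt d x (toTorus s) j₀) (d - 1) := by
  set e : Space d x → ℂ := fun y =>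
    rootBranch d φ ψ (centeredLift (toBase d (x : ℂ) y - toTorus s)) (sheet y) with he
  have he' {h : ℂ} (hh : ‖h‖ < ε) (j : ZMod d) :
      e (pt d x (toTorus (s + h)) j) = rootBranch d φ ψ h j := by
    simp only [he, toBase_pt]
    rw [← toTorus_sub, add_sub_cancel_left, centeredLift_toTorus (hh.trans hε')]
    rcases eq_or_ne h 0 with rfl | h0
    · rw [rootBranch_zero, rootBranch_zero]
    · rw [sheet_pt (hsk h h0 hh)]
  have hepow (y : Space d x) : toBase d (x : ℂ) y = toTorus s + toTorus (e y ^ d) := by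
    rw [he, rootBranch_pow, toTorus_centeredLift, add_sub_cancel]
  let N : Set ℂ → Set (Space d x) := fun V => toBase d (x : ℂ) ⁻¹' (toTorus '' V)
  have hN {V : Set ℂ} {y : Space d x} (hy : y ∈ N V) :
      ∃ h j, (s : ℂ) + h ∈ V ∧ pt d x (toTorus (s + h)) j = y := by
    obtain ⟨w, j, rfl⟩ := exists_pt y
    obtain ⟨z, hz, e⟩ := hy
    rw [toBase_pt] at e
    exact ⟨z - s, j, by rwa [add_sub_cancel], by rw [add_sub_cancel, e]⟩
  have hNo {V : Set ℂ} (hV : IsOpen V) : IsOpen (N V) :=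
    (isOpenMap_toTorus V hV).preimage continuous_toBase
  have hcont : ContinuousOn e (N (Metric.ball s ε)) := by
    refine continuousOn_of_tendsto (hNo Metric.isOpen_ball) ?_ ?_
    · intro z j hzN hzend k
      obtain ⟨h, i, hh, e1⟩ := hN hzN
      have hh : ‖h‖ < ε := by simpa [dist_eq_norm] using hh
      have e2 := (pt_eq_pt_iff.1 e1).1
      have h0 : h = 0 := by
        by_contra h0
        exact hsk h h0 hh (e2 ▸ hzend)
      subst h0
      rw [add_zero] at e2
      have h1 : e (pt d x (toTorus z) j) = 0 := by
        have := he' (h := 0) (by simpa using hε) j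
        rwa [add_zero, e2, rootBranch_zero] at this
      rw [h1, tendsto_zero_iff_norm_tendsto_zero]
      have hroot : Tendsto (fun h : ℂ => ‖h‖ ^ ((d : ℝ)⁻¹)) (𝓝 0) (𝓝 0) := by
        have hd : (0 : ℝ) < (d : ℝ)⁻¹ := by
          have : 0 < d := Nat.pos_of_ne_zero (NeZero.ne d)
          positivity
        have hc : Continuous (fun h : ℂ => ‖h‖ ^ ((d : ℝ)⁻¹)) :=
          continuous_norm.rpow_const fun _ => Or.inr hd.le
        simpa [Real.zero_rpow hd.ne'] using hc.tendsto 0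
      refine hroot.congr' ?_
      filter_upwards [Metric.ball_mem_nhds (0 : ℂ) hε] with h hh
      have hh : ‖h‖ < ε := by simpa using hh
      rw [toTorus_add, ← e2, ← toTorus_add, he' hh]
      conv_lhs => rw [← rootBranch_pow (φ := φ) (ψ := ψ) h k, norm_pow]
      rw [Real.pow_rpow_inv_natCast (norm_nonneg _) (NeZero.ne d)]
    · intro z j hzN hzend
      obtain ⟨h, i, hh, e1⟩ := hN hzN
      have hh : ‖h‖ < ε := by simpa [dist_eq_norm] using hh
      have e2 := (pt_eq_pt_iff.1 e1).1
      have h0 : h ≠ 0 := by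
        rintro rfl
        rw [add_zero] at e2
        exact hzend (e2 ▸ hs)
      have key := tendsto_rootBranch (φ := φ) (ψ := ψ) hx h0 (z := s + h) (fun hi =>
          im_add_ne (k := 0) (by simp) hi (hh.trans (hε'.trans (by norm_num))))
        (fun hi hp => by
          have := hr h.re hp ((Complex.re_le_norm h).trans_lt hh)
          rwa [show ((h.re : ℝ) : ℂ) = h from Complex.ext (by simp) (by simp [hi])] at this)
        (fun hi hp => by
          have := hl h.re (by linarith [neg_abs_le h.re, Complex.abs_re_le_norm h]) hp
          rwa [show ((h.re : ℝ) : ℂ) = h from Complex.ext (by simp) (by simp [hi])] at this) j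
      have h1 : e (pt d x (toTorus z) j) = rootBranch d φ ψ h j := by rw [← e2, he' hh]
      rw [h1]
      refine key.congr' ?_
      have hball : ∀ᶠ k in 𝓝 (0 : ℂ), ‖h + k‖ < ε := by
        have : Continuous (fun k : ℂ => ‖h + k‖) := by fun_prop
        exact (this.tendsto 0).eventually (gt_mem_nhds (by simpa using hh))
      filter_upwards [hball] with k hk
      rw [toTorus_add z k, ← e2, ← toTorus_add, add_assoc, he' hk]
  have hδ : ε / 2 < ε := by linarith
  have hδ0 : 0 < ε / 2 := by linarith
  have hKO : N (Metric.closedBall s (ε / 2)) ⊆ N (Metric.ball s ε) :=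
    Set.preimage_mono (Set.image_mono (Metric.closedBall_subset_ball hδ))
  have hK : IsCompact (N (Metric.closedBall s (ε / 2))) := by
    refine IsClosed.isCompact (IsClosed.preimage continuous_toBase ?_)
    exact ((isCompact_closedBall _ _).image continuous_toTorus).isClosed
  have hinj : Set.InjOn e (N (Metric.closedBall s (ε / 2))) := by
    intro y hy y' hy' hyy
    obtain ⟨h, j, hh, rfl⟩ := hN hy
    obtain ⟨h', j', hh', rfl⟩ := hN hy'
    have hh : ‖h‖ < ε := lt_of_le_of_lt (by simpa [dist_eq_norm] using hh) hδ
    have hh' : ‖h'‖ < ε := lt_of_le_of_lt (by simpa [dist_eq_norm] using hh') hδ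
    rw [he' hh, he' hh'] at hyy
    have : h = h' := by
      rw [← rootBranch_pow (φ := φ) (ψ := ψ) h j, hyy, rootBranch_pow]
    subst this
    rcases eq_or_ne h 0 with rfl | h0
    · rw [add_zero]
      exact pt_eq_of_isEnd hs _ _
    · rw [rootBranch_injective h0 hyy]
  have himage : e '' N (Metric.ball s (ε / 2)) = {w | ‖w ^ d‖ < ε / 2} := by
    ext w
    constructor
    · rintro ⟨y, hy, rfl⟩
      obtain ⟨h, j, hh, rfl⟩ := hN hy
      have hh : ‖h‖ < ε / 2 := by simpa [dist_eq_norm] using hh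
      rw [Set.mem_ofPred_eq, he' (hh.trans hδ), rootBranch_pow]
      exact hh
    · intro hw
      obtain ⟨j, hj⟩ := exists_rootBranch_eq (φ := φ) (ψ := ψ) w
      refine ⟨pt d x (toTorus (s + w ^ d)) j, ⟨s + w ^ d, ?_, rfl⟩, ?_⟩
      · simpa [dist_eq_norm] using hw
      · rw [he' (lt_trans hw hδ), hj]
  have : Nonempty (Space d x) := ⟨pt d x (toTorus s) j₀⟩
  obtain ⟨Φ, hΦ, hΦe⟩ := exists_openPartialHomeomorph hK (hNo Metric.isOpen_ball)
    (Set.preimage_mono (Set.image_mono Metric.ball_subset_closedBall)) (hcont.mono hKO) hinj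
    (by rw [himage]; exact isOpen_lt (by fun_prop) continuous_const)
  refine ⟨Φ, ?_, ?_, ?_⟩
  · rw [hΦ]
    exact ⟨s, Metric.mem_ball_self hδ0, rfl⟩
  · have := he' (h := 0) (by simpa using hε) j₀
    rw [add_zero, rootBranch_zero] at this
    exact (hΦe _).trans this
  · intro y _
    have h1 : Φ y = e y := hΦe y
    have h2 : toBase d (x : ℂ) y = toTorus s + toTorus (Φ y ^ (d - 1 + 1)) := by
      rw [Nat.sub_add_cancel (Nat.pos_of_ne_zero (NeZero.ne d)), h1]
      exact hepow y
    exact h2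

/-- The two ends of a real slit of non-integral length are zeros of order `d - 1`. -/
lemma hasOrderAt_p₀_p₁ [NeZero d] (hx : 0 < x) (hxi : ∀ k : ℤ, x ≠ k) :
    (connectedSum d x).HasOrderAt (connectedSum d x).p₀ (d - 1) ∧
      (connectedSum d x).HasOrderAt (connectedSum d x).p₁ (d - 1) := by
  have h0 : (⌊x⌋ : ℝ) < x := lt_of_le_of_ne (Int.floor_le x) (hxi _).symm
  have h1 := Int.lt_floor_add_one x
  obtain ⟨ε, hε, hε', hεl, hεr⟩ : ∃ ε : ℝ, 0 < ε ∧ ε < 1 / 2 ∧ ε ≤ x - ⌊x⌋ ∧ ε ≤ ⌊x⌋ + 1 - x := by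
    refine ⟨min (1 / 3) (min (x - ⌊x⌋) (⌊x⌋ + 1 - x)), ?_, ?_, ?_, ?_⟩
    · exact lt_min (by norm_num) (lt_min (by linarith) (by linarith))
    · exact (min_le_left _ _).trans_lt (by norm_num)
    · exact (min_le_right _ _).trans (min_le_left _ _)
    · exact (min_le_right _ _).trans (min_le_right _ _)
  have hsmall {h : ℂ} (hh : h ≠ 0) (hhε : ‖h‖ < ε) : h ∉ gaussianLattice := fun hm =>
    hh (eq_of_toTorus_eq (hhε.trans hε') (by norm_num) (toTorus_eq_zero_iff.2 hm))
  have hre {h : ℂ} (hhε : ‖h‖ < ε) : |h.re| < ε := (Complex.abs_re_le_norm h).trans_lt hhε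
  have hne {y : ℝ} (a : (⌊x⌋ : ℝ) < y) (b : y < ⌊x⌋ + 1) (k : ℤ) : y ≠ k := by
    rintro rfl
    have a : ⌊x⌋ < k := by exact_mod_cast a
    have b : k < ⌊x⌋ + 1 := by exact_mod_cast b
    lia
  have hend0 (h : ℂ) (hh : h ≠ 0) (hhε : ‖h‖ < ε) : ¬ IsEnd x (toTorus ((0 : ℝ) + h)) := by
    rw [Complex.ofReal_zero, zero_add, isEnd_toTorus_iff, mem_gaussianLattice (z := h - x)]
    rintro (hm | ⟨a, b, ha, -⟩)
    · exact hsmall hh hhε hm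
    · have := abs_lt.1 (hre hhε)
      rw [Complex.sub_re, Complex.ofReal_re] at ha
      exact hne (y := x - h.re) (by linarith) (by linarith) (-a) (by push_cast; linarith)
  have hend1 (h : ℂ) (hh : h ≠ 0) (hhε : ‖h‖ < ε) : ¬ IsEnd x (toTorus (x + h)) := by
    rw [isEnd_toTorus_iff, add_sub_cancel_left, mem_gaussianLattice (z := x + h)]
    rintro (⟨a, b, ha, -⟩ | hm)
    · have := abs_lt.1 (hre hhε)
      rw [Complex.add_re, Complex.ofReal_re] at ha
      exact hne (y := x + h.re) (by linarith) (by linarith) a ha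
    · exact hsmall hh hhε hm
  have hnorm {h : ℝ} (a : -ε < h) (b : h < ε) : ‖(h : ℂ)‖ < ε := by
    rw [Complex.norm_real, Real.norm_eq_abs, abs_lt]
    exact ⟨a, b⟩
  have hq {y : ℝ} (a : (⌊x⌋ : ℝ) < y) (b : y < ⌊x⌋ + 1) : ⌊y⌋ = ⌊x⌋ :=
    Int.floor_eq_iff.2 ⟨a.le, b⟩
  have hq' {y : ℝ} (a : (⌊x⌋ : ℝ) < y) (b : y < ⌊x⌋ + 1) : ⌊-y⌋ = -⌊x⌋ - 1 := by
    rw [floor_neg_of_ne (hne a b), hq a b]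
  have hm1 {y : ℝ} (a : 0 < y) (b : y < ε) : ⌊-y⌋ = -1 :=
    Int.floor_eq_iff.2 ⟨by push_cast; linarith, by push_cast; linarith⟩
  have hm0 {y : ℝ} (a : -ε < y) (b : y < 0) : ⌊-y⌋ = 0 :=
    Int.floor_eq_iff.2 ⟨by push_cast; linarith, by push_cast; linarith⟩
  -- The numbers of passages, to both sides of both ends.
  have p0 {h : ℝ} (a : -ε < h) (b : h < ε) (hh : h ≠ 0) :
      ((passes x (toTorus ((0 : ℝ) + h)) : ℕ) : ZMod d) = ((⌊x - h⌋ - ⌊-h⌋ : ℤ) : ZMod d) := by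
    have := passes_real hx (z := (0 : ℝ) + h) (k := 0) (by simp)
      (hend0 h (by exact_mod_cast hh) (hnorm a b))
    rw [← Int.cast_natCast, this]
    simp
  have p1 {h : ℝ} (a : -ε < h) (b : h < ε) (hh : h ≠ 0) :
      ((passes x (toTorus (x + h)) : ℕ) : ZMod d) = ((⌊-h⌋ - ⌊-(x + h)⌋ : ℤ) : ZMod d) := by
    have := passes_real hx (z := x + h) (k := 0) (by simp)
      (hend1 h (by exact_mod_cast hh) (hnorm a b))
    rw [← Int.cast_natCast, this]
    simp
  constructor
  · have := hasOrderAt_end (d := d) hx hε hε' (s := 0) (Or.inl (by simp)) hend0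
      (φ := Equiv.neg _) (ψ := Equiv.subLeft ((⌊x⌋ : ZMod d) + 1))
      (fun h a b j => by
        rw [p0 (by linarith) b a.ne', hm1 a b, hq (y := x - h) (by linarith) (by linarith)]
        simp only [Equiv.subLeft_apply, Equiv.neg_apply]
        push_cast
        ring)
      (fun h a b j => by
        rw [p0 a (by linarith) b.ne, hm0 a b, hq (y := x - h) (by linarith) (by linarith)]
        simp only [Equiv.subLeft_apply, Equiv.neg_apply]
        push_cast
        ring) 0
    rw [Complex.ofReal_zero] at this
    exact this
  · exact hasOrderAt_end (d := d) hx hε hε' (s := x) (Or.inr rfl) hend1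
      (φ := Equiv.refl _) (ψ := Equiv.subRight (⌊x⌋ : ZMod d))
      (fun h a b j => by
        rw [p1 (by linarith) b a.ne', hm1 a b, hq' (y := x + h) (by linarith) (by linarith)]
        simp only [Equiv.subRight_apply, Equiv.refl_apply]
        push_cast
        ring)
      (fun h a b j => by
        rw [p1 a (by linarith) b.ne, hm0 a b, hq' (y := x + h) (by linarith) (by linarith)]
        simp only [Equiv.subRight_apply, Equiv.refl_apply]
        push_cast
        ring) 0

end ConnectedSum

namespace ConnectedSum

open EllipticDifferential

variable {d : ℕ} {x : ℝ}

/-! ### Slits of integral length -/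

lemma isEnd_intCast_iff {m : ℤ} {z : SquareTorus} : IsEnd (m : ℝ) z ↔ z = 0 := by
  have : toTorus (m : ℝ) = 0 :=
    toTorus_eq_zero_iff.2 (mem_gaussianLattice.2 ⟨m, 0, by simp, by simp⟩)
  rw [IsEnd, this, toTorus_zero, or_self]

lemma toTorus_ne_zero {h : ℂ} (h0 : h ≠ 0) (hh : ‖h‖ < 1 / 4) : toTorus h ≠ 0 := fun e =>
  h0 (eq_of_toTorus_eq (hh.trans (by norm_num)) (by norm_num) (e.trans toTorus_zero.symm))

/-- The difference between the sheet and the disc that contain a point at `h` from the ends of a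
slit of length `m`: the upper half of each disc is in the sheet of the same number, and the lower
half `m` sheets above it. -/
def discShift (d : ℕ) (m : ℤ) (h : ℂ) : ZMod d :=
  open Classical in if h.im < 0 then -(m : ZMod d) else 0

/-- A small path around the end of a slit of length `m` crosses the slit once upwards and once
downwards, each time with `m` passages, and so closes up in every sheet. -/
lemma eventually_discShift_add {m : ℤ} (hm : 0 < m) {h : ℂ} (h0 : h ≠ 0) (hh : ‖h‖ < 1 / 4) :
    ∀ᶠ k in 𝓝 (0 : ℂ), ((shift (m : ℝ) (toTorus h) k : ℕ) : ZMod d) + discShift d m (h + k) =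
      discShift d m h := by
  have hm' : (0 : ℝ) < m := by exact_mod_cast hm
  have hi : |h.im| < 1 := (Complex.abs_im_le_norm h).trans_lt (hh.trans (by norm_num))
  have ht : Tendsto (fun k : ℂ => (h + k).im) (𝓝 0) (𝓝 h.im) := by
    have : Continuous fun k : ℂ => (h + k).im := by fun_prop
    simpa using this.tendsto 0
  by_cases him : h.im = 0
  · have hend : ¬ IsEnd (m : ℝ) (toTorus h) := by
      rw [isEnd_intCast_iff]
      exact toTorus_ne_zero h0 hh
    have hp : ((passes (m : ℝ) (toTorus h) : ℕ) : ZMod d) = m := by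
      have := passes_real hm' (k := 0) (by simpa using him) hend
      rw [sub_eq_add_neg (m : ℝ), Int.floor_intCast_add, add_sub_cancel_right] at this
      rw [← Int.cast_natCast, this]
    refine Eventually.of_forall fun k => ?_
    rw [shift_real hm']
    simp only [discShift, Complex.add_im, him, zero_add, lt_irrefl, if_false]
    split_ifs
    · rw [hp, add_neg_cancel]
    · simp
  · have hs : ∀ k : ℤ, h.im ≠ k := by
      rintro k hk
      rw [hk] at hi him
      exact him (by exact_mod_cast Int.abs_lt_one_iff.1 (by exact_mod_cast hi))
    have hd : ∀ᶠ k in 𝓝 (0 : ℂ), ((h + k).im < 0 ↔ h.im < 0) := by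
      rcases lt_or_gt_of_ne him with hl | hg
      · filter_upwards [ht.eventually (gt_mem_nhds hl)] with k hk
        exact ⟨fun _ => hl, fun _ => hk⟩
      · filter_upwards [ht.eventually (lt_mem_nhds hg)] with k hk
        exact ⟨fun a => absurd a hk.not_gt, fun a => absurd a hg.not_gt⟩
    filter_upwards [hd] with k hk
    rw [shift_eq_zero_of_im (by simp) hs, Nat.cast_zero, zero_add]
    simp only [discShift, hk]

/-- The two ends of a slit of integral length coincide, and near them the connected sum consists of
`d` discs joined at their centres. -/
lemma isUnionOfDiscsAt_p₀ [NeZero d] {m : ℤ} (hm : 0 < m) :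
    (connectedSum d (m : ℝ)).IsUnionOfDiscsAt (connectedSum d (m : ℝ)).p₀ d := by
  have hm' : (0 : ℝ) < m := by exact_mod_cast hm
  let U : Set (Space d (m : ℝ)) := toBase d (m : ℝ) ⁻¹' (toTorus '' Metric.ball 0 (1 / 4))
  let o : Space d (m : ℝ) := pt d (m : ℝ) (toTorus 0) 0
  have hU : IsOpen U :=
    (isOpenMap_toTorus _ Metric.isOpen_ball).preimage continuous_toBase
  have hoU : o ∈ U := ⟨0, Metric.mem_ball_self (by norm_num), rfl⟩
  have hUexists {y : Space d (m : ℝ)} (hy : y ∈ U) :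
      ∃ (h : ℂ) (j : ZMod d), ‖h‖ < 1 / 4 ∧ y = pt d (m : ℝ) (toTorus h) j := by
    obtain ⟨z, j, rfl⟩ := exists_pt y
    obtain ⟨h, hh, e⟩ := hy
    exact ⟨h, j, by simpa using hh, by rw [e, toBase_pt]⟩
  have hne {h : ℂ} {j : ZMod d} : pt d (m : ℝ) (toTorus h) j ≠ o → h ≠ 0 := by
    rintro H rfl
    exact H (pt_eq_of_isEnd (Or.inl rfl) _ _)
  have hend {h : ℂ} (h0 : h ≠ 0) (hh : ‖h‖ < 1 / 4) : ¬ IsEnd (m : ℝ) (toTorus h) := by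
    rw [isEnd_intCast_iff]
    exact toTorus_ne_zero h0 hh
  have hVexists {y : Space d (m : ℝ)} (hy : y ∈ U \ {o}) :
      ∃ (h : ℂ) (j : ZMod d), h ≠ 0 ∧ ‖h‖ < 1 / 4 ∧ y = pt d (m : ℝ) (toTorus h) j := by
    obtain ⟨h, j, hh, rfl⟩ := hUexists hy.1
    exact ⟨h, j, hne hy.2, hh, rfl⟩
  have hmem {h : ℂ} (h0 : h ≠ 0) (hh : ‖h‖ < 1 / 4) (j : ZMod d) :
      pt d (m : ℝ) (toTorus h) j ∈ U \ {o} :=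
    ⟨⟨h, by simpa using hh, rfl⟩, fun e => toTorus_ne_zero h0 hh (pt_eq_pt_iff.1 e).1⟩
  have hcl {h : ℂ} (hh : ‖h‖ < 1 / 4) : centeredLift (toTorus h) = h :=
    centeredLift_toTorus (hh.trans (by norm_num))
  let c : Space d (m : ℝ) → ℂ := fun y => centeredLift (toBase d (m : ℝ) y)
  have hc {h : ℂ} (hh : ‖h‖ < 1 / 4) (j : ZMod d) : c (pt d (m : ℝ) (toTorus h) j) = h := hcl hh
  have hccont : ContinuousOn c U := by
    intro y hy
    obtain ⟨h, j, hh, rfl⟩ := hUexists hy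
    refine ContinuousAt.continuousWithinAt ?_
    refine ContinuousAt.comp (g := centeredLift) ?_ continuous_toBase.continuousAt
    rw [toBase_pt]
    exact continuousAt_centeredLift (hh.trans (by norm_num))
  let σ : Space d (m : ℝ) → ZMod d := fun y => sheet y + discShift d m (c y)
  have hσ {h : ℂ} (h0 : h ≠ 0) (hh : ‖h‖ < 1 / 4) (j : ZMod d) :
      σ (pt d (m : ℝ) (toTorus h) j) = j + discShift d m h := by
    simp only [σ, sheet_pt (hend h0 hh), hc hh]
  have hball {h : ℂ} (h0 : h ≠ 0) (hh : ‖h‖ < 1 / 4) :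
      ∀ᶠ k in 𝓝 (0 : ℂ), h + k ≠ 0 ∧ ‖h + k‖ < 1 / 4 := by
    have h1 : Tendsto (fun k : ℂ => h + k) (𝓝 0) (𝓝 h) := by
      have : Continuous fun k : ℂ => h + k := by fun_prop
      simpa using this.tendsto 0
    exact (h1.eventually_ne h0).and (h1.norm.eventually (gt_mem_nhds hh))
  have : T2Space (Space d (m : ℝ)) := t2Space hm'
  have hV : IsOpen (U \ {o}) := hU.sdiff isClosed_singleton
  have hσcont : ContinuousOn σ (U \ {o}) := by
    refine continuousOn_of_tendsto hV ?_ ?_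
    · intro z j hz he
      exact absurd (pt_eq_pt_iff.2 ⟨isEnd_intCast_iff.1 he, Or.inl he⟩) hz.2
    · intro z j hz he
      obtain ⟨h, k, h0, hh, e⟩ := hVexists hz
      have e : toTorus z = toTorus h := (pt_eq_pt_iff.1 e).1
      rw [e, hσ h0 hh]
      refine tendsto_const_nhds.congr' ?_
      filter_upwards [eventually_discShift_add (d := d) hm h0 hh, hball h0 hh] with k hk hk'
      rw [toTorus_add, e, ← toTorus_add, hσ hk'.1 hk'.2, add_assoc, hk]
  let E : Fin d ≃ ZMod d := (ZMod.finEquiv d).toEquiv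
  have hquarter {w : ℂ} (h0 : 0 < ‖w‖) (h1 : ‖w‖ < 1) : w / 4 ≠ 0 ∧ ‖w / 4‖ < 1 / 4 :=
    ⟨div_ne_zero (norm_pos_iff.1 h0) (by norm_num), by rw [norm_div]; norm_num; linarith⟩
  let F : (U \ {o} : Set (Space d (m : ℝ))) ≃ₜ Fin d × {z : ℂ // 0 < ‖z‖ ∧ ‖z‖ < 1} :=
    { toFun := fun y => (E.symm (σ y), ⟨4 * c y, by
        obtain ⟨h, j, h0, hh, e⟩ := hVexists y.2
        rw [e, hc hh, norm_mul]
        norm_num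
        exact ⟨h0, by linarith⟩⟩)
      invFun := fun p => ⟨pt d (m : ℝ) (toTorus (p.2 / 4)) (E p.1 - discShift d m (p.2 / 4)),
        hmem (hquarter p.2.2.1 p.2.2.2).1 (hquarter p.2.2.1 p.2.2.2).2 _⟩
      left_inv := by
        rintro ⟨y, hy⟩
        obtain ⟨h, j, h0, hh, rfl⟩ := hVexists hy
        apply Subtype.ext
        simp only [hσ h0 hh, hc hh, Equiv.apply_symm_apply]
        rw [mul_div_cancel_left₀ h (by norm_num), add_sub_cancel_right]
      right_inv := by
        rintro ⟨i, w, h0, h1⟩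
        obtain ⟨h2, h3⟩ := hquarter h0 h1
        refine Prod.ext ?_ (Subtype.ext ?_)
        · simp only [hσ h2 h3, sub_add_cancel, Equiv.symm_apply_apply]
        · simp only [hc h3]
          exact mul_div_cancel₀ w (by norm_num)
      continuous_toFun := by
        refine Continuous.prodMk ?_ (Continuous.subtype_mk ?_ _)
        · exact continuous_of_discreteTopology.comp
            (continuousOn_iff_continuous_domRestrict.1 hσcont)
        · exact continuous_const.mul
            (continuousOn_iff_continuous_domRestrict.1 (hccont.mono Set.sdiff_subset))
      continuous_invFun := by
        refine Continuous.subtype_mk ?_ _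
        rw [continuous_iff_continuousAt]
        rintro ⟨i, w, h0, h1⟩
        obtain ⟨h2, h3⟩ := hquarter h0 h1
        refine continuousAt_pt (γ := fun p : Fin d × {z : ℂ // 0 < ‖z‖ ∧ ‖z‖ < 1} => (p.2 : ℂ) / 4)
          (j := fun p => E p.1 - discShift d m (p.2 / 4)) (by fun_prop) fun _ => ?_
        have ht : Tendsto
            (fun p : Fin d × {z : ℂ // 0 < ‖z‖ ∧ ‖z‖ < 1} => (p.2 : ℂ) / 4 - w / 4)
            (𝓝 (i, ⟨w, h0, h1⟩)) (𝓝 0) := by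
          have : Continuous
              fun p : Fin d × {z : ℂ // 0 < ‖z‖ ∧ ‖z‖ < 1} => (p.2 : ℂ) / 4 - w / 4 := by fun_prop
          simpa using this.tendsto (i, ⟨w, h0, h1⟩)
        have hi : ∀ᶠ p : Fin d × {z : ℂ // 0 < ‖z‖ ∧ ‖z‖ < 1} in 𝓝 (i, ⟨w, h0, h1⟩), p.1 = i :=
          continuous_fst.continuousAt.eventually
            ((isOpen_discrete {i}).mem_nhds (Set.mem_singleton i))
        filter_upwards [ht.eventually (eventually_discShift_add (d := d) hm h2 h3), hi]
          with p hp hpi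
        rw [add_sub_cancel] at hp
        simp only [hpi, ← hp]
        abel }
  refine ⟨U, hU, ⟨⟨o, hoU⟩, ?_⟩, hoU, ⟨F⟩⟩
  refine isPreconnected_of_forall o fun y hy => ?_
  obtain ⟨h, j, hh, rfl⟩ := hUexists hy
  refine ⟨(fun t : ℝ => pt d (m : ℝ) (toTorus (t * h)) j) '' Set.Icc 0 1, ?_,
    ⟨0, by simp, ?_⟩, ⟨1, by simp, ?_⟩,
    exists_isPreconnected_segment hm' (h := h)
      ((Complex.abs_im_le_norm h).trans_lt (hh.trans (by norm_num))) j⟩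
  · rintro _ ⟨t, ht, rfl⟩
    refine ⟨t * h, ?_, rfl⟩
    rw [mem_ball_zero_iff, norm_mul, Complex.norm_real, Real.norm_of_nonneg ht.1]
    nlinarith [ht.2, norm_nonneg h]
  · simp only [Complex.ofReal_zero, zero_mul]
    exact pt_eq_of_isEnd (Or.inl rfl) _ _
  · simp only [Complex.ofReal_one, one_mul]
    rfl

/-! ### Regular and degenerate symmetric differentials -/

lemma hasOrderAt_of_ne [NeZero d] (hx : 0 < x) (y : Space d x)
    (h0 : y ≠ (connectedSum d x).p₀) (h1 : y ≠ (connectedSum d x).p₁) :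
    (connectedSum d x).HasOrderAt y 0 := by
  obtain ⟨z, j, rfl⟩ := exists_pt y
  exact hasOrderAt_zero hx (fun he => (eq_p₀_or_p₁_iff.2 he).elim h0 h1) j

lemma isRegularSymmetric [NeZero d] (hx : 0 < x) (hxi : ∀ k : ℤ, x ≠ k) :
    (connectedSum d x).IsRegularSymmetric d := by
  have hne : (connectedSum d x).p₀ ≠ (connectedSum d x).p₁ := by
    intro h
    have h1 : toTorus 0 = toTorus x := (pt_eq_pt_iff.1 h).1
    obtain ⟨a, b, ha, -⟩ := toTorus_eq_iff_int.1 h1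
    exact hxi (-a) (by push_cast; rw [← ha]; simp)
  exact ⟨inferInstanceAs (CompactSpace (Space d x)), t2Space hx, connectedSpace hx,
    continuous_toBase, periods_eq hx, hne, (hasOrderAt_p₀_p₁ hx hxi).1,
    (hasOrderAt_p₀_p₁ hx hxi).2, hasOrderAt_of_ne hx, hasCyclicSymmetry _, hasDegree _⟩

lemma isDegenerateSymmetric (hd : 2 ≤ d) {m : ℤ} (hm : 0 < m) :
    (connectedSum d (m : ℝ)).IsDegenerateSymmetric d := by
  have : NeZero d := ⟨by lia⟩
  have hx : (0 : ℝ) < m := by exact_mod_cast hm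
  have hp : (connectedSum d (m : ℝ)).p₀ = (connectedSum d (m : ℝ)).p₁ :=
    pt_eq_pt_iff.2 ⟨(isEnd_intCast_iff.1 (Or.inr rfl)).symm, Or.inl (Or.inl rfl)⟩
  exact ⟨inferInstanceAs (CompactSpace (Space d (m : ℝ))), t2Space hx, connectedSpace hx,
    continuous_toBase, hd, hp, isUnionOfDiscsAt_p₀ hm,
    fun y hy => hasOrderAt_of_ne hx y hy (hp ▸ hy), hasCyclicSymmetry _, hasDegree _,
    exists_iterate_eq⟩

lemma not_isDegenerate [NeZero d] (hx : 0 < x) (hxi : ∀ k : ℤ, x ≠ k) :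
    ¬ (connectedSum d x).IsDegenerate := by
  have : T2Space (connectedSum d x).carrier := t2Space hx
  rintro ⟨s, rfl | rfl, k, hk, h⟩
  · exact (hasOrderAt_p₀_p₁ hx hxi).1.not_isUnionOfDiscsAt hk h
  · exact (hasOrderAt_p₀_p₁ hx hxi).2.not_isUnionOfDiscsAt hk h

end ConnectedSum
end

theorem mainTheorem5 (g n : ℕ) (hg : 0 < g) (hn : 2 ≤ n) :
    -- existence, with degenerate differentials admitted
    (∃ Y : EllipticDifferential,
      (Y.IsRegularSymmetric g ∧ Y.veechGroup = realGamma1 n) ∨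
      (Y.IsDegenerateSymmetric g ∧ Y.symmetricVeechGroup = realGamma1 n)) ∧
    -- the example
    (connectedSum g ((g : ℂ) / n)).symmetricVeechGroup = realGamma1 n ∧
    (¬ n ∣ g → (connectedSum g ((g : ℂ) / n)).IsRegularSymmetric g ∧
      (connectedSum g ((g : ℂ) / n)).veechGroup = realGamma1 n) ∧
    (n ∣ g → (connectedSum g ((g : ℂ) / n)).IsDegenerateSymmetric g) ∧
    ((connectedSum g ((g : ℂ) / n)).IsDegenerate ↔ n ∣ g) ∧
    -- its isomorphism class is the point `[g / n]` of `ℂ / g (ℤ ⊕ ℤ i)`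
    (∀ v : ℂ, (connectedSum g v).Isomorphic (connectedSum g ((g : ℂ) / n)) ↔
      ∃ w ∈ gaussianLattice, v - (g : ℂ) / n = g * w) := by
  have : NeZero g := ⟨hg.ne'⟩
  have hn0 : n ≠ 0 := by lia
  have hv : (g : ℂ) / n = ((g : ℝ) / n : ℝ) := by push_cast; rfl
  have hx : (0 : ℝ) < (g : ℝ) / n := by positivity
  have hsymm : (connectedSum g ((g : ℂ) / n)).symmetricVeechGroup = realGamma1 n :=
    ConnectedSum.symmetricVeechGroup_eq hn hv
  have hreg (h : ¬ n ∣ g) : (connectedSum g ((g : ℂ) / n)).IsRegularSymmetric g ∧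
      (connectedSum g ((g : ℂ) / n)).veechGroup = realGamma1 n := by
    refine ⟨?_, ConnectedSum.veechGroup_eq hn h hv⟩
    rw [hv]
    exact ConnectedSum.isRegularSymmetric hx (ConnectedSum.div_ne_int_of_not_dvd hn0 h)
  have hdeg (h : n ∣ g) : (connectedSum g ((g : ℂ) / n)).IsDegenerateSymmetric g := by
    obtain ⟨m, hm⟩ := id h
    have hm0 : 0 < m := Nat.pos_of_ne_zero fun e => hg.ne' (by rw [hm, e, mul_zero])
    have hxm : (g : ℝ) / n = ((m : ℤ) : ℝ) := by
      rw [div_eq_iff (Nat.cast_ne_zero.2 hn0), hm]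
      push_cast
      ring
    rw [hv, hxm]
    exact ConnectedSum.isDegenerateSymmetric (hn.trans (Nat.le_of_dvd hg h))
      (by exact_mod_cast hm0)
  refine ⟨⟨connectedSum g ((g : ℂ) / n), ?_⟩, hsymm, hreg, hdeg, ⟨fun hY => ?_, fun h => ?_⟩,
    ConnectedSum.isomorphic_iff hn hv⟩
  · by_cases h : n ∣ g
    · exact Or.inr ⟨hdeg h, hsymm⟩
    · exact Or.inl (hreg h)
  · by_contra h
    rw [hv] at hY
    exact ConnectedSum.not_isDegenerate hx (ConnectedSum.div_ne_int_of_not_dvd hn0 h) hY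
  · obtain ⟨-, -, -, -, hd, -, hdisc, -⟩ := hdeg h
    exact ⟨_, Or.inl rfl, g, hd, hdisc⟩
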